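/- **Setting.** Let $\mathcal T=\prod_{k\ge 0}(\mathbb R^d)^{\otimes k}$ be the algebra of tensor series $\mathbf x=\sum_w \mathbf x^w e_w$ ($w$ ranging over words in $\{1,\dots,d\}$, $e_we_{w'}=e_{ww'}$), with levels $\mathbf x^{(n)}=\sum_{|w|=n}\mathbf x^we_w$, and let $\mathcal T_0$, $\mathcal T_1$ be the series with scalar component $0$, $1$. Write $[\mathbf x,\mathbf y]=\mathbf x\mathbf y-\mathbf y\mathbf x$, $\operatorname{ad}\mathbf x=[\mathbf x,\cdot]$, and let $\exp:\mathcal T_0\to\mathcal T_1$, $\log:\mathcal T_1\to\mathcal T_0$ be given by the usual power series. Put $$H(\operatorname{ad}\mathbf x)=\sum_{k\ge0}\frac{B_k}{k!}(\operatorname{ad}\mathbf x)^k,\qquad \Psi(A)=\sum_{n\ge0}\frac{(-1)^n}{n+1}(A-\mathrm{Id})^n,$$ with Bernoulli numbers $(B_k)=(1,-\tfrac12,\tfrac16,\dots)$, so that $\Psi(z)=\log z/(z-1)$. Let $T\ge 0$ and let $\mathbf X:[0,T]\to\mathcal T_0$ be deterministic, componentwise càdlàg and of bounded variation, with left limits $\mathbf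 X_{u-}$, jumps $\Delta\mathbf X_u=\mathbf X_u-\mathbf X_{u-}$, increments $\mathbf X_{t,T}=\mathbf X_T-\mathbf X_t$ and continuous part $\mathbf X^c_t=\mathbf X_t-\sum_{0<u\le t}\Delta\mathbf X_u$. All integrals are componentwise Lebesgue–Stieltjes integrals: $\int_{(s,t]} F_u(d\mathbf X_u)=\sum_w\sum_{|v|\le|w|}\int_{(s,t]}F_u(e_v)^w\,d\mathbf X^v_u\;e_w$. For $0\le s\le T$, $\mathrm{Sig}(\mathbf X)_{s,\cdot}$ is the unique componentwise càdlàg solution on $[s,T]$ of $$S_t=1+\int_{(s,t]}S_{u-}\,d\mathbf X_u+\sum_{s<u\le t}S_{u-}\bigl(\exp(\Delta\mathbf X_u)-1-\Delta\mathbf X_u\bigr).$$ **Theorem 5.1.** The signature is well defined (the above equation has exactly one solution for every $s$). The log-signature $\Omega_t=\Omega_t(T)=\log \mathrm{Sig}(\mathbf X)_{t,T}$ is componentwise càdlàg on $[0,T]$ and satisfies, for all $t\in[0,T]$, $$\Omega_t=\int_{(t,T]}H(\operatorname{ad}\Omega_{u-})(d\mathbf X^c_u)+\sum_{t<u\le T}\int_0^1\Psi\bigl(\exp(\operatorname{ad}\theta\Delta\mathbf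 X_u)\circ\exp(\operatorname{ad}\Omega_u)\bigr)(\Delta\mathbf X_u)\,d\theta .$$ The integrals exist, and the sum, over the at most countably many jump times of $\mathbf X$, is (componentwise) absolutely convergent. If $\mathbf X$ is continuous, the sum vanishes and Hausdorff's equation $\Omega_t=\int_t^TH(\operatorname{ad}\Omega_u)(d\mathbf X_u)$ remains. (i) (Jump Magnus expansion.) $\Omega^{(1)}_t=\mathbf X^{(1)}_{t,T}$, and for $n\ge2$ and $t\in[0,T]$ $$\Omega_t^{(n)}=\mathbf X_{t,T}^{(n)}+\sum_{k\ge2}\ \sum_{\substack{\ell=(l_1,\dots,l_k),\ l_i\ge1\\ l_1+\dots+l_k=n}}\bigl(\mathrm{HMag}^1(\mathbf X,\Omega;\ell)_{t,T}+\mathrm{HJmp}(\mathbf X,\Omega;\ell)_{t,T}\bigr),$$ where $$\mathrm{HMag}^1(\mathbf X,\Omega;\ell)_{t,T}=\frac{B_{k-1}}{(k-1)!}\int_{(t,T]}\operatorname{ad}\Omega_{u-}^{(l_2)}\cdots\operatorname{ad}\Omega_{u-}^{(l_k)}\bigl(d\mathbf X_u^{(l_1)}\bigr),$$ $$\mathrm{HJmp}(\mathbf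 X,\Omega;\ell)_{t,T}=\sum_{t<u\le T}\ \sum_{\substack{1\le i\le k,\ 0\le m\le j\le i\\(i,m)\ne(1,1)}}(-1)^{i-j}\frac{B_{k-i}}{(k-i)!}\operatorname{ad}\Omega_{u-}^{(l_{i+1})}\cdots\operatorname{ad}\Omega_{u-}^{(l_k)}\left(\frac{\Delta\mathbf X_u^{(l_1)}\cdots\Delta\mathbf X_u^{(l_m)}\,\Omega_u^{(l_{m+1})}\cdots\Omega_u^{(l_j)}\,\Omega_{u-}^{(l_{j+1})}\cdots\Omega_{u-}^{(l_i)}}{m!\,(j-m)!\,(i-j)!}\right).$$ All these integrals exist, the sums over $u$ converge absolutely, and the right-hand side depends on $\Omega$ only through the levels $\Omega^{(k)}$ with $k<n$. (ii) If $\mathbf X$ takes values in a linear subspace $V\subset\mathcal T_0$, then for all $t\in[0,T]$ $$\Omega_t(T)\in\mathcal L:=\mathrm{Lie}(V),\qquad \mathrm{Sig}(\mathbf X)_{t,T}\in\exp(\mathcal L).$$ Here $\mathrm{Lie}(V)$ is the closed Lie algebra generated by $V$: it consists of the series which, up to every tensor level $N$, agree with an element of the Lie subalgebra of $\mathcal T_0$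 generated by $V$ (for $V=\mathbb R^d$: the free Lie series). -/

import Mathlib

open MeasureTheory Set Filter Topology
open scoped Nat

namespace JumpMagnus

/-- The tensor series `∏ₖ (ℝᵈ)^{⊗k}` over `ℝᵈ`: the series `∑_w x^w e_w` over all words `w` in the
alphabet `Fin d` is stored through its coefficients `x^w`. -/
def TensorSeries (d : ℕ) : Type := List (Fin d) → ℝ

namespace TensorSeries

variable {d : ℕ}

noncomputable instance : AddCommGroup (TensorSeries d) :=
  inferInstanceAs (AddCommGroup (List (Fin d) → ℝ))

noncomputable instance : Module ℝ (TensorSeries d) :=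
  inferInstanceAs (Module ℝ (List (Fin d) → ℝ))

/-- The basis element `e_v` of a word `v`. -/
noncomputable def e (v : List (Fin d)) : TensorSeries d := fun w => if w = v then 1 else 0

/-- The unit is `e_∅`. -/
noncomputable instance : One (TensorSeries d) := ⟨e []⟩

/-- The concatenation product, `(xy)^w = ∑_{w = w₁w₂} x^{w₁} y^{w₂}`. -/
noncomputable instance : Mul (TensorSeries d) :=
  ⟨fun x y w => ∑ i ∈ Finset.range (w.length + 1), x (w.take i) * y (w.drop i)⟩

@[ext] theorem ext {x y : TensorSeries d} (h : ∀ w, x w = y w) : x = y := funext h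

@[simp] theorem zero_apply (w : List (Fin d)) : (0 : TensorSeries d) w = 0 := rfl
@[simp] theorem add_apply (x y : TensorSeries d) (w : List (Fin d)) :
    (x + y) w = x w + y w := rfl
@[simp] theorem neg_apply (x : TensorSeries d) (w : List (Fin d)) : (-x) w = -x w := rfl
@[simp] theorem sub_apply (x y : TensorSeries d) (w : List (Fin d)) :
    (x - y) w = x w - y w := rfl
@[simp] theorem smul_apply (c : ℝ) (x : TensorSeries d) (w : List (Fin d)) :
    (c • x) w = c * x w := rfl
theorem one_apply (w : List (Fin d)) : (1 : TensorSeries d) w = if w = [] then 1 else 0 := rfl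
theorem mul_apply (x y : TensorSeries d) (w : List (Fin d)) :
    (x * y) w = ∑ i ∈ Finset.range (w.length + 1), x (w.take i) * y (w.drop i) := rfl

protected theorem mul_assoc' (x y z : TensorSeries d) : x * y * z = x * (y * z) := by
  ext w
  simp only [mul_apply, Finset.sum_mul, Finset.mul_sum]
  rw [Finset.sum_sigma', Finset.sum_sigma']
  refine Finset.sum_bij' (fun p _ => ⟨p.2, p.1 - p.2⟩) (fun p _ => ⟨p.1 + p.2, p.1⟩)
    ?_ ?_ ?_ ?_ ?_
  · rintro ⟨i, j⟩ h
    simp only [Finset.mem_sigma, Finset.mem_range, List.length_take, List.length_drop] at h ⊢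
    omega
  · rintro ⟨i, j⟩ h
    simp only [Finset.mem_sigma, Finset.mem_range, List.length_take, List.length_drop] at h ⊢
    omega
  · rintro ⟨i, j⟩ h
    simp only [Finset.mem_sigma, Finset.mem_range, List.length_take] at h
    have : j + (i - j) = i := by omega
    simp [this]
  · rintro ⟨i, j⟩ h
    simp
  · rintro ⟨i, j⟩ h
    simp only [Finset.mem_sigma, Finset.mem_range, List.length_take] at h
    have h1 : min j i = j := by omega
    have h2 : j + (i - j) = i := by omega
    simp [List.take_take, List.drop_take, List.drop_drop, h1, h2, mul_assoc]

protected theorem one_mul' (x : TensorSeries d) : 1 * x = x := by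
  ext w
  rw [mul_apply, Finset.sum_eq_single 0]
  · simp [one_apply]
  · intro i hi h0
    rw [one_apply, if_neg, zero_mul]
    intro h
    have := congrArg List.length h
    simp only [Finset.mem_range, List.length_take, List.length_nil] at hi this
    omega
  · simp

protected theorem mul_one' (x : TensorSeries d) : x * 1 = x := by
  ext w
  rw [mul_apply, Finset.sum_eq_single w.length]
  · simp [one_apply]
  · intro i hi h0
    rw [one_apply, if_neg, mul_zero]
    intro h
    have := congrArg List.length h
    simp only [Finset.mem_range, List.length_drop, List.length_nil] at hi this
    omega
  · simp

noncomputable instance : Ring (TensorSeries d) :=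
  { (inferInstance : AddCommGroup (TensorSeries d)),
    (inferInstance : One (TensorSeries d)),
    (inferInstance : Mul (TensorSeries d)) with
    mul_assoc := TensorSeries.mul_assoc'
    one_mul := TensorSeries.one_mul'
    mul_one := TensorSeries.mul_one'
    left_distrib := fun x y z => by
      ext w; simp [mul_apply, mul_add, Finset.sum_add_distrib]
    right_distrib := fun x y z => by
      ext w; simp [mul_apply, add_mul, Finset.sum_add_distrib]
    zero_mul := fun x => by ext w; simp [mul_apply]
    mul_zero := fun x => by ext w; simp [mul_apply] }

noncomputable instance : Algebra ℝ (TensorSeries d) :=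
  Algebra.ofModule
    (fun r x y => by ext w; simp [mul_apply, Finset.mul_sum, mul_assoc])
    (fun r x y => by ext w; simp [mul_apply, Finset.mul_sum, mul_left_comm])

/-- The commutator bracket `[x, y] = xy - yx`. -/
noncomputable instance : LieRing (TensorSeries d) := LieRing.ofAssociativeRing

noncomputable instance : LieAlgebra ℝ (TensorSeries d) := LieAlgebra.ofAssociativeAlgebra

/-- The series with vanishing scalar component. -/
def T0 (d : ℕ) : Submodule ℝ (TensorSeries d) where
  carrier := {x | x [] = 0}
  add_mem' := fun {x y} hx hy => by
    simp only [mem_ofPred_eq] at hx hy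
    simp [hx, hy]
  zero_mem' := by simp
  smul_mem' := fun c x hx => by
    simp only [mem_ofPred_eq] at hx
    simp [hx]

/-- The tensor level `x^{(n)}`, as a homogeneous tensor series. -/
noncomputable def level (n : ℕ) (x : TensorSeries d) : TensorSeries d :=
  fun w => if w.length = n then x w else 0

/-- `exp x = ∑ₖ xᵏ / k!` for `x` with zero scalar component; at a word `w` the terms with
`k > |w|` vanish for such `x`. -/
noncomputable def texp (x : TensorSeries d) : TensorSeries d :=
  fun w => ∑ k ∈ Finset.range (w.length + 1), (1 / (k ! : ℝ)) * (x ^ k) w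

/-- `log x = ∑_{k ≥ 1} (-1)^{k+1} / k (x - 1)ᵏ` for `x` with scalar component `1`; at a word `w`
the terms with `k > |w|` vanish for such `x`. -/
noncomputable def tlog (x : TensorSeries d) : TensorSeries d :=
  fun w => ∑ k ∈ Finset.Icc 1 w.length, ((-1 : ℝ) ^ (k + 1) / (k : ℝ)) * ((x - 1) ^ k) w

/-- The operator `∑ₖ aₖ Aᵏ`, for a linear operator `A` that raises the tensor level by at least
one; at a word `w` the terms with `k > |w|` vanish for such `A`. -/
noncomputable def opSeries (a : ℕ → ℝ) (A : TensorSeries d → TensorSeries d) :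
    TensorSeries d → TensorSeries d :=
  fun y w => ∑ k ∈ Finset.range (w.length + 1), a k * (A^[k] y) w

/-- `ad x = [x, ·]`, the commutator. -/
noncomputable def ad (x : TensorSeries d) : TensorSeries d → TensorSeries d := fun y => ⁅x, y⁆

/-- `H(ad x) = ∑ₖ Bₖ / k! (ad x)ᵏ` with the Bernoulli numbers `1, -1/2, 1/6, …`. -/
noncomputable def Had (x : TensorSeries d) : TensorSeries d → TensorSeries d :=
  opSeries (fun k => (bernoulli k : ℝ) / (k ! : ℝ)) (ad x)

/-- `exp(ad x) = ∑ₖ (ad x)ᵏ / k!`. -/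
noncomputable def expAd (x : TensorSeries d) : TensorSeries d → TensorSeries d :=
  opSeries (fun k => 1 / (k ! : ℝ)) (ad x)

/-- `Ψ(A) = ∑ₙ (-1)ⁿ / (n + 1) (A - Id)ⁿ`, the power series of `log z / (z - 1)` at `z = 1`. -/
noncomputable def Psi (A : TensorSeries d → TensorSeries d) :
    TensorSeries d → TensorSeries d :=
  opSeries (fun n => (-1 : ℝ) ^ n / ((n : ℝ) + 1)) (fun z => A z - z)

/-- `ad x^{(l₁)} ⋯ ad x^{(lₖ)} (z)` for a list `l₁, …, lₖ` of levels. -/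
noncomputable def adLevels (l : List ℕ) (x z : TensorSeries d) : TensorSeries d :=
  l.foldr (fun i y => ad (level i x) y) z

/-- `x^{(l₁)} ⋯ x^{(lₖ)}` for a list `l₁, …, lₖ` of levels. -/
noncomputable def prodLevels (l : List ℕ) (x : TensorSeries d) : TensorSeries d :=
  (l.map (fun i => level i x)).prod

/-- `Lie(V)`: the closed Lie algebra generated by `V`. A series belongs to it when, up to every
tensor level `N`, it agrees with an element of the Lie subalgebra generated by `V`. As truncated
subspaces are finite-dimensional, this is the closure of that subalgebra for componentwise
convergence. For `V = ℝᵈ` it consists of the free Lie series. -/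
def lieSeries (V : Submodule ℝ (TensorSeries d)) : Set (TensorSeries d) :=
  {x | ∀ N : ℕ, ∃ y ∈ LieSubalgebra.lieSpan ℝ (TensorSeries d) (V : Set (TensorSeries d)),
    ∀ w : List (Fin d), w.length ≤ N → x w = y w}

end TensorSeries

open TensorSeries

/-- A real function is càdlàg on `[a, b]`. -/
def IsCadlagOn (g : ℝ → ℝ) (a b : ℝ) : Prop :=
  (∀ u ∈ Ico a b, Tendsto g (𝓝[>] u) (𝓝 (g u))) ∧
  (∀ u ∈ Ioc a b, ∃ l : ℝ, Tendsto g (𝓝[<] u) (𝓝 l))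

open scoped Classical in
/-- The Lebesgue–Stieltjes signed measure `dg` of a càdlàg function `g` of bounded variation
on `[0, T]`. The function is extended by constants outside `[0, T]`, hence
`dg((a, b]) = g b - g a` for `0 ≤ a ≤ b ≤ T` and there is no mass outside `(0, T]`. -/
noncomputable def stieltjes (T : ℝ) (g : ℝ → ℝ) : SignedMeasure ℝ :=
  if h : BoundedVariationOn (fun u => g (max 0 (min u T))) univ then h.vectorMeasure else 0

variable {d : ℕ}

/-- The integral `∫_{(s,t]} F_u(dX_u)` of operators against a path, with `w`-component
`∑_{|v| ≤ |w|} ∫_{(s,t]} F_u(e_v)^w dX_u^v`. -/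
noncomputable def opIntegral (T : ℝ) (F : ℝ → TensorSeries d → TensorSeries d)
    (X : ℝ → TensorSeries d) (s t : ℝ) : TensorSeries d :=
  fun w => ∑ k ∈ Finset.range (w.length + 1), ∑ v : Fin k → Fin d,
    ∫ᵛ u in Ioc s t, F u (e (List.ofFn v)) w ∂•(stieltjes T (fun u => X u (List.ofFn v)))

/-- All scalar integrals in `∫_{(s,t]} F_u(dX_u)` exist. -/
def OpIntegrable (T : ℝ) (F : ℝ → TensorSeries d → TensorSeries d)
    (X : ℝ → TensorSeries d) (s t : ℝ) : Prop :=
  ∀ v w : List (Fin d), v.length ≤ w.length →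
    ((stieltjes T (fun u => X u v)).restrict (Ioc s t)).Integrable (fun u => F u (e v) w)

/-- The left limit `X_{u-}`, componentwise. -/
noncomputable def left (X : ℝ → TensorSeries d) (u : ℝ) : TensorSeries d :=
  fun w => Function.leftLim (fun r => X r w) u

/-- The jump `ΔX_u = X_u - X_{u-}`. -/
noncomputable def jump (X : ℝ → TensorSeries d) (u : ℝ) : TensorSeries d := X u - left X u

/-- The continuous part `X^c_t = X_t - ∑_{0 < u ≤ t} ΔX_u` of a path of bounded variation. -/
noncomputable def contPart (X : ℝ → TensorSeries d) (t : ℝ) : TensorSeries d :=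
  fun w => X t w - ∑' u : Ioc (0 : ℝ) t, jump X u w

/-- A path on `[0, T]` with values in the series with zero scalar component, càdlàg and of bounded
variation in every component. -/
structure IsBVPath (T : ℝ) (X : ℝ → TensorSeries d) : Prop where
  mem_T0 : ∀ t ∈ Icc 0 T, X t ∈ T0 d
  cadlag : ∀ w, IsCadlagOn (fun t => X t w) 0 T
  boundedVariation : ∀ w, BoundedVariationOn (fun t => X t w) (Icc 0 T)

/-- `S` is a càdlàg solution on `[s, T]` of the signature equation (in Marcus form)
`S_t = 1 + ∫_{(s,t]} S_{u-} dX_u + ∑_{s < u ≤ t} S_{u-} (exp(ΔX_u) - 1 - ΔX_u)`.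
A path of bounded variation has no continuous martingale part, so there is no bracket term. -/
structure IsSignature (T : ℝ) (X : ℝ → TensorSeries d) (s : ℝ) (S : ℝ → TensorSeries d) :
    Prop where
  cadlag : ∀ w, IsCadlagOn (fun t => S t w) s T
  integrable : OpIntegrable T (fun u x => left S u * x) X s T
  summable : ∀ w, Summable (fun u : Ioc s T =>
    |(left S u * (texp (jump X u) - 1 - jump X u)) w|)
  eqn : ∀ t ∈ Icc s T, ∀ w, S t w = (1 : TensorSeries d) w
    + opIntegral T (fun u x => left S u * x) X s t w
    + ∑' u : Ioc s t, (left S u * (texp (jump X u) - 1 - jump X u)) w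

open scoped Classical in
/-- The generalized signature `Sig(X)_{s,t}`: the solution of the signature equation started from
`1` at time `s`, evaluated at time `t`. -/
noncomputable def sig (T : ℝ) (X : ℝ → TensorSeries d) (s t : ℝ) : TensorSeries d :=
  if h : ∃ S, IsSignature T X s S then h.choose t else 1

/-- The log-signature `Ω_t(T) = log Sig(X)_{t,T}`. -/
noncomputable def logSig (T : ℝ) (X : ℝ → TensorSeries d) (t : ℝ) : TensorSeries d :=
  tlog (sig T X t T)

/-- The contribution `∫₀¹ Ψ(exp(ad θΔX_u) ∘ exp(ad Y_u))(ΔX_u) dθ` of a time `u`, componentwise. -/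
noncomputable def hausdorffJump (X Y : ℝ → TensorSeries d) (u : ℝ) : TensorSeries d :=
  fun w => ∫ θ in (0 : ℝ)..1, Psi (expAd (θ • jump X u) ∘ expAd (Y u)) (jump X u) w

/-- `HMag¹(X, Y; l₁, …, lₖ)_{t,T}
  = B_{k-1} / (k-1)! ∫_{(t,T]} ad Y_{u-}^{(l₂)} ⋯ ad Y_{u-}^{(lₖ)} (dX_u^{(l₁)})`. -/
noncomputable def hMag (T : ℝ) (X Y : ℝ → TensorSeries d) (t : ℝ) : List ℕ → TensorSeries d
  | [] => 0
  | l :: ls => ((bernoulli ls.length : ℝ) / (ls.length ! : ℝ)) •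
      opIntegral T (fun u x => adLevels ls (left Y u) x) (fun u => level l (X u)) t T

/-- The summand at time `u` of `HJmp(X, Y; l₁, …, lₖ)_{t,T}`: the sum over `1 ≤ i ≤ k` and
`0 ≤ m ≤ j ≤ i` with `(i, m) ≠ (1, 1)` of
`(-1)^{i-j} B_{k-i} / ((k-i)! m! (j-m)! (i-j)!)` times
`ad Y_{u-}^{(l_{i+1})} ⋯ ad Y_{u-}^{(l_k)}` applied to
`ΔX_u^{(l_1)} ⋯ ΔX_u^{(l_m)} Y_u^{(l_{m+1})} ⋯ Y_u^{(l_j)} Y_{u-}^{(l_{j+1})} ⋯ Y_{u-}^{(l_i)}`. -/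
noncomputable def hJmpTerm (X Y : ℝ → TensorSeries d) (l : List ℕ) (u : ℝ) : TensorSeries d :=
  ∑ i ∈ Finset.Icc 1 l.length, ∑ j ∈ Finset.range (i + 1), ∑ m ∈ Finset.range (j + 1),
    if i = 1 ∧ m = 1 then 0 else
      ((-1 : ℝ) ^ (i - j) * (bernoulli (l.length - i) : ℝ) /
        (((l.length - i)! : ℝ) * (m ! : ℝ) * ((j - m)! : ℝ) * ((i - j)! : ℝ))) •
      adLevels (l.drop i) (left Y u)
        (prodLevels (l.take m) (jump X u) * prodLevels ((l.take j).drop m) (Y u) *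
          prodLevels ((l.take i).drop j) (left Y u))

/-- `HJmp(X, Y; l)_{t,T}`, the sum of the above summands over `t < u ≤ T`. -/
noncomputable def hJmp (T : ℝ) (X Y : ℝ → TensorSeries d) (t : ℝ) (l : List ℕ) :
    TensorSeries d :=
  fun w => ∑' u : Ioc t T, hJmpTerm X Y l u w

/-- The right-hand side of the recursion at level `n`,
`X_{t,T}^{(n)} + ∑_{‖l‖ = n, |l| ≥ 2} (HMag¹(X, Y; l)_{t,T} + HJmp(X, Y; l)_{t,T})`;
the multi-indices `l` with entries `≥ 1` and sum `n` are the compositions of `n`. -/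
noncomputable def magnusRHS (T : ℝ) (X Y : ℝ → TensorSeries d) (n : ℕ) (t : ℝ) :
    TensorSeries d :=
  level n (X T - X t) + ∑ c : Composition n with 2 ≤ c.length,
    (hMag T X Y t c.blocks + hJmp T X Y t c.blocks)

end JumpMagnus

open JumpMagnus JumpMagnus.TensorSeries

/-! Reduction to densities. There are only countably many words, so all components of `X` are
primitives with respect to one finite measure `μ` on `(0, T]` (`exists_driver`): `dX = x dμ` and
`ΔX_u = μ{u} x_u`. Stieltjes integrals become integrals against `μ`, and jump sums become integrals
over the atoms of `μ`.

Signature. Let `e₁(z) = (exp z - 1) / z` and `y = x e₁(μ{u} x)`. Then `y = x` off the atoms and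
`μ{u} y_u = exp(ΔX_u) - 1` at every `u`, so the Marcus equation is the linear equation `dS = S_- y
dμ`. Since `y` has no scalar component, this equation is triangular in word length. It is solved by
recursion on words (`dysonSeries`), the solution is unique by the same induction, and `Sig_{s,t} =
K_s⁻¹ K_t` for the solution `K` started at time zero.

Hausdorff equation. Put `Ω_t = log(K_t⁻¹ K_T)`. The derivative of `exp` at `Ω` in direction `ω` is
`e₁(ad Ω)(ω) exp Ω` (`evalDeriv_exp`), and the Bernoulli series inverts `e₁`. Off the atoms,
integration by parts is the ordinary Leibniz rule, whence `dΩ = -H(ad Ω)(dX)`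
(`exists_density_logSig`). At a jump, `exp Ω_{u-} = exp(ΔX_u) exp Ω_u`; the same chain rule along `θ
↦ log(exp(θ ΔX_u) exp Ω_u)`, with `Ψ(exp(ad z)) = H(ad z)`, writes `Ω_{u-} - Ω_u` as the integral
over `θ` (`hausdorffJump_eq`). Integration from `t` to `T` with `Ω_T = 0` gives the equation.

Magnus expansion. At level `n` the terms `HMag¹` add up to `∫ H(ad Ω_-)(dX) - X_{t,T}` with the
jumps of `X` included, so `HJmp` has to supply `Ω_{u-} - Ω_u - H(ad Ω_{u-})(ΔX_u)` at each jump.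
This follows by expanding `0 = H(ad v)(exp(x) exp(y) exp(-v) - 1)` with `x = ΔX_u`, `y = Ω_u`, `v =
Ω_{u-}` (`sum_jumpSum`) and separating the terms with `(i, m) = (1, 1)` and the composition with one
block.

Lie property. Modulo order `n + 2`, `H(ad Ω)(x)` depends on `Ω` only modulo order `n + 1`, since `x`
has no scalar component. Induction on the order then works, because subspaces containing all series
of high order are stable under componentwise integrals, left limits and densities (`integral_mem`,
`HasLeft.mem`, `density_mem`). -/

namespace JumpMagnus

/-! ### Formal power series of `exp`, `log` and the Bernoulli numbers. -/

section PowerSeriesIdentities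
open PowerSeries

/-- The power series `∑ zᵏ / (k + 1)!` of `(exp z - 1) / z`. -/
noncomputable def expQuot : PowerSeries ℝ := PowerSeries.mk fun k => 1 / ((k + 1)! : ℝ)

/-- The power series `∑ (-1)ⁿ / (n + 1) zⁿ` of `log (1 + z) / z`. -/
noncomputable def logQuot : PowerSeries ℝ :=
  PowerSeries.mk fun n => (-1 : ℝ) ^ n / ((n : ℝ) + 1)

theorem X_mul_expQuot : (X : PowerSeries ℝ) * expQuot = exp ℝ - 1 := by
  ext n
  cases n with
  | zero => simp
  | succ n => simp [coeff_succ_X_mul, expQuot, coeff_one]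

theorem X_mul_logQuot : (X : PowerSeries ℝ) * logQuot = PowerSeries.log ℝ := by
  ext n
  cases n with
  | zero => simp
  | succ n => simp [coeff_succ_X_mul, logQuot, pow_add]

/-- This is where the Bernoulli numbers enter: `expQuot` appears in the derivative of the
exponential, and solving for the direction requires its inverse. -/
theorem bernoulli_mul_expQuot : bernoulliPowerSeries ℝ * expQuot = 1 := by
  have h := bernoulliPowerSeries_mul_exp_sub_one ℝ
  rw [← X_mul_expQuot, mul_left_comm] at h
  exact mul_left_cancel₀ X_ne_zero (h.trans (mul_one _).symm)

theorem one_add_X_mul_derivative_log :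
    (1 + X : PowerSeries ℝ) * d⁄dX ℝ (PowerSeries.log ℝ) = 1 := by
  rw [deriv_log]
  ext n
  cases n with
  | zero => simp
  | succ n => simp [add_mul, coeff_succ_X_mul, coeff_one, pow_succ]

/-- Both sides have constant term zero and derivative one: by the chain rule the derivative on the
left is `1 / (1 + z)` at `z = exp - 1`, times `exp`. -/
theorem log_subst_exp_sub_one : (PowerSeries.log ℝ).subst (exp ℝ - 1) = X := by
  have hs : HasSubst (exp ℝ - 1) := HasSubst.exp_sub_one
  apply derivative.ext
  · rw [derivative_subst hs]
    have h := congrArg (PowerSeries.subst (exp ℝ - 1)) one_add_X_mul_derivative_log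
    rw [subst_mul hs, subst_add hs, subst_X hs] at h
    have h1 : (1 : PowerSeries ℝ).subst (exp ℝ - 1) = 1 := by
      rw [← coe_substAlgHom hs, map_one]
    rw [h1] at h
    simp only [map_sub, derivative_exp, derivative_one, sub_zero, derivative_X]
    rw [mul_comm]
    simpa using h
  · simp only [constantCoeff_X]
    have h0 : constantCoeff (exp ℝ - 1) = 0 := by simp
    exact constantCoeff_subst_eq_zero h0 _ (by simp)

/-- With `L = log'` one has `f' = f L` and `L' = -L²`, so `f L` has derivative zero and equals its
constant term one. Multiplication by `1 + X`, the inverse of `L`, concludes. -/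
theorem exp_subst_log : (exp ℝ).subst (PowerSeries.log ℝ) = 1 + X := by
  have hs : HasSubst (PowerSeries.log ℝ) := HasSubst.log
  set f := (exp ℝ).subst (PowerSeries.log ℝ) with hf
  have hf' : d⁄dX ℝ f = f * d⁄dX ℝ (PowerSeries.log ℝ) := by
    rw [hf, derivative_subst hs, derivative_exp]
  have hL := one_add_X_mul_derivative_log
  set L := d⁄dX ℝ (PowerSeries.log ℝ)
  have hLd : d⁄dX ℝ L = - (L * L) := by
    have h := congrArg (d⁄dX ℝ) hL
    simp only [Derivation.leibniz, map_add, derivative_X, derivative_one, zero_add,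
      smul_eq_mul, mul_one] at h
    linear_combination L * h - d⁄dX ℝ L * hL
  have hone : f * L = 1 := by
    apply derivative.ext
    · simp only [Derivation.leibniz, smul_eq_mul, derivative_one, hf', hLd]
      ring
    · have h0 : constantCoeff f = 1 := by
        have h1 : exp ℝ = (exp ℝ - 1) + 1 := by ring
        rw [hf, h1, subst_add hs]
        have h2 : (1 : PowerSeries ℝ).subst (PowerSeries.log ℝ) = 1 := by
          rw [← coe_substAlgHom hs, map_one]
        have h3 : constantCoeff ((exp ℝ - 1).subst (PowerSeries.log ℝ)) = 0 :=
          constantCoeff_subst_eq_zero (constantCoeff_log (A := ℝ)) _ (by simp)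
        rw [h2, map_add, h3]
        simp
      have h4 := congrArg constantCoeff hL
      simp only [map_mul, map_add, map_one, constantCoeff_X, add_zero, one_mul] at h4
      rw [map_mul, h0, h4]; simp
  linear_combination (1 + X) * hone - f * hL

/-- Both series give `X` when multiplied by `exp - 1`, which can be cancelled. This is the formal
version of `Ψ(exp(ad z)) = H(ad z)`. -/
theorem logQuot_subst_exp_sub_one : logQuot.subst (exp ℝ - 1) = bernoulliPowerSeries ℝ := by
  have hs : HasSubst (exp ℝ - 1) := HasSubst.exp_sub_one
  have h := log_subst_exp_sub_one
  rw [← X_mul_logQuot, subst_mul hs, subst_X hs, ← bernoulliPowerSeries_mul_exp_sub_one ℝ,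
    mul_comm] at h
  refine mul_right_cancel₀ ?_ h
  rw [← X_mul_expQuot]
  exact mul_ne_zero X_ne_zero (right_ne_zero_of_mul_eq_one bernoulli_mul_expQuot)

end PowerSeriesIdentities

/-- A double sum over `i + j ≤ N`, written over the square when the other terms vanish. -/
theorem sum_antidiagonal_eq_sum_square {M : Type*} [AddCommMonoid M] (N : ℕ) (F : ℕ → ℕ → M)
    (hF : ∀ i j, N < i + j → F i j = 0) :
    ∑ k ∈ Finset.range (N + 1), ∑ p ∈ Finset.HasAntidiagonal.antidiagonal k, F p.1 p.2 =
      ∑ i ∈ Finset.range (N + 1), ∑ j ∈ Finset.range (N + 1), F i j := by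
  rw [← Finset.sum_product', Finset.sum_sigma']
  symm
  rw [← Finset.sum_filter_of_ne (p := fun p : ℕ × ℕ => p.1 + p.2 ≤ N)]
  · refine Finset.sum_bij' (fun p _ => ⟨p.1 + p.2, p⟩) (fun s _ => s.2) ?_ ?_ ?_ ?_ ?_
    · rintro ⟨i, j⟩ h
      simp only [Finset.mem_filter, Finset.mem_product, Finset.mem_range] at h
      simp only [Finset.mem_sigma, Finset.mem_range, Finset.HasAntidiagonal.mem_antidiagonal,
        and_true]
      omega
    · rintro ⟨k, i, j⟩ h
      simp only [Finset.mem_sigma, Finset.mem_range, Finset.HasAntidiagonal.mem_antidiagonal] at h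
      simp only [Finset.mem_filter, Finset.mem_product, Finset.mem_range]
      omega
    · rintro ⟨i, j⟩ h
      rfl
    · rintro ⟨k, i, j⟩ h
      simp only [Finset.mem_sigma, Finset.mem_range, Finset.HasAntidiagonal.mem_antidiagonal] at h
      obtain ⟨_, rfl⟩ := h
      rfl
    · rintro ⟨i, j⟩ h
      rfl
  · rintro ⟨i, j⟩ _ hne
    by_contra h
    exact hne (hF i j (not_le.mp h))

/-! ### The filtration by order and power series of level-raising operators. -/

namespace TensorSeries

variable {d : ℕ}

@[simp] theorem sum_apply {ι : Type*} (s : Finset ι) (f : ι → TensorSeries d)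
    (w : List (Fin d)) : (∑ i ∈ s, f i) w = ∑ i ∈ s, f i w := by
  classical
  induction s using Finset.induction_on with
  | empty => simp
  | insert i s his ih => simp [Finset.sum_insert, his, ih]

/-- The series whose coefficients at words of length `< n` vanish. -/
def fil (d n : ℕ) : Submodule ℝ (TensorSeries d) where
  carrier := {x | ∀ w, w.length < n → x w = 0}
  add_mem' := fun {x y} hx hy w hw => by simp [hx w hw, hy w hw]
  zero_mem' := fun w _ => rfl
  smul_mem' := fun c x hx w hw => by simp [hx w hw]

theorem fil_zero (x : TensorSeries d) : x ∈ fil d 0 := fun _ h => absurd h (Nat.not_lt_zero _)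

theorem fil_mono {m n : ℕ} (h : m ≤ n) {x : TensorSeries d} (hx : x ∈ fil d n) : x ∈ fil d m :=
  fun w hw => hx w (hw.trans_le h)

theorem mem_T0 {x : TensorSeries d} : x ∈ T0 d ↔ x [] = 0 := Iff.rfl

theorem mem_T0_iff_fil {x : TensorSeries d} : x ∈ T0 d ↔ x ∈ fil d 1 := by
  constructor
  · intro h w hw
    have : w = [] := List.length_eq_zero_iff.mp (by omega)
    rw [this]; exact h
  · intro h
    exact h [] (by simp)

theorem mul_mem_fil {m n : ℕ} {x y : TensorSeries d} (hx : x ∈ fil d m) (hy : y ∈ fil d n) :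
    x * y ∈ fil d (m + n) := by
  intro w hw
  rw [mul_apply]
  refine Finset.sum_eq_zero fun i hi => ?_
  rw [Finset.mem_range] at hi
  by_cases h : i < m
  · rw [hx, zero_mul]
    simp; omega
  · rw [hy, mul_zero]
    simp; omega

theorem pow_mem_fil {x : TensorSeries d} (hx : x ∈ T0 d) (k : ℕ) : x ^ k ∈ fil d k := by
  induction k with
  | zero => exact fil_zero _
  | succ k ih => rw [pow_succ]; exact mul_mem_fil ih (mem_T0_iff_fil.mp hx)

theorem mul_apply_nil (x y : TensorSeries d) : (x * y) [] = x [] * y [] := by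
  simp [mul_apply]

@[simp] theorem one_apply_nil : (1 : TensorSeries d) [] = 1 := by simp [one_apply]

/-- A linear operator raises the level if it maps series of order `≥ n` to series of
order `≥ n + 1`. -/
def Raising (A : Module.End ℝ (TensorSeries d)) : Prop :=
  ∀ n x, x ∈ fil d n → A x ∈ fil d (n + 1)

theorem Raising.pow_mem {A : Module.End ℝ (TensorSeries d)} (hA : Raising A) {n : ℕ}
    {x : TensorSeries d} (hx : x ∈ fil d n) (k : ℕ) : (A ^ k) x ∈ fil d (n + k) := by
  induction k with
  | zero => simpa using hx
  | succ k ih => rw [pow_succ', Module.End.mul_apply]; exact hA _ _ ih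

theorem Raising.pow_apply_eq_zero {A : Module.End ℝ (TensorSeries d)} (hA : Raising A)
    (x : TensorSeries d) {k : ℕ} {w : List (Fin d)} (h : w.length < k) : (A ^ k) x w = 0 :=
  hA.pow_mem (fil_zero x) k w (by omega)

theorem Raising.sub {A B : Module.End ℝ (TensorSeries d)} (hA : Raising A) (hB : Raising B) :
    Raising (A - B) :=
  fun n x hx => (fil d _).sub_mem (hA n x hx) (hB n x hx)

/-- The power series `∑ₖ fₖ Aᵏ` of a linear operator, as a linear operator. -/
noncomputable def opS (f : PowerSeries ℝ) (A : Module.End ℝ (TensorSeries d)) :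
    Module.End ℝ (TensorSeries d) where
  toFun y := opSeries (fun k => PowerSeries.coeff k f) A y
  map_add' x y := by
    ext w
    simp only [opSeries, add_apply, ← Module.End.pow_apply, map_add, mul_add,
      Finset.sum_add_distrib]
  map_smul' c x := by
    ext w
    simp only [opSeries, smul_apply, ← Module.End.pow_apply, map_smul, RingHom.id_apply,
      Finset.mul_sum]
    exact Finset.sum_congr rfl fun k _ => by ring

theorem opSeries_eq_opS {a : ℕ → ℝ} {f : PowerSeries ℝ} (h : ∀ k, PowerSeries.coeff k f = a k)
    (A : Module.End ℝ (TensorSeries d)) : opSeries a A = opS f A := by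
  obtain rfl : (fun k => PowerSeries.coeff k f) = a := funext h
  rfl

section opS

variable {f g : PowerSeries ℝ} {A B : Module.End ℝ (TensorSeries d)}

theorem opS_apply (f : PowerSeries ℝ) (A : Module.End ℝ (TensorSeries d)) (y : TensorSeries d)
    (w : List (Fin d)) :
    opS f A y w = ∑ k ∈ Finset.range (w.length + 1), PowerSeries.coeff k f * (A ^ k) y w := by
  simp only [Module.End.pow_apply]
  rfl

theorem opS_apply_of_le (hA : Raising A) (y : TensorSeries d) {w : List (Fin d)} {N : ℕ}
    (h : w.length ≤ N) :
    opS f A y w = ∑ k ∈ Finset.range (N + 1), PowerSeries.coeff k f * (A ^ k) y w := by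
  rw [opS_apply]
  refine Finset.sum_subset (by simpa using h) fun k _ hk => ?_
  rw [hA.pow_apply_eq_zero, mul_zero]
  simp at hk; omega

/-- Approximation modulo `fil` plays the role of convergence: identities between infinite series are
checked on finite truncations. -/
theorem opS_sub_sum_mem (hA : Raising A) (y : TensorSeries d) (N : ℕ) :
    opS f A y - ∑ k ∈ Finset.range (N + 1), PowerSeries.coeff k f • (A ^ k) y
      ∈ fil d (N + 1) := by
  intro w hw
  rw [sub_apply, opS_apply_of_le hA y (Nat.le_of_lt_succ hw)]
  simp

theorem opS_mem_fil (hA : Raising A) {n : ℕ} {y : TensorSeries d} (hy : y ∈ fil d n) :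
    opS f A y ∈ fil d n := by
  intro w hw
  rw [opS_apply]
  refine Finset.sum_eq_zero fun k _ => ?_
  rw [fil_mono (by omega) (hA.pow_mem hy k) w hw, mul_zero]

/-- Both series can be cut at `N`, because `A ^ i` and `B ^ j` together raise the order by `i + j`.
Two different operators are allowed so that the formula serves Cauchy products and `exp (A + B)`
alike. -/
theorem opS_opS_apply (hA : Raising A) (hB : Raising B) (y : TensorSeries d)
    {w : List (Fin d)} {N : ℕ} (h : w.length ≤ N) :
    opS f A (opS g B y) w = ∑ k ∈ Finset.range (N + 1), ∑ p ∈ Finset.HasAntidiagonal.antidiagonal k,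
      PowerSeries.coeff p.1 f * PowerSeries.coeff p.2 g * (A ^ p.1) ((B ^ p.2) y) w := by
  rw [sum_antidiagonal_eq_sum_square N (fun i j =>
    PowerSeries.coeff i f * PowerSeries.coeff j g * (A ^ i) ((B ^ j) y) w)]
  · rw [opS_apply_of_le hA _ h]
    refine Finset.sum_congr rfl fun i _ => ?_
    have h1 := fil_mono (by omega) (hA.pow_mem (opS_sub_sum_mem (f := g) hB y N) i) w
      (Nat.lt_succ_of_le h)
    rw [map_sub, sub_apply, sub_eq_zero] at h1
    rw [h1, map_sum, sum_apply, Finset.mul_sum]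
    refine Finset.sum_congr rfl fun j _ => ?_
    rw [map_smul, smul_apply, mul_assoc]
  · intro i j hij
    rw [fil_mono (m := N + 1) (by omega) (hA.pow_mem (hB.pow_mem (fil_zero y) j) i) w
      (Nat.lt_succ_of_le h), mul_zero]

theorem opS_mul (hA : Raising A) : opS (f * g) A = opS f A * opS g A := by
  ext y w
  rw [Module.End.mul_apply, opS_opS_apply hA hA y le_rfl, opS_apply]
  refine Finset.sum_congr rfl fun k _ => ?_
  rw [PowerSeries.coeff_mul, Finset.sum_mul]
  refine Finset.sum_congr rfl fun p hp => ?_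
  rw [← Module.End.mul_apply, ← pow_add, Finset.HasAntidiagonal.mem_antidiagonal.mp hp]

theorem opS_add : opS (f + g) A = opS f A + opS g A := by
  ext y w
  simp [opS_apply, add_mul, Finset.sum_add_distrib]

theorem opS_sub : opS (f - g) A = opS f A - opS g A := by
  ext y w
  simp [opS_apply, sub_mul, Finset.sum_sub_distrib]

theorem opS_one : opS 1 A = 1 := by
  ext y w
  rw [opS_apply, Finset.sum_eq_single 0]
  · simp
  · intro k _ hk; simp [PowerSeries.coeff_one, hk]
  · simp

theorem opS_X (hA : Raising A) : opS PowerSeries.X A = A := by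
  ext y w
  -- The range is enlarged by one so that it contains `k = 1` even at the empty word.
  rw [opS_apply_of_le hA y (Nat.le_succ _), Finset.sum_eq_single 1]
  · simp
  · intro k _ hk; simp [PowerSeries.coeff_X, hk]
  · simp

theorem opS_pow (hA : Raising A) (k : ℕ) : opS (f ^ k) A = opS f A ^ k := by
  induction k with
  | zero => simp [opS_one]
  | succ k ih => rw [pow_succ, opS_mul hA, ih, pow_succ]

/-- As `g ^ k` has no coefficient below degree `k`, at a fixed word only finitely many pairs of
indices matter, and the two sums may be interchanged. -/
theorem opS_subst (hA : Raising A) (hg : PowerSeries.constantCoeff g = 0) :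
    opS (f.subst g) A = opS f (opS g A) := by
  ext y w
  have hs : PowerSeries.HasSubst g := PowerSeries.HasSubst.of_constantCoeff_zero hg
  have hX : PowerSeries.X ∣ g := PowerSeries.X_dvd_iff.mpr hg
  have hz : ∀ j k, j < k → PowerSeries.coeff j (g ^ k) = 0 := fun j k hjk =>
    PowerSeries.X_pow_dvd_iff.mp (pow_dvd_pow_of_dvd hX k) j hjk
  rw [opS_apply, opS_apply]
  simp only [← opS_pow hA, opS_apply _ A, Finset.mul_sum]
  rw [Finset.sum_comm]
  refine Finset.sum_congr rfl fun j hj => ?_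
  rw [PowerSeries.coeff_subst' hs, finsum_eq_sum_of_support_subset
    (s := Finset.range (w.length + 1)), Finset.sum_mul]
  · simp [mul_assoc]
  · intro k hk
    simp only [Function.mem_support] at hk
    simp only [Finset.coe_range, mem_Iio]
    by_contra hlt
    rw [Finset.mem_range] at hj
    exact hk (by rw [hz j k (by omega), smul_zero])

theorem opS_zero : opS f (0 : Module.End ℝ (TensorSeries d)) =
    PowerSeries.constantCoeff f • 1 := by
  ext y w
  rw [opS_apply, Finset.sum_eq_single 0]
  · simp
  · intro k _ hk; simp [hk]
  · simp

/-- The binomial theorem in each total degree. -/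
theorem opS_exp_add (hA : Raising A) (hB : Raising B) (h : Commute A B) :
    opS (PowerSeries.exp ℝ) (A + B) =
      opS (PowerSeries.exp ℝ) A * opS (PowerSeries.exp ℝ) B := by
  ext y w
  rw [Module.End.mul_apply, opS_opS_apply hA hB y le_rfl, opS_apply]
  refine Finset.sum_congr rfl fun k _ => ?_
  rw [h.add_pow', LinearMap.sum_apply, sum_apply, Finset.mul_sum]
  refine Finset.sum_congr rfl fun p hp => ?_
  rw [LinearMap.smul_apply, Module.End.mul_apply, ← Nat.cast_smul_eq_nsmul ℝ, smul_apply,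
    ← mul_assoc]
  congr 1
  simp only [PowerSeries.coeff_exp, one_div, map_inv₀, map_natCast]
  rw [Finset.HasAntidiagonal.mem_antidiagonal] at hp
  subst hp
  have h1 := Nat.add_choose_mul_factorial_mul_factorial p.1 p.2
  rw [← Nat.choose_symm_add] at h1
  rw [← h1]
  push_cast
  have := Nat.factorial_ne_zero p.1
  have := Nat.factorial_ne_zero p.2
  have hc : ((p.1 + p.2).choose p.1 : ℝ) ≠ 0 := by
    exact_mod_cast (Nat.choose_pos (Nat.le_add_right _ _)).ne'
  field_simp

end opS

end TensorSeries
-- Exponential, logarithm and adjoint action of tensor series.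
namespace TensorSeries

variable {d : ℕ}

theorem mulLeft_raising {x : TensorSeries d} (hx : x ∈ T0 d) :
    Raising (LinearMap.mulLeft ℝ x) := fun n y hy => by
  rw [LinearMap.mulLeft_apply, add_comm]
  exact mul_mem_fil (mem_T0_iff_fil.mp hx) hy

theorem mulRight_raising {x : TensorSeries d} (hx : x ∈ T0 d) :
    Raising (LinearMap.mulRight ℝ x) := fun n y hy => by
  rw [LinearMap.mulRight_apply]
  exact mul_mem_fil hy (mem_T0_iff_fil.mp hx)

/-- The commutator `ad x`, as a linear operator. -/
noncomputable def adE (x : TensorSeries d) : Module.End ℝ (TensorSeries d) :=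
  LinearMap.mulLeft ℝ x - LinearMap.mulRight ℝ x

theorem adE_apply (x y : TensorSeries d) : adE x y = x * y - y * x := rfl

theorem ad_apply (x y : TensorSeries d) : ad x y = x * y - y * x := rfl

theorem coe_adE (x : TensorSeries d) : ⇑(adE x) = ad x := rfl

theorem adE_raising {x : TensorSeries d} (hx : x ∈ T0 d) : Raising (adE x) :=
  (mulLeft_raising hx).sub (mulRight_raising hx)

theorem mulLeft_pow_apply (x y : TensorSeries d) (k : ℕ) :
    (LinearMap.mulLeft ℝ x ^ k) y = x ^ k * y := by
  rw [LinearMap.pow_mulLeft, LinearMap.mulLeft_apply]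

theorem mulRight_pow_apply (x y : TensorSeries d) (k : ℕ) :
    (LinearMap.mulRight ℝ x ^ k) y = y * x ^ k := by
  rw [LinearMap.pow_mulRight, LinearMap.mulRight_apply]

/-- The power series `∑ₖ fₖ xᵏ` of a series `x`. -/
noncomputable def evalS (f : PowerSeries ℝ) (x : TensorSeries d) : TensorSeries d :=
  opS f (LinearMap.mulLeft ℝ x) 1

theorem evalS_apply (f : PowerSeries ℝ) (x : TensorSeries d) (w : List (Fin d)) :
    evalS f x w = ∑ k ∈ Finset.range (w.length + 1), PowerSeries.coeff k f * (x ^ k) w := by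
  simp [evalS, opS_apply]

theorem evalS_sub_sum_mem (f : PowerSeries ℝ) {x : TensorSeries d} (hx : x ∈ T0 d) (N : ℕ) :
    evalS f x - ∑ k ∈ Finset.range (N + 1), PowerSeries.coeff k f • x ^ k ∈ fil d (N + 1) := by
  simpa [evalS] using opS_sub_sum_mem (f := f) (mulLeft_raising hx) 1 N

/-- Transfers the calculus of power series of operators to power series of elements. -/
theorem opS_mulLeft (f : PowerSeries ℝ) {x : TensorSeries d} (hx : x ∈ T0 d)
    (y : TensorSeries d) : opS f (LinearMap.mulLeft ℝ x) y = evalS f x * y := by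
  ext w
  have h := mul_mem_fil (evalS_sub_sum_mem f hx w.length) (fil_zero y) w (by omega)
  rw [sub_mul, sub_apply, sub_eq_zero] at h
  rw [h, opS_apply, Finset.sum_mul, sum_apply]
  simp

theorem opS_mulRight (f : PowerSeries ℝ) {x : TensorSeries d} (hx : x ∈ T0 d)
    (y : TensorSeries d) : opS f (LinearMap.mulRight ℝ x) y = y * evalS f x := by
  ext w
  have h := mul_mem_fil (fil_zero y) (evalS_sub_sum_mem f hx w.length) w (by omega)
  rw [mul_sub, sub_apply, sub_eq_zero] at h
  rw [h, opS_apply, Finset.mul_sum, sum_apply]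
  simp

theorem texp_eq_evalS (x : TensorSeries d) : texp x = evalS (PowerSeries.exp ℝ) x := by
  ext w
  rw [evalS_apply, texp]
  simp

theorem tlog_eq_evalS (g : TensorSeries d) : tlog g = evalS (PowerSeries.log ℝ) (g - 1) := by
  ext w
  rw [evalS_apply, tlog, Finset.range_eq_Ico, Finset.sum_eq_sum_Ico_succ_bot (by omega)]
  simp only [PowerSeries.coeff_zero_eq_constantCoeff, PowerSeries.constantCoeff_log, zero_mul,
    zero_add]
  refine Finset.sum_congr (by ext; simp) fun k hk => ?_
  rw [Finset.mem_Ico] at hk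
  rw [PowerSeries.coeff_log, if_neg (by omega)]
  simp

theorem evalS_apply_nil (f : PowerSeries ℝ) (x : TensorSeries d) :
    evalS f x [] = PowerSeries.constantCoeff f := by
  simp [evalS_apply]

@[simp] theorem texp_apply_nil (x : TensorSeries d) : texp x [] = 1 := by
  rw [texp_eq_evalS, evalS_apply_nil]; simp

theorem tlog_mem_T0 (g : TensorSeries d) : tlog g ∈ T0 d := by
  rw [tlog_eq_evalS, mem_T0, evalS_apply_nil]; simp

theorem sub_one_mem_T0 {g : TensorSeries d} (hg : g [] = 1) : g - 1 ∈ T0 d := by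
  simp [mem_T0, hg]

/-- Left multiplication by `tlog g` is the logarithm series of left multiplication by `g - 1`, so
the formal composition `exp_subst_log` applies. -/
theorem texp_tlog {g : TensorSeries d} (hg : g [] = 1) : texp (tlog g) = g := by
  have hx := sub_one_mem_T0 hg
  have h : LinearMap.mulLeft ℝ (tlog g) =
      opS (PowerSeries.log ℝ) (LinearMap.mulLeft ℝ (g - 1)) := by
    ext1 y
    rw [opS_mulLeft _ hx, ← tlog_eq_evalS, LinearMap.mulLeft_apply]
  rw [texp_eq_evalS, evalS, h, ← opS_subst (mulLeft_raising hx) (by simp), exp_subst_log,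
    opS_add, opS_one, opS_X (mulLeft_raising hx)]
  simp

theorem tlog_one : tlog (1 : TensorSeries d) = 0 := by
  ext w
  rw [tlog_eq_evalS, evalS_apply, Finset.sum_eq_zero, zero_apply]
  intro k _
  cases k with
  | zero => simp
  | succ k => simp

theorem commute_mulLeft_mulRight (x y : TensorSeries d) :
    Commute (LinearMap.mulLeft ℝ x) (LinearMap.mulRight ℝ y) :=
  LinearMap.commute_mulLeft_right x y

theorem texp_neg_mul_texp {x : TensorSeries d} (hx : x ∈ T0 d) : texp (-x) * texp x = 1 := by
  have hn : -x ∈ T0 d := (T0 d).neg_mem hx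
  have hc : Commute (LinearMap.mulLeft ℝ (-x)) (LinearMap.mulLeft ℝ x) := by
    have : LinearMap.mulLeft ℝ (-x) = -LinearMap.mulLeft ℝ x := by ext1; simp
    rw [this]
    exact (Commute.refl _).neg_left
  have h := opS_exp_add (mulLeft_raising hn) (mulLeft_raising hx) hc
  have h0 : LinearMap.mulLeft ℝ (-x) + LinearMap.mulLeft ℝ x = 0 := by ext1; simp
  rw [h0, opS_zero] at h
  have h1 := LinearMap.congr_fun h 1
  rw [Module.End.mul_apply, opS_mulLeft _ hx, opS_mulLeft _ hn, mul_one, ← texp_eq_evalS,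
    ← texp_eq_evalS] at h1
  simpa using h1.symm

theorem texp_mul_texp_neg {x : TensorSeries d} (hx : x ∈ T0 d) : texp x * texp (-x) = 1 := by
  have h := texp_neg_mul_texp ((T0 d).neg_mem hx)
  rwa [neg_neg] at h

theorem expAd_eq_opS (x : TensorSeries d) : expAd x = opS (PowerSeries.exp ℝ) (adE x) := by
  rw [expAd, ← coe_adE]
  exact opSeries_eq_opS (fun k => by simp) _

theorem Had_eq_opS (x : TensorSeries d) :
    Had x = opS (bernoulliPowerSeries ℝ) (adE x) := by
  rw [Had, ← coe_adE]
  exact opSeries_eq_opS (fun k => by simp [bernoulliPowerSeries]) _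

/-- `ad x` is left multiplication by `x` plus right multiplication by `-x`, and these two operators
commute. -/
theorem expAd_apply {x : TensorSeries d} (hx : x ∈ T0 d) (y : TensorSeries d) :
    expAd x y = texp x * y * texp (-x) := by
  have hn : -x ∈ T0 d := (T0 d).neg_mem hx
  have h0 : adE x = LinearMap.mulLeft ℝ x + LinearMap.mulRight ℝ (-x) := by
    ext1 y
    simp [adE_apply, sub_eq_add_neg]
  rw [expAd_eq_opS, h0, opS_exp_add (mulLeft_raising hx) (mulRight_raising hn)
    (commute_mulLeft_mulRight _ _), Module.End.mul_apply, opS_mulRight _ hn, opS_mulLeft _ hx,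
    ← texp_eq_evalS, ← texp_eq_evalS, mul_assoc]

/-- All three operators are conjugations, so only the exponential of `z` matters and no
Baker-Campbell-Hausdorff formula is involved. -/
theorem expAd_comp_expAd {x y z : TensorSeries d} (hx : x ∈ T0 d) (hy : y ∈ T0 d)
    (hz : z ∈ T0 d) (h : texp z = texp x * texp y) : expAd x ∘ expAd y = expAd z := by
  have hinv : texp (-z) = texp (-y) * texp (-x) := by
    calc texp (-z) = texp (-z) * (texp x * (texp y * texp (-y)) * texp (-x)) := by
          rw [texp_mul_texp_neg hy, mul_one, texp_mul_texp_neg hx, mul_one]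
      _ = texp (-z) * (texp x * texp y) * (texp (-y) * texp (-x)) := by
          simp only [mul_assoc]
      _ = _ := by rw [← h, texp_neg_mul_texp hz, one_mul]
  funext u
  rw [Function.comp_apply, expAd_apply hx, expAd_apply hy, expAd_apply hz, hinv, h]
  simp only [mul_assoc]

/-- `exp(ad z) - Id` is itself a power series in `ad z` without constant term, so `Ψ` becomes a
substitution of power series. -/
theorem Psi_expAd {z : TensorSeries d} (hz : z ∈ T0 d) : Psi (expAd z) = Had z := by
  have h : (fun y => expAd z y - y) = opS (PowerSeries.exp ℝ - 1) (adE z) := by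
    funext y
    rw [opS_sub, opS_one, expAd_eq_opS]
    rfl
  rw [Psi, h, opSeries_eq_opS (f := logQuot) (fun k => by simp [logQuot]),
    ← opS_subst (adE_raising hz) (by simp), logQuot_subst_exp_sub_one, Had_eq_opS]

/-- If `e₁(ad x)(ω) = y`, with `e₁(z) = (exp z - 1) / z`, then `ω = H(ad x)(y)`. -/
theorem eq_Had_of_expQuot {x ω y : TensorSeries d} (hx : x ∈ T0 d)
    (h : opS expQuot (adE x) ω = y) : ω = Had x y := by
  rw [Had_eq_opS, ← h, ← Module.End.mul_apply, ← opS_mul (adE_raising hx),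
    bernoulli_mul_expQuot, opS_one]
  rfl

/-- `∑_{i < k} xⁱ ω xᵏ⁻¹⁻ⁱ`, the derivative of the `k`-th power at `x` in direction `ω`. -/
noncomputable def powDeriv (x ω : TensorSeries d) (k : ℕ) : TensorSeries d :=
  ∑ i ∈ Finset.range k, x ^ i * ω * x ^ (k - 1 - i)

theorem powDeriv_zero (x ω : TensorSeries d) : powDeriv x ω 0 = 0 := by simp [powDeriv]

theorem powDeriv_succ (x ω : TensorSeries d) (k : ℕ) :
    powDeriv x ω (k + 1) = powDeriv x ω k * x + x ^ k * ω := by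
  rw [powDeriv, Finset.sum_range_succ, powDeriv, Finset.sum_mul]
  congr 1
  · refine Finset.sum_congr rfl fun i hi => ?_
    rw [Finset.mem_range] at hi
    rw [mul_assoc (x ^ i * ω), ← pow_succ]
    congr 2
    omega
  · simp

theorem powDeriv_mem_fil {x ω : TensorSeries d} (hx : x ∈ T0 d) (hω : ω ∈ T0 d) (k : ℕ) :
    powDeriv x ω k ∈ fil d k := by
  refine Submodule.sum_mem _ fun i hi => ?_
  rw [Finset.mem_range] at hi
  exact fil_mono (by omega) (mul_mem_fil (mul_mem_fil (pow_mem_fil hx i)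
    (mem_T0_iff_fil.mp hω)) (pow_mem_fil hx (k - 1 - i)))

/-- The derivative of `x ↦ ∑ₖ fₖ xᵏ` at `x` in direction `ω`. -/
noncomputable def evalDeriv (f : PowerSeries ℝ) (x ω : TensorSeries d) : TensorSeries d :=
  fun w => ∑ k ∈ Finset.range (w.length + 1), PowerSeries.coeff k f * powDeriv x ω k w

/-- Moves all powers of `x` to the right of `ω`. Left multiplication is `ad x` plus right
multiplication, so the binomial theorem expands `x ^ k * ω`; the induction then uses Pascal's rule.
-/
theorem powDeriv_eq_sum_choose (x ω : TensorSeries d) (k : ℕ) :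
    powDeriv x ω k = ∑ j ∈ Finset.range k,
      (k.choose (j + 1) : ℝ) • ((adE x ^ j) ω * x ^ (k - 1 - j)) := by
  have hpow : ∀ k, x ^ k * ω = ∑ j ∈ Finset.range (k + 1),
      (k.choose j : ℝ) • ((adE x ^ j) ω * x ^ (k - j)) := by
    intro k
    have h0 : LinearMap.mulLeft ℝ x = adE x + LinearMap.mulRight ℝ x := by
      simp [adE]
    have hc : Commute (adE x) (LinearMap.mulRight ℝ x) :=
      (commute_mulLeft_mulRight x x).sub_left (Commute.refl _)
    rw [← mulLeft_pow_apply, h0, hc.add_pow, LinearMap.sum_apply]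
    refine Finset.sum_congr rfl fun j _ => ?_
    rw [(hc.pow_pow j (k - j)).eq, Module.End.mul_apply, Module.End.mul_apply,
      Module.End.natCast_apply, map_nsmul, mulRight_pow_apply, ← Nat.cast_smul_eq_nsmul ℝ,
      smul_mul_assoc]
  induction k with
  | zero => simp [powDeriv]
  | succ k ih =>
    rw [powDeriv_succ, ih, hpow, Finset.sum_mul]
    have hext : ∑ j ∈ Finset.range k,
        (k.choose (j + 1) : ℝ) • ((adE x ^ j) ω * x ^ (k - 1 - j)) * x =
        ∑ j ∈ Finset.range (k + 1), (k.choose (j + 1) : ℝ) • ((adE x ^ j) ω * x ^ (k - j)) := by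
      rw [Finset.sum_range_succ]
      simp only [Nat.choose_succ_self, Nat.cast_zero, zero_smul, add_zero]
      refine Finset.sum_congr rfl fun j hj => ?_
      rw [Finset.mem_range] at hj
      rw [smul_mul_assoc, mul_assoc, ← pow_succ]
      congr 3
      omega
    rw [hext, ← Finset.sum_add_distrib]
    refine Finset.sum_congr rfl fun j _ => ?_
    rw [← add_smul, Nat.choose_succ_succ k j]
    push_cast
    rw [add_comm]

/-- The derivative of the exponential: `D exp(x)[ω] = e₁(ad x)(ω) exp(x)`. -/
theorem evalDeriv_exp {x ω : TensorSeries d} (hx : x ∈ T0 d) (hω : ω ∈ T0 d) :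
    evalDeriv (PowerSeries.exp ℝ) x ω = opS expQuot (adE x) ω * texp x := by
  ext w
  have h1 : (opS expQuot (adE x) ω * texp x) =
      opS (PowerSeries.exp ℝ) (LinearMap.mulRight ℝ x) (opS expQuot (adE x) ω) := by
    rw [opS_mulRight _ hx, texp_eq_evalS]
  rw [h1, opS_opS_apply (mulRight_raising hx) (adE_raising hx) ω (Nat.le_refl _)]
  -- One more term, zero by its order, is included: the term `k = 0` is about to be dropped and the
  -- index shifted.
  have h2 : evalDeriv (PowerSeries.exp ℝ) x ω w =
      ∑ k ∈ Finset.range (w.length + 2),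
        PowerSeries.coeff k (PowerSeries.exp ℝ) * powDeriv x ω k w := by
    rw [Finset.sum_range_succ _ (w.length + 1), powDeriv_mem_fil hx hω (w.length + 1) w (by omega),
      mul_zero, add_zero]
    rfl
  rw [h2, Finset.sum_range_succ', powDeriv_zero, zero_apply, mul_zero, add_zero]
  refine Finset.sum_congr rfl fun k _ => ?_
  rw [powDeriv_eq_sum_choose, sum_apply, Finset.mul_sum,
    Finset.Nat.sum_antidiagonal_eq_sum_range_succ_mk, ← Finset.sum_range_reflect]
  refine Finset.sum_congr rfl fun j hj => ?_
  rw [Finset.mem_range] at hj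
  have e1 : k + 1 - 1 - j = k - j := by omega
  have e2 : k + 1 - 1 - (k - j) = j := by omega
  simp only [e1, e2]
  rw [mulRight_pow_apply, smul_apply, ← mul_assoc]
  congr 1
  have h3 : (k + 1).choose (k - j + 1) * (k - j + 1)! * j ! = (k + 1)! := by
    have := Nat.choose_mul_factorial_mul_factorial (show k - j + 1 ≤ k + 1 by omega)
    rwa [show k + 1 - (k - j + 1) = j by omega] at this
  simp only [PowerSeries.coeff_exp, expQuot, PowerSeries.coeff_mk, one_div, map_inv₀,
    map_natCast]
  rw [← h3]
  push_cast
  have := Nat.factorial_ne_zero j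
  have := Nat.factorial_ne_zero (k - j + 1)
  have hc : ((k + 1).choose (k - j + 1) : ℝ) ≠ 0 := by
    exact_mod_cast (Nat.choose_pos (by omega)).ne'
  field_simp

theorem evalDeriv_mem_T0 (f : PowerSeries ℝ) (x ω : TensorSeries d) :
    evalDeriv f x ω ∈ T0 d := by
  simp [mem_T0, evalDeriv, powDeriv_zero]

end TensorSeries

/-! ### Componentwise regularity of paths, and abstract derivations. -/

variable {d : ℕ}

/-- The components of a path of tensor series belong to a space of real functions. -/
def CompIn (M : Submodule ℝ (ℝ → ℝ)) (F : ℝ → TensorSeries d) : Prop :=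
  ∀ w, (fun t => F t w) ∈ M

namespace CompIn

variable {M : Submodule ℝ (ℝ → ℝ)} {S : Subalgebra ℝ (ℝ → ℝ)} {F G : ℝ → TensorSeries d}

theorem add (hF : CompIn M F) (hG : CompIn M G) : CompIn M (fun t => F t + G t) :=
  fun w => M.add_mem (hF w) (hG w)

theorem sub (hF : CompIn M F) (hG : CompIn M G) : CompIn M (fun t => F t - G t) :=
  fun w => M.sub_mem (hF w) (hG w)

theorem smul (c : ℝ) (hF : CompIn M F) : CompIn M (fun t => c • F t) :=
  fun w => M.smul_mem c (hF w)

theorem zero : CompIn M (fun _ => (0 : TensorSeries d)) := fun _ => M.zero_mem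

theorem sum {ι : Type*} (s : Finset ι) {F : ι → ℝ → TensorSeries d}
    (h : ∀ i ∈ s, CompIn M (F i)) : CompIn M (fun t => ∑ i ∈ s, F i t) := by
  intro w
  have : (fun t => (∑ i ∈ s, F i t) w) = ∑ i ∈ s, fun t => F i t w := by
    funext t; simp [sum_apply]
  rw [this]
  exact M.sum_mem fun i hi => h i hi w

theorem const (x : TensorSeries d) : CompIn (Subalgebra.toSubmodule S) (fun _ => x) :=
  fun w => S.algebraMap_mem (x w)

theorem level (n : ℕ) (hF : CompIn M F) : CompIn M (fun t => TensorSeries.level n (F t)) := by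
  intro w
  by_cases h : w.length = n
  · simpa [TensorSeries.level, h] using hF w
  · simp only [TensorSeries.level, h, if_false]
    exact M.zero_mem

/-- The pattern is that of a module over an algebra. It is used for integrable or summable functions
over bounded ones, and for an algebra over itself. -/
theorem mul_left (hM : ∀ f ∈ S, ∀ g ∈ M, f * g ∈ M) (hF : CompIn (Subalgebra.toSubmodule S) F)
    (hG : CompIn M G) : CompIn M (fun t => F t * G t) := by
  intro w
  have : (fun t => (F t * G t) w) = ∑ i ∈ Finset.range (w.length + 1),
      (fun t => F t (w.take i)) * (fun t => G t (w.drop i)) := by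
    funext t; simp [mul_apply, Finset.sum_apply]
  rw [this]
  exact M.sum_mem fun i _ => hM _ (hF _) _ (hG _)

theorem mul_right (hM : ∀ f ∈ S, ∀ g ∈ M, f * g ∈ M) (hF : CompIn M F)
    (hG : CompIn (Subalgebra.toSubmodule S) G) : CompIn M (fun t => F t * G t) := by
  intro w
  have : (fun t => (F t * G t) w) = ∑ i ∈ Finset.range (w.length + 1),
      (fun t => G t (w.drop i)) * (fun t => F t (w.take i)) := by
    funext t; simp [mul_apply, Finset.sum_apply, mul_comm]
  rw [this]
  exact M.sum_mem fun i _ => hM _ (hG _) _ (hF _)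

theorem mul (hF : CompIn (Subalgebra.toSubmodule S) F)
    (hG : CompIn (Subalgebra.toSubmodule S) G) :
    CompIn (Subalgebra.toSubmodule S) (fun t => F t * G t) :=
  mul_left (fun _ hf _ hg => S.mul_mem hf hg) hF hG

theorem pow (hF : CompIn (Subalgebra.toSubmodule S) F) (k : ℕ) :
    CompIn (Subalgebra.toSubmodule S) (fun t => F t ^ k) := by
  induction k with
  | zero => simpa using const (S := S) (1 : TensorSeries d)
  | succ k ih => simpa only [pow_succ] using ih.mul hF

theorem evalS (f : PowerSeries ℝ) (hF : CompIn (Subalgebra.toSubmodule S) F) :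
    CompIn (Subalgebra.toSubmodule S) (fun t => TensorSeries.evalS f (F t)) := by
  intro w
  have : (fun t => TensorSeries.evalS f (F t) w) = ∑ k ∈ Finset.range (w.length + 1),
      PowerSeries.coeff k f • fun t => (F t ^ k) w := by
    funext t; simp [evalS_apply, Finset.sum_apply]
  rw [this]
  exact Submodule.sum_mem _ fun k _ => Submodule.smul_mem _ _ (hF.pow k w)

theorem texp (hF : CompIn (Subalgebra.toSubmodule S) F) :
    CompIn (Subalgebra.toSubmodule S) (fun t => TensorSeries.texp (F t)) := by
  simpa only [texp_eq_evalS] using evalS (PowerSeries.exp ℝ) hF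

theorem tlog (hF : CompIn (Subalgebra.toSubmodule S) F) :
    CompIn (Subalgebra.toSubmodule S) (fun t => TensorSeries.tlog (F t)) := by
  simpa only [tlog_eq_evalS] using evalS (PowerSeries.log ℝ) (hF.sub (const 1))

theorem adE_pow (hM : ∀ f ∈ S, ∀ g ∈ M, f * g ∈ M)
    (hF : CompIn (Subalgebra.toSubmodule S) F) (hG : CompIn M G) (k : ℕ) :
    CompIn M (fun t => (adE (F t) ^ k) (G t)) := by
  induction k with
  | zero => simpa using hG
  | succ k ih =>
    simp only [pow_succ', Module.End.mul_apply, adE_apply]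
    exact (mul_left hM hF ih).sub (mul_right hM ih hF)

theorem opS_adE (f : PowerSeries ℝ) (hM : ∀ f ∈ S, ∀ g ∈ M, f * g ∈ M)
    (hF : CompIn (Subalgebra.toSubmodule S) F) (hG : CompIn M G) :
    CompIn M (fun t => opS f (adE (F t)) (G t)) := by
  intro w
  have : (fun t => opS f (adE (F t)) (G t) w) = ∑ k ∈ Finset.range (w.length + 1),
      PowerSeries.coeff k f • fun t => (adE (F t) ^ k) (G t) w := by
    funext t; simp [opS_apply, Finset.sum_apply]
  rw [this]
  exact Submodule.sum_mem _ fun k _ => Submodule.smul_mem _ _ (adE_pow hM hF hG k w)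

theorem Had (hM : ∀ f ∈ S, ∀ g ∈ M, f * g ∈ M)
    (hF : CompIn (Subalgebra.toSubmodule S) F) (hG : CompIn M G) :
    CompIn M (fun t => TensorSeries.Had (F t) (G t)) := by
  simpa only [Had_eq_opS] using opS_adE (bernoulliPowerSeries ℝ) hM hF hG

theorem adLevels (hM : ∀ f ∈ S, ∀ g ∈ M, f * g ∈ M) (l : List ℕ)
    (hF : CompIn (Subalgebra.toSubmodule S) F) (hG : CompIn M G) :
    CompIn M (fun t => TensorSeries.adLevels l (F t) (G t)) := by
  induction l with
  | nil => exact hG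
  | cons i l ih =>
    simp only [TensorSeries.adLevels, List.foldr_cons, ad_apply]
    exact (mul_left hM (hF.level i) ih).sub (mul_right hM ih (hF.level i))

end CompIn

/-- A derivation on real functions, as a relation between a function and its derivative. -/
structure IsDerivationRel (R : (ℝ → ℝ) → (ℝ → ℝ) → Prop) : Prop where
  const : ∀ c : ℝ, R (fun _ => c) (fun _ => 0)
  add : ∀ {f g ξ γ}, R f ξ → R g γ → R (fun t => f t + g t) (fun t => ξ t + γ t)
  mul : ∀ {f g ξ γ}, R f ξ → R g γ → R (fun t => f t * g t) (fun t => f t * γ t + ξ t * g t)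

/-- Componentwise derivatives of paths of tensor series. -/
def CompDeriv (R : (ℝ → ℝ) → (ℝ → ℝ) → Prop) (F ξ : ℝ → TensorSeries d) : Prop :=
  ∀ w, R (fun t => F t w) (fun t => ξ t w)

namespace IsDerivationRel

variable {R : (ℝ → ℝ) → (ℝ → ℝ) → Prop} {F G ξ γ : ℝ → TensorSeries d}

theorem const_mul (hR : IsDerivationRel R) (c : ℝ) {f ξ : ℝ → ℝ} (h : R f ξ) :
    R (fun t => c * f t) (fun t => c * ξ t) := by
  simpa using hR.mul (hR.const c) h

theorem sum (hR : IsDerivationRel R) {ι : Type*} (s : Finset ι) {f ξ : ι → ℝ → ℝ}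
    (h : ∀ i ∈ s, R (f i) (ξ i)) : R (fun t => ∑ i ∈ s, f i t) (fun t => ∑ i ∈ s, ξ i t) := by
  classical
  induction s using Finset.induction_on with
  | empty => simpa using hR.const 0
  | insert i s his ih =>
    simp only [Finset.sum_insert his]
    exact hR.add (h i (by simp)) (ih fun j hj => h j (by simp [hj]))

theorem comp_const (hR : IsDerivationRel R) (x : TensorSeries d) :
    CompDeriv R (fun _ => x) (fun _ => 0) := fun w => hR.const (x w)

theorem comp_add (hR : IsDerivationRel R) (hF : CompDeriv R F ξ) (hG : CompDeriv R G γ) :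
    CompDeriv R (fun t => F t + G t) (fun t => ξ t + γ t) := fun w => hR.add (hF w) (hG w)

theorem comp_mul (hR : IsDerivationRel R) (hF : CompDeriv R F ξ) (hG : CompDeriv R G γ) :
    CompDeriv R (fun t => F t * G t) (fun t => F t * γ t + ξ t * G t) := by
  intro w
  simp only [mul_apply, add_apply, ← Finset.sum_add_distrib]
  exact hR.sum _ fun i _ => hR.mul (hF _) (hG _)

theorem comp_pow (hR : IsDerivationRel R) (hF : CompDeriv R F ξ) (k : ℕ) :
    CompDeriv R (fun t => F t ^ k) (fun t => powDeriv (F t) (ξ t) k) := by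
  induction k with
  | zero => simpa [powDeriv_zero] using hR.comp_const (1 : TensorSeries d)
  | succ k ih =>
    simp only [powDeriv_succ, pow_succ, add_comm (powDeriv _ _ _ * _)]
    exact hR.comp_mul ih hF

/-- At a fixed word a power series of a path is a polynomial in finitely many components, so the
Leibniz rule suffices and no analytic chain rule is needed. -/
theorem comp_evalS (hR : IsDerivationRel R) (f : PowerSeries ℝ) (hF : CompDeriv R F ξ) :
    CompDeriv R (fun t => evalS f (F t)) (fun t => evalDeriv f (F t) (ξ t)) := by
  intro w
  simp only [evalS_apply, evalDeriv]
  exact hR.sum _ fun k _ => hR.const_mul _ (hR.comp_pow hF k w)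

/-- The logarithm of a differentiable path is differentiable, and its derivative `ω` satisfies
`D G = e₁(ad log G)(ω) G`. -/
theorem comp_tlog (hR : IsDerivationRel R) (hG : CompDeriv R G γ) (h1 : ∀ t, G t [] = 1) :
    CompDeriv R (fun t => tlog (G t))
        (fun t => evalDeriv (PowerSeries.log ℝ) (G t - 1) (γ t)) ∧
      CompDeriv R G (fun t => opS expQuot (adE (tlog (G t)))
        (evalDeriv (PowerSeries.log ℝ) (G t - 1) (γ t)) * G t) := by
  have h2 : CompDeriv R (fun t => G t - 1) γ := by
    simpa [sub_eq_add_neg] using hR.comp_add hG (hR.comp_const (-1 : TensorSeries d))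
  have h3 := hR.comp_evalS (PowerSeries.log ℝ) h2
  simp only [← tlog_eq_evalS] at h3
  refine ⟨h3, ?_⟩
  -- Exponentiating the logarithm returns `G`, which yields a second expression for its derivative.
  have h4 := hR.comp_evalS (PowerSeries.exp ℝ) h3
  simp only [← texp_eq_evalS, evalDeriv_exp (tlog_mem_T0 _) (evalDeriv_mem_T0 _ _ _),
    texp_tlog (h1 _)] at h4
  exact h4

end IsDerivationRel

/-- This instance serves the variable `θ` inside a jump; the time variable uses
`isDerivationRel_diffuseDeriv`. -/
theorem isDerivationRel_hasDerivAt :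
    IsDerivationRel (fun f ξ => ∀ t, HasDerivAt f (ξ t) t) where
  const c t := hasDerivAt_const t c
  add hf hg t := (hf t).add (hg t)
  mul hf hg t := by
    exact ((hf t).mul (hg t)).congr_deriv (add_comm _ _)

/-- The algebra of continuous functions. -/
def contAlg : Subalgebra ℝ (ℝ → ℝ) where
  carrier := {f | Continuous f}
  mul_mem' := fun hf hg => Continuous.mul hf hg
  add_mem' := fun hf hg => Continuous.add hf hg
  algebraMap_mem' := fun _ => continuous_const

/-! ### The logarithm along the curve `θ ↦ exp(θ x) g`. -/

namespace TensorSeries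

theorem mul_texp_neg_tlog {g : TensorSeries d} (hg : g [] = 1) : g * texp (-tlog g) = 1 := by
  conv_lhs => enter [1]; rw [← texp_tlog hg]
  exact texp_mul_texp_neg (tlog_mem_T0 g)

theorem texp_neg_tlog_mul {g : TensorSeries d} (hg : g [] = 1) : texp (-tlog g) * g = 1 := by
  conv_lhs => enter [2]; rw [← texp_tlog hg]
  exact texp_neg_mul_texp (tlog_mem_T0 g)

theorem mul_right_cancel_of_apply_nil {g : TensorSeries d} (hg : g [] = 1)
    {x y : TensorSeries d} (h : x * g = y * g) : x = y := by
  have h1 := mul_texp_neg_tlog hg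
  calc x = x * g * texp (-tlog g) := by rw [mul_assoc, h1, mul_one]
    _ = y := by rw [h, mul_assoc, h1, mul_one]

theorem opS_apply_of_apply_eq_zero (f : PowerSeries ℝ) {A : Module.End ℝ (TensorSeries d)}
    {y : TensorSeries d} (h : A y = 0) : opS f A y = PowerSeries.constantCoeff f • y := by
  ext w
  rw [opS_apply, Finset.sum_eq_single 0]
  · simp
  · intro k _ hk
    obtain ⟨k, rfl⟩ := Nat.exists_eq_succ_of_ne_zero hk
    rw [pow_succ, Module.End.mul_apply, h, map_zero, zero_apply, mul_zero]
  · simp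

theorem evalS_zero (f : PowerSeries ℝ) :
    evalS f (0 : TensorSeries d) = PowerSeries.constantCoeff f • 1 := by
  rw [evalS, LinearMap.mulLeft_zero_eq_zero, opS_zero]
  rfl

theorem texp_zero : texp (0 : TensorSeries d) = 1 := by
  simp [texp_eq_evalS, evalS_zero]

theorem continuous_Had_tlog (x g : TensorSeries d) (w : List (Fin d)) :
    Continuous fun θ : ℝ => Had (tlog (texp (θ • x) * g)) x w := by
  have hl : CompIn (Subalgebra.toSubmodule contAlg) (fun θ : ℝ => θ • x) := fun v => by
    change Continuous fun θ : ℝ => θ * x v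
    fun_prop
  exact CompIn.Had (S := contAlg) (M := Subalgebra.toSubmodule contAlg)
    (fun _ hf _ hg => contAlg.mul_mem hf (show _ ∈ contAlg from hg))
    (hl.texp.mul (CompIn.const g)).tlog (CompIn.const x) w

/-- `∫₀¹ H(ad log(exp(θ x) g))(x) dθ = log(exp(x) g) - log g`. -/
theorem integral_Had_tlog {x g : TensorSeries d} (hx : x ∈ T0 d) (hg : g [] = 1)
    (w : List (Fin d)) :
    ∫ θ in (0 : ℝ)..1, Had (tlog (texp (θ • x) * g)) x w =
      tlog (texp x * g) w - tlog g w := by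
  have hR := isDerivationRel_hasDerivAt
  have hθ : ∀ θ : ℝ, θ • x ∈ T0 d := fun θ => (T0 d).smul_mem θ hx
  have hlin : CompDeriv (fun f ξ => ∀ t, HasDerivAt f (ξ t) t) (fun θ : ℝ => θ • x)
      (fun _ => x) := fun v t => by
    simpa using (hasDerivAt_id t).mul_const (x v)
  have hexp := hR.comp_evalS (PowerSeries.exp ℝ) hlin
  -- `x` commutes with `θ • x`, so only the constant term of the series acts.
  have hquot : ∀ θ : ℝ, opS expQuot (adE (θ • x)) x = x := fun θ => by
    rw [opS_apply_of_apply_eq_zero _ (by simp [adE_apply])]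
    simp [expQuot]
  simp only [← texp_eq_evalS, evalDeriv_exp (hθ _) hx, hquot] at hexp
  have hG := hR.comp_mul hexp (hR.comp_const g)
  have hnil : ∀ θ : ℝ, (texp (θ • x) * g) [] = 1 := fun θ => by
    rw [mul_apply_nil, texp_apply_nil, hg, one_mul]
  obtain ⟨h1, h2⟩ := hR.comp_tlog hG hnil
  -- The path `G = exp(θ x) g` has derivative `x G` and also `e₁(ad log G)(ω) G`, where `ω` is the
  -- derivative of `log G`. Cancelling `G` and inverting `e₁` determines `ω`.
  have hω : ∀ θ : ℝ, evalDeriv (PowerSeries.log ℝ) (texp (θ • x) * g - 1)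
      (texp (θ • x) * 0 + x * texp (θ • x) * g) = Had (tlog (texp (θ • x) * g)) x := by
    intro θ
    refine eq_Had_of_expQuot (tlog_mem_T0 _) (mul_right_cancel_of_apply_nil (hnil θ) ?_)
    ext v
    refine ((h2 v θ).unique (hG v θ)).trans ?_
    change (texp (θ • x) * 0 + x * texp (θ • x) * g) v = (x * (texp (θ • x) * g)) v
    rw [mul_zero, zero_add, mul_assoc]
  rw [intervalIntegral.integral_eq_sub_of_hasDerivAt (f := fun θ => tlog (texp (θ • x) * g) w)
    (fun θ _ => hω θ ▸ h1 w θ) ((continuous_Had_tlog x g w).intervalIntegrable 0 1)]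
  simp [texp_zero]

end TensorSeries

/-! ### Primitives with respect to a measure: jumps, integration by parts, Stieltjes measures. -/

/-- `f` is on `[0, T]` the primitive `f 0 + ∫_{(0, t]} p dμ` of an integrable function `p`. -/
structure IsPrim (μ : Measure ℝ) (T : ℝ) (f p : ℝ → ℝ) : Prop where
  integrable : Integrable p μ
  eq_add : ∀ t ∈ Icc 0 T, f t = f 0 + ∫ u in Ioc 0 t, p u ∂μ

/-- The measure attached to a function of bounded variation is given by right limits; this
identifies them with the values of the clamped path. -/
theorem rightLim_clamp {f : ℝ → ℝ} {T : ℝ} (hf : ∀ u ∈ Ico 0 T, Tendsto f (𝓝[>] u) (𝓝 (f u)))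
    (t : ℝ) : Function.rightLim (fun u => f (max 0 (min u T))) t = f (max 0 (min t T)) := by
  refine rightLim_eq_of_tendsto ?_
  rcases lt_or_ge t 0 with h0 | h0
  · refine tendsto_const_nhds.congr' ?_
    filter_upwards [Ioo_mem_nhdsGT h0] with r hr
    rw [max_eq_left ((min_le_left _ _).trans h0.le), max_eq_left ((min_le_left _ _).trans hr.2.le)]
  rcases lt_or_ge t T with h1 | h1
  · rw [min_eq_left h1.le, max_eq_right h0]
    refine (hf t ⟨h0, h1⟩).congr' ?_
    filter_upwards [Ioo_mem_nhdsGT h1] with r hr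
    rw [min_eq_left hr.2.le, max_eq_right (h0.trans hr.1.le)]
  · refine tendsto_const_nhds.congr' ?_
    filter_upwards [self_mem_nhdsWithin] with r (hr : t < r)
    rw [min_eq_right h1, min_eq_right (h1.trans hr.le)]

theorem eVariationOn_le_of_edist_le {f g : ℝ → ℝ} {s : Set ℝ}
    (h : ∀ x ∈ s, ∀ y ∈ s, edist (f x) (f y) ≤ edist (g x) (g y)) :
    eVariationOn f s ≤ eVariationOn g s :=
  iSup_mono fun p => Finset.sum_le_sum fun _ _ => h _ (p.2.2.2 _) _ (p.2.2.2 _)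

/-- For nonnegative `p` the integral is monotone in `t`; the general case splits `p` into its
positive and negative parts. -/
theorem measurable_setIntegral_of_monotone {μ : Measure ℝ} {p : ℝ → ℝ} (hp : Integrable p μ)
    {s : ℝ → Set ℝ} (hs : Monotone s) :
    Measurable fun t => ∫ u in s t, p u ∂μ := by
  have key : ∀ q : ℝ → ℝ, Integrable q μ → (∀ u, 0 ≤ q u) →
      Measurable fun t => ∫ u in s t, q u ∂μ := fun q hq h0 =>
    Monotone.measurable fun a b hab => setIntegral_mono_set hq.integrableOn
      (Eventually.of_forall h0) (hs hab).eventuallyLE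
  have h : (fun t => ∫ u in s t, p u ∂μ) =
      fun t => ∫ u in s t, max (p u) 0 ∂μ - ∫ u in s t, max (-p u) 0 ∂μ := by
    funext t
    rw [← integral_sub hp.pos_part.integrableOn hp.neg_part.integrableOn]
    refine integral_congr_ae (Eventually.of_forall fun u => ?_)
    rcases le_total 0 (p u) with h | h <;> simp [h]
  rw [h]
  exact (key _ hp.pos_part fun u => le_max_right _ _).sub
    (key _ hp.neg_part fun u => le_max_right _ _)

namespace IsPrim

variable {μ : Measure ℝ} {T : ℝ} {f g p q : ℝ → ℝ}

theorem congr_density (hf : IsPrim μ T f p) (h : p =ᵐ[μ] q) : IsPrim μ T f q :=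
  ⟨hf.integrable.congr h, fun t ht => by
    rw [hf.eq_add t ht, integral_congr_ae (ae_restrict_of_ae h)]⟩

theorem const (c : ℝ) : IsPrim μ T (fun _ => c) (fun _ => 0) :=
  ⟨integrable_zero _ _ _, fun t _ => by simp⟩

theorem add (hf : IsPrim μ T f p) (hg : IsPrim μ T g q) :
    IsPrim μ T (fun t => f t + g t) (fun t => p t + q t) :=
  ⟨hf.integrable.add hg.integrable, fun t ht => by
    rw [integral_add hf.integrable.integrableOn hg.integrable.integrableOn, hf.eq_add t ht,
      hg.eq_add t ht]
    ring⟩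

theorem sub_eq (hf : IsPrim μ T f p) {s t : ℝ} (hs : 0 ≤ s) (hst : s ≤ t) (ht : t ≤ T) :
    f t - f s = ∫ u in Ioc s t, p u ∂μ := by
  rw [hf.eq_add t ⟨hs.trans hst, ht⟩, hf.eq_add s ⟨hs, hst.trans ht⟩,
    ← Ioc_union_Ioc_eq_Ioc hs hst, setIntegral_union (Ioc_disjoint_Ioc_of_le le_rfl)
    measurableSet_Ioc hf.integrable.integrableOn hf.integrable.integrableOn]
  ring

theorem tendsto_right (hf : IsPrim μ T f p) {u : ℝ} (hu : u ∈ Ico 0 T) :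
    Tendsto f (𝓝[>] u) (𝓝 (f u)) := by
  have h : Tendsto (fun t => ∫ v, (Ioc u t).indicator p v ∂μ) (𝓝[>] u) (𝓝 (∫ _, 0 ∂μ)) := by
    refine tendsto_integral_filter_of_dominated_convergence (fun v => ‖p v‖)
      (Eventually.of_forall fun t => hf.integrable.aestronglyMeasurable.indicator
        measurableSet_Ioc) (Eventually.of_forall fun t => Eventually.of_forall fun v =>
        norm_indicator_le_norm_self _ _) hf.integrable.norm (Eventually.of_forall fun v => ?_)
    refine tendsto_const_nhds.congr' ?_
    rcases le_or_gt v u with hv | hv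
    · exact Eventually.of_forall fun t => by simp [hv]
    · filter_upwards [Ioo_mem_nhdsGT hv] with t ht
      rw [indicator_of_notMem]
      exact fun h => absurd ht.2 (not_lt.mpr h.2)
  have h2 : Tendsto (fun t => f u + ∫ v, (Ioc u t).indicator p v ∂μ) (𝓝[>] u) (𝓝 (f u)) := by
    simpa using h.const_add (f u)
  refine h2.congr' ?_
  filter_upwards [Ioo_mem_nhdsGT hu.2] with t ht
  rw [integral_indicator measurableSet_Ioc, ← hf.sub_eq hu.1 ht.1.le ht.2.le]
  ring

/-- Dominated convergence. The limiting interval is open at `u`, so the left limit misses exactly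
the contribution of the atom at `u`. -/
theorem tendsto_left (hf : IsPrim μ T f p) {u : ℝ} (hu : u ∈ Ioc 0 T) :
    Tendsto f (𝓝[<] u) (𝓝 (f 0 + ∫ v in Ioo 0 u, p v ∂μ)) := by
  have h : Tendsto (fun t => ∫ v, (Ioc 0 t).indicator p v ∂μ) (𝓝[<] u)
      (𝓝 (∫ v, (Ioo 0 u).indicator p v ∂μ)) := by
    refine tendsto_integral_filter_of_dominated_convergence (fun v => ‖p v‖)
      (Eventually.of_forall fun t => hf.integrable.aestronglyMeasurable.indicator
        measurableSet_Ioc) (Eventually.of_forall fun t => Eventually.of_forall fun v =>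
        norm_indicator_le_norm_self _ _) hf.integrable.norm (Eventually.of_forall fun v => ?_)
    refine tendsto_const_nhds.congr' ?_
    rcases le_or_gt u v with hv | hv
    · filter_upwards [self_mem_nhdsWithin] with t (ht : t < u)
      rw [indicator_of_notMem (fun h => absurd h.2 (not_lt.mpr hv)), indicator_of_notMem]
      exact fun h => absurd h.2 (not_le.mpr (ht.trans_le hv))
    · filter_upwards [Ioo_mem_nhdsLT hv] with t ht
      by_cases h0 : 0 < v
      · rw [indicator_of_mem (show v ∈ Ioo 0 u from ⟨h0, hv⟩),
          indicator_of_mem (show v ∈ Ioc 0 t from ⟨h0, ht.1.le⟩)]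
      · rw [indicator_of_notMem (fun h => h0 h.1), indicator_of_notMem (fun h => h0 h.1)]
  rw [integral_indicator measurableSet_Ioo] at h
  refine (h.const_add (f 0)).congr' ?_
  filter_upwards [Ioo_mem_nhdsLT hu.1] with t ht
  rw [integral_indicator measurableSet_Ioc, ← hf.eq_add t ⟨ht.1.le, ht.2.le.trans hu.2⟩]

theorem leftLim_eq (hf : IsPrim μ T f p) {u : ℝ} (hu : u ∈ Ioc 0 T) :
    Function.leftLim f u = f 0 + ∫ v in Ioo 0 u, p v ∂μ :=
  leftLim_eq_of_tendsto (hf.tendsto_left hu)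

theorem tendsto_leftLim (hf : IsPrim μ T f p) {u : ℝ} (hu : u ∈ Ioc 0 T) :
    Tendsto f (𝓝[<] u) (𝓝 (Function.leftLim f u)) := by
  rw [hf.leftLim_eq hu]; exact hf.tendsto_left hu

theorem isCadlagOn (hf : IsPrim μ T f p) : IsCadlagOn f 0 T :=
  ⟨fun _ hu => hf.tendsto_right hu, fun _ hu => ⟨_, hf.tendsto_left hu⟩⟩

theorem sub_leftLim (hf : IsPrim μ T f p) {u : ℝ} (hu : u ∈ Ioc 0 T) :
    f u - Function.leftLim f u = μ.real {u} * p u := by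
  rw [hf.leftLim_eq hu, hf.eq_add u ⟨hu.1.le, hu.2⟩, ← Ioo_union_right hu.1,
    setIntegral_union (by simp) (measurableSet_singleton u) hf.integrable.integrableOn
    hf.integrable.integrableOn, integral_singleton, smul_eq_mul]
  ring

theorem leftLim_eq_self (hf : IsPrim μ T f p) {u : ℝ} (hu : u ∈ Ioc 0 T) (h : μ {u} = 0) :
    Function.leftLim f u = f u := by
  have := hf.sub_leftLim hu
  rw [Measure.real, h, ENNReal.toReal_zero, zero_mul, sub_eq_zero] at this
  exact this.symm

theorem abs_setIntegral_le (hf : IsPrim μ T f p) (s : Set ℝ) :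
    |∫ u in s, p u ∂μ| ≤ ∫ u, |p u| ∂μ :=
  (norm_integral_le_integral_norm _).trans (setIntegral_le_integral hf.integrable.norm
    (Eventually.of_forall fun _ => abs_nonneg _))

/-- Integration by parts. -/
theorem mul [IsFiniteMeasure μ] (hμ : μ (Ioc 0 T)ᶜ = 0) (hf : IsPrim μ T f p)
    (hg : IsPrim μ T g q) :
    IsPrim μ T (fun t => f t * g t) (fun t => Function.leftLim f t * q t + p t * g t) := by
  set A : ℝ → ℝ := fun u => ∫ v in Ioo 0 u, p v ∂μ with hA
  set B : ℝ → ℝ := fun u => ∫ v in Ioc 0 u, q v ∂μ with hB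
  have hAm : Measurable A := measurable_setIntegral_of_monotone hf.integrable
    (fun a b hab => Ioo_subset_Ioo_right hab)
  have hBm : Measurable B := measurable_setIntegral_of_monotone hg.integrable
    (fun a b hab => Ioc_subset_Ioc_right hab)
  have hAq : Integrable (fun u => A u * q u) μ :=
    hg.integrable.bdd_mul hAm.aestronglyMeasurable
      (Eventually.of_forall fun u => hf.abs_setIntegral_le _)
  have hpB : Integrable (fun u => p u * B u) μ :=
    hf.integrable.mul_bdd hBm.aestronglyMeasurable
      (Eventually.of_forall fun u => hg.abs_setIntegral_le _)
  have hae : (fun u => (f 0 + A u) * q u + p u * (g 0 + B u)) =ᵐ[μ]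
      fun t => Function.leftLim f t * q t + p t * g t := by
    have : ∀ᵐ u ∂μ, u ∈ Ioc 0 T := by rwa [ae_iff]
    filter_upwards [this] with u hu
    rw [hf.leftLim_eq hu, hg.eq_add u ⟨hu.1.le, hu.2⟩]
  have hi1 : Integrable (fun u => f 0 * q u + A u * q u) μ := (hg.integrable.const_mul _).add hAq
  have hi2 : Integrable (fun u => p u * g 0 + p u * B u) μ := (hf.integrable.mul_const _).add hpB
  refine IsPrim.congr_density ⟨?_, fun t ht => ?_⟩ hae
  · simp only [add_mul, mul_add]
    exact hi1.add hi2
  simp only [add_mul, mul_add]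
  rw [integral_add hi1.integrableOn hi2.integrableOn,
    integral_add (hg.integrable.const_mul _).integrableOn hAq.integrableOn,
    integral_add (hf.integrable.mul_const _).integrableOn hpB.integrableOn,
    integral_const_mul, integral_mul_const, hf.eq_add t ht, hg.eq_add t ht]
  -- Fubini on the square `(0, t]²`, split into `z.1 < z.2` and its complement. The diagonal belongs
  -- to the complement, which is why one factor carries a left limit and the other its value.
  have key : (∫ u in Ioc 0 t, p u ∂μ) * ∫ u in Ioc 0 t, q u ∂μ =
      (∫ u in Ioc 0 t, A u * q u ∂μ) + ∫ u in Ioc 0 t, p u * B u ∂μ := by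
    set ν := μ.restrict (Ioc 0 t) with hν
    have hp : Integrable p ν := hf.integrable.integrableOn
    have hq : Integrable q ν := hg.integrable.integrableOn
    have hpq : Integrable (fun z : ℝ × ℝ => p z.1 * q z.2) (ν.prod ν) := hp.mul_prod hq
    have hE : MeasurableSet {z : ℝ × ℝ | z.1 < z.2} := measurableSet_lt measurable_fst
      measurable_snd
    rw [← integral_prod_mul, ← integral_add_compl hE hpq, ← integral_indicator hE,
      ← integral_indicator hE.compl, integral_prod_symm _ (hpq.indicator hE),
      integral_prod _ (hpq.indicator hE.compl)]
    congr 1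
    · refine setIntegral_congr_fun measurableSet_Ioc fun u hu => ?_
      have : (fun v => {z : ℝ × ℝ | z.1 < z.2}.indicator (fun z => p z.1 * q z.2) (v, u)) =
          fun v => (Iio u).indicator p v * q u := by
        funext v
        by_cases h : v < u <;> simp [indicator, h]
      simp only [this]
      rw [integral_mul_const, integral_indicator measurableSet_Iio, hν,
        Measure.restrict_restrict measurableSet_Iio, hA]
      congr 3
      ext v
      simp only [mem_inter_iff, mem_Iio, mem_Ioc, mem_Ioo]
      exact ⟨fun h => ⟨h.2.1, h.1⟩, fun h => ⟨h.2, h.1, h.2.le.trans hu.2⟩⟩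
    · refine setIntegral_congr_fun measurableSet_Ioc fun v hv => ?_
      have : (fun u => {z : ℝ × ℝ | z.1 < z.2}ᶜ.indicator (fun z => p z.1 * q z.2) (v, u)) =
          fun u => p v * (Iic v).indicator q u := by
        funext u
        by_cases h : u ≤ v <;> simp [indicator, h]
      simp only [this]
      rw [integral_const_mul, integral_indicator measurableSet_Iic, hν,
        Measure.restrict_restrict measurableSet_Iic, hB]
      congr 3
      ext u
      simp only [mem_inter_iff, mem_Iic, mem_Ioc]
      exact ⟨fun h => ⟨h.2.1, h.1⟩, fun h => ⟨h.2, h.1, h.2.trans hv.2⟩⟩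
  linear_combination key

/-- The clamped path is a primitive over half-lines. -/
theorem clamp_eq (hT : 0 ≤ T) (hμ : μ (Ioc 0 T)ᶜ = 0) (hf : IsPrim μ T f p) (t : ℝ) :
    f (max 0 (min t T)) = f 0 + ∫ u in Iic t, p u ∂μ := by
  rw [hf.eq_add _ ⟨le_max_left _ _, max_le hT (min_le_right _ _)⟩]
  congr 1
  refine setIntegral_congr_set ?_
  have : ∀ᵐ u ∂μ, u ∈ Ioc 0 T := by rwa [ae_iff]
  filter_upwards [this] with u hu
  refine propext ?_
  change u ∈ Ioc 0 (max 0 (min t T)) ↔ u ∈ Iic t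
  simp only [mem_Ioc, mem_Iic, le_max_iff, le_min_iff]
  refine ⟨fun h => ?_, fun h => ⟨hu.1, Or.inr ⟨h, hu.2⟩⟩⟩
  rcases h.2 with h1 | h1
  · exact absurd h1 (not_le.mpr hu.1)
  · exact h1.1

/-- The increments are dominated by those of the bounded monotone primitive of `|p|`. -/
theorem boundedVariationOn_clamp (hT : 0 ≤ T) (hμ : μ (Ioc 0 T)ᶜ = 0) (hf : IsPrim μ T f p) :
    BoundedVariationOn (fun u => f (max 0 (min u T))) univ := by
  set h : ℝ → ℝ := fun t => ∫ u in Iic t, |p u| ∂μ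
  have hmono : Monotone h := fun a b hab => setIntegral_mono_set hf.integrable.abs.integrableOn
    (Eventually.of_forall fun _ => abs_nonneg _) (Iic_subset_Iic.mpr hab).eventuallyLE
  have hle : ∀ a b, a ≤ b → |f (max 0 (min b T)) - f (max 0 (min a T))| ≤ |h b - h a| := by
    intro a b hab
    have e : ∀ r : ℝ → ℝ, Integrable r μ →
        ∫ u in Iic b, r u ∂μ = (∫ u in Iic a, r u ∂μ) + ∫ u in Ioc a b, r u ∂μ := fun r hr => by
      rw [← Iic_union_Ioc_eq_Iic hab, setIntegral_union (Iic_disjoint_Ioc le_rfl)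
        measurableSet_Ioc hr.integrableOn hr.integrableOn]
    rw [hf.clamp_eq hT hμ, hf.clamp_eq hT hμ, abs_of_nonneg (sub_nonneg.mpr (hmono hab)),
      show h b = _ from e _ hf.integrable.abs, e _ hf.integrable]
    simp only [add_sub_add_left_eq_sub, add_sub_cancel_left, h]
    exact norm_integral_le_integral_norm (f := p) (μ := μ.restrict (Ioc a b))
  have hb : BoundedVariationOn h univ := (hmono.monotoneOn univ).boundedVariationOn
    (C := ∫ u, |p u| ∂μ) fun x _ => by
      rw [abs_of_nonneg (integral_nonneg fun _ => abs_nonneg _)]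
      exact setIntegral_le_integral hf.integrable.abs (Eventually.of_forall fun _ => abs_nonneg _)
  refine ne_top_of_le_ne_top hb (eVariationOn_le_of_edist_le fun x _ y _ => ?_)
  rw [edist_dist, edist_dist, Real.dist_eq, Real.dist_eq]
  refine ENNReal.ofReal_le_ofReal ?_
  rcases le_total x y with hxy | hxy
  · rw [abs_sub_comm, abs_sub_comm (h x)]; exact hle x y hxy
  · exact hle y x hxy

/-- The two signed measures agree on the half-lines `Iic t`, a generating π-system, and on the whole
line. This converts all Stieltjes integrals into integrals against `μ`. -/
theorem stieltjes_eq (hT : 0 ≤ T) (hμ : μ (Ioc 0 T)ᶜ = 0) (hf : IsPrim μ T f p) :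
    stieltjes T f = μ.withDensityᵥ p := by
  have hbv := hf.boundedVariationOn_clamp hT hμ
  rw [stieltjes, dif_pos hbv]
  set F : ℝ → ℝ := fun u => f (max 0 (min u T)) with hF
  have hright := rightLim_clamp fun u hu => hf.tendsto_right hu
  have hbot : limUnder atBot F = f 0 := by
    refine Tendsto.limUnder_eq (tendsto_const_nhds.congr' ?_)
    filter_upwards [eventually_le_atBot 0] with r hr
    rw [hF]; dsimp only; rw [max_eq_left ((min_le_left _ _).trans hr)]
  have htop : limUnder atTop F = f T := by
    refine Tendsto.limUnder_eq (tendsto_const_nhds.congr' ?_)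
    filter_upwards [eventually_ge_atTop T] with r hr
    rw [hF]; dsimp only; rw [min_eq_right hr, max_eq_right hT]
  refine VectorMeasure.ext_of_generateFrom (range Iic) ?_
    (by rw [← borel_eq_generateFrom_Iic]; exact BorelSpace.measurable_eq) isPiSystem_Iic ?_
  · rintro _ ⟨t, rfl⟩
    rw [hbv.vectorMeasure_Iic, hright, hbot, withDensityᵥ_apply hf.integrable measurableSet_Iic,
      hf.clamp_eq hT hμ]
    ring
  · rw [hbv.vectorMeasure_univ, hbot, htop, withDensityᵥ_apply hf.integrable MeasurableSet.univ,
      hf.eq_add T ⟨hT, le_rfl⟩]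
    rw [add_sub_cancel_left]
    refine setIntegral_congr_set ?_
    have : ∀ᵐ u ∂μ, u ∈ Ioc 0 T := by rwa [ae_iff]
    filter_upwards [this] with u hu
    exact propext ⟨fun _ => trivial, fun _ => hu⟩

end IsPrim

/-! ### Integration against a signed measure given by a density. -/

section VectorIntegral

variable {μ : Measure ℝ} {p h : ℝ → ℝ}

theorem restrict_withDensityᵥ (hp : Integrable p μ) {s : Set ℝ} (hs : MeasurableSet s) :
    (μ.withDensityᵥ p).restrict s = (μ.restrict s).withDensityᵥ p := by
  ext t ht
  rw [VectorMeasure.restrict_apply _ hs ht, withDensityᵥ_apply hp (ht.inter hs),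
    withDensityᵥ_apply hp.integrableOn ht, Measure.restrict_restrict ht]

/-- The variation has density `|p|`, and multiplication by the bounded sign of `p` passes between `h
|p|` and `h p`. -/
theorem integrable_withDensityᵥ_iff (hp : Integrable p μ) :
    (μ.withDensityᵥ p).Integrable h ↔ Integrable (fun u => h u * p u) μ := by
  rw [VectorMeasure.Integrable, Measure.variation_withDensityᵥ hp,
    integrable_withDensity_iff_integrable_smul₀' hp.aestronglyMeasurable.enorm
    (Eventually.of_forall fun u => enorm_lt_top)]
  have hm : AEStronglyMeasurable (fun u => if p u < 0 then (-1 : ℝ) else 1) μ :=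
    (((measurable_const.ite measurableSet_Iio measurable_const :
      Measurable fun r : ℝ => if r < 0 then (-1 : ℝ) else 1)).comp_aemeasurable
      hp.aemeasurable).aestronglyMeasurable
  have hb : ∀ᵐ u ∂μ, ‖(if p u < 0 then (-1 : ℝ) else 1)‖ ≤ 1 :=
    Eventually.of_forall fun u => by split_ifs <;> simp
  constructor
  · intro H
    refine (H.bdd_mul hm hb).congr (Eventually.of_forall fun u => ?_)
    simp only [toReal_enorm, Real.norm_eq_abs, smul_eq_mul]
    split_ifs with h0
    · rw [abs_of_neg h0]; ring
    · rw [abs_of_nonneg (not_lt.mp h0)]; ring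
  · intro H
    refine (H.bdd_mul hm hb).congr (Eventually.of_forall fun u => ?_)
    simp only [toReal_enorm, Real.norm_eq_abs, smul_eq_mul]
    split_ifs with h0
    · rw [abs_of_neg h0]; ring
    · rw [abs_of_nonneg (not_lt.mp h0)]; ring

/-- The density is split into positive and negative parts, each of which defines an ordinary finite
measure. -/
theorem integral_withDensityᵥ (hp : Integrable p μ) (hh : Integrable (fun u => h u * p u) μ) :
    (∫ᵛ u, h u ∂•(μ.withDensityᵥ p)) = ∫ u, h u * p u ∂μ := by
  have hflip : (ContinuousLinearMap.lsmul ℝ ℝ : ℝ →L[ℝ] ℝ →L[ℝ] ℝ) =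
      (ContinuousLinearMap.lsmul ℝ ℝ).flip := by
    ext; simp
  have hI : ∀ q : ℝ → ℝ, Integrable q μ → Integrable (fun u => h u * q u) μ →
      Integrable (fun u => (ENNReal.ofReal (q u)).toReal • h u) μ := by
    intro q hq hhq
    have hm : AEStronglyMeasurable (fun u => if q u < 0 then (0 : ℝ) else 1) μ :=
      (((measurable_const.ite measurableSet_Iio measurable_const :
        Measurable fun r : ℝ => if r < 0 then (0 : ℝ) else 1)).comp_aemeasurable
        hq.aemeasurable).aestronglyMeasurable
    refine (hhq.bdd_mul (c := 1) hm (Eventually.of_forall fun u => by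
      split_ifs <;> simp)).congr (Eventually.of_forall fun u => ?_)
    simp only [smul_eq_mul]
    split_ifs with h0
    · rw [ENNReal.ofReal_of_nonpos h0.le]; simp
    · rw [ENNReal.toReal_ofReal (not_lt.mp h0)]; ring
  have hneg : Integrable (fun u => h u * -p u) μ := by simpa using hh.neg
  have h1 := hI p hp hh
  have h2 := hI (fun u => -p u) hp.neg hneg
  have hm1 : AEMeasurable (fun u => ENNReal.ofReal (p u)) μ := hp.aemeasurable.ennreal_ofReal
  have hm2 : AEMeasurable (fun u => ENNReal.ofReal (-p u)) μ := hp.neg.aemeasurable.ennreal_ofReal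
  have hl1 : ∀ᵐ u ∂μ, ENNReal.ofReal (p u) < ⊤ :=
    Eventually.of_forall fun _ => ENNReal.ofReal_lt_top
  have hl2 : ∀ᵐ u ∂μ, ENNReal.ofReal (-p u) < ⊤ :=
    Eventually.of_forall fun _ => ENNReal.ofReal_lt_top
  have := isFiniteMeasure_withDensity_ofReal hp.2
  have := isFiniteMeasure_withDensity_ofReal hp.neg.2
  rw [withDensityᵥ_eq_withDensity_pos_part_sub_withDensity_neg_part hp,
    VectorMeasure.integral_sub_vectorMeasure
      (by rwa [VectorMeasure.Integrable, Measure.variation_toSignedMeasure,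
        integrable_withDensity_iff_integrable_smul₀' hm1 hl1])
      (by rwa [VectorMeasure.Integrable, Measure.variation_toSignedMeasure,
        integrable_withDensity_iff_integrable_smul₀' hm2 hl2]),
    hflip, VectorMeasure.integral_toSignedMeasure, VectorMeasure.integral_toSignedMeasure,
    integral_withDensity_eq_integral_toReal_smul₀ hm1 hl1,
    integral_withDensity_eq_integral_toReal_smul₀ hm2 hl2, ← integral_sub h1 h2]
  refine integral_congr_ae (Eventually.of_forall fun u => ?_)
  simp only [smul_eq_mul]
  rcases le_total 0 (p u) with h0 | h0
  · rw [ENNReal.toReal_ofReal h0, ENNReal.ofReal_of_nonpos (by linarith)]; simp [mul_comm]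
  · rw [ENNReal.toReal_ofReal (by linarith : 0 ≤ -p u), ENNReal.ofReal_of_nonpos h0]
    simp [mul_comm]

end VectorIntegral

/-- The atoms of a measure. -/
def atoms (μ : Measure ℝ) : Set ℝ := {u | μ {u} ≠ 0}

theorem countable_atoms (μ : Measure ℝ) [SFinite μ] : (atoms μ).Countable := by
  have := Measure.countable_meas_pos_of_disjoint_iUnion (μ := μ) (As := fun u : ℝ => {u})
    (fun u => measurableSet_singleton u) fun a b hab => disjoint_singleton.mpr hab
  simpa [atoms, pos_iff_ne_zero] using this

theorem measurableSet_atoms (μ : Measure ℝ) [SFinite μ] : MeasurableSet (atoms μ) :=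
  (countable_atoms μ).measurableSet

/-- The sum of `p u μ{u}` is the integral of `p` over the atoms of `μ`. -/
theorem hasSum_atoms {μ : Measure ℝ} [SFinite μ] {p : ℝ → ℝ} (hp : Integrable p μ) (s : Set ℝ) :
    HasSum (fun u : s => μ.real {(u : ℝ)} * p u) (∫ u in s ∩ atoms μ, p u ∂μ) := by
  have hc : Countable ↥(s ∩ atoms μ) := ((countable_atoms μ).mono inter_subset_right).to_subtype
  have h := hasSum_integral_iUnion (μ := μ) (f := p) (s := fun u : ↥(s ∩ atoms μ) => {(u : ℝ)})
    (fun u => measurableSet_singleton _)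
    (fun a b hab => disjoint_singleton.mpr fun e => hab (Subtype.ext e)) hp.integrableOn
  rw [iUnion_coe_set, biUnion_of_singleton] at h
  simp only [integral_singleton, smul_eq_mul] at h
  have h1 := hasSum_subtype_iff_indicator (f := fun u => μ.real {u} * p u).mp h
  -- Off the atoms the summand is zero, so the countable sum extends to all of `s`.
  have e : (s ∩ atoms μ).indicator (fun u => μ.real {u} * p u) =
      s.indicator fun u => μ.real {u} * p u := by
    rw [inter_comm, ← indicator_indicator]
    funext u
    by_cases hu : u ∈ atoms μ
    · rw [indicator_of_mem hu]
    · rw [indicator_of_notMem hu]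
      have : μ.real {u} = 0 := by
        rw [Measure.real, not_not.mp hu, ENNReal.toReal_zero]
      simp [indicator, this]
  rw [e] at h1
  exact hasSum_subtype_iff_indicator (f := fun u => μ.real {u} * p u).mpr h1

end JumpMagnus

/-! ### A common driving measure, bounded and integrable coefficients. -/

namespace JumpMagnus

variable {d : ℕ}

/-- A finite measure `μ` on `(0, T]` with respect to which `X` has the density `x`. -/
structure Driver (μ : Measure ℝ) (T : ℝ) (X x : ℝ → TensorSeries d) : Prop where
  nonneg : 0 ≤ T
  finite : IsFiniteMeasure μ
  null : μ (Ioc 0 T)ᶜ = 0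
  mem_T0 : ∀ u, x u ∈ T0 d
  prim : ∀ w, IsPrim μ T (fun t => X t w) (fun u => x u w)

theorem exists_driver {T : ℝ} (hT : 0 ≤ T) {X : ℝ → TensorSeries d} (hX : IsBVPath T X) :
    ∃ (μ : Measure ℝ) (x : ℝ → TensorSeries d), Driver μ T X x := by
  set ν : List (Fin d) → SignedMeasure ℝ := fun w => stieltjes T (fun u => X u w) with hν
  have hfin : ∀ w, IsFiniteMeasure (ν w).variation := fun w => by
    rw [← SignedMeasure.totalVariation_eq_variation]; infer_instance
  have hIoc : ∀ w t, t ∈ Icc 0 T → ν w (Ioc 0 t) = X t w - X 0 w := by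
    intro w t ht
    have hbv : BoundedVariationOn (fun u => X (max 0 (min u T)) w) univ := by
      refine ne_top_of_le_ne_top (hX.boundedVariation w) ?_
      refine eVariationOn.comp_le_of_monotoneOn (fun t => X t w) (fun u => max 0 (min u T)) ?_ ?_
      · intro a _ b _ hab
        exact max_le_max le_rfl (min_le_min hab le_rfl)
      · intro a _
        exact ⟨le_max_left _ _, max_le hT (min_le_right _ _)⟩
    have hr := rightLim_clamp (f := fun t => X t w) (hX.cadlag w).1
    rw [hν]
    dsimp only
    rw [stieltjes, dif_pos hbv, hbv.vectorMeasure_Ioc ht.1, hr, hr, min_eq_left ht.2,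
      max_eq_right ht.1, min_eq_left hT, max_self]
  -- A countable sum of finite measures is s-finite but possibly infinite; `toFinite` provides a
  -- finite measure with the same null sets.
  set μ₀ : Measure ℝ := Measure.sum fun w => (ν w).variation with hμ₀
  set μ : Measure ℝ := μ₀.toFinite.restrict (Ioc 0 T) with hμ
  have hac : ∀ w, (ν w).restrict (Ioc 0 T) ≪ᵥ μ.toENNRealVectorMeasure := by
    intro w
    refine VectorMeasure.AbsolutelyContinuous.mk fun s hs h0 => ?_
    rw [Measure.toENNRealVectorMeasure_apply_measurable hs, hμ, Measure.restrict_apply hs] at h0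
    have h1 : μ₀ (s ∩ Ioc 0 T) = 0 := absolutelyContinuous_toFinite μ₀ h0
    rw [hμ₀, Measure.sum_apply_eq_zero] at h1
    rw [VectorMeasure.restrict_apply _ measurableSet_Ioc hs]
    have h2 := (ν w).enorm_measure_le_variation (s ∩ Ioc 0 T)
    rw [h1 w] at h2
    simpa using h2
  -- The scalar component is set to zero by hand, so that the density lies in `T0` at every `u` and
  -- not only almost everywhere.
  set x : ℝ → TensorSeries d := fun u w =>
    if w = [] then 0 else SignedMeasure.rnDeriv ((ν w).restrict (Ioc 0 T)) μ u with hx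
  refine ⟨μ, x, hT, inferInstance, ?_, fun u => ?_, fun w => ?_⟩
  · rw [hμ, Measure.restrict_apply measurableSet_Ioc.compl, compl_inter_self, measure_empty]
  · exact mem_T0.mpr (by simp [hx])
  · by_cases hw : w = []
    · subst hw
      refine ⟨by simp [hx], fun t ht => ?_⟩
      have h1 : X t [] = 0 := hX.mem_T0 t ht
      have h2 : X 0 [] = 0 := hX.mem_T0 0 ⟨le_rfl, hT⟩
      simp [hx, h1, h2]
    · have hxw : (fun u => x u w) = SignedMeasure.rnDeriv ((ν w).restrict (Ioc 0 T)) μ := by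
        funext u; simp [hx, hw]
      rw [hxw]
      refine ⟨SignedMeasure.integrable_rnDeriv _ _, fun t ht => ?_⟩
      rw [← withDensityᵥ_apply (SignedMeasure.integrable_rnDeriv _ _) measurableSet_Ioc,
        SignedMeasure.withDensityᵥ_rnDeriv_eq _ _ (hac w),
        VectorMeasure.restrict_apply _ measurableSet_Ioc measurableSet_Ioc,
        inter_eq_left.mpr (Ioc_subset_Ioc_right ht.2), hIoc w t ht]
      ring

/-- Essentially bounded measurable functions. -/
def bddAlg (μ : Measure ℝ) : Subalgebra ℝ (ℝ → ℝ) where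
  carrier := {f | AEStronglyMeasurable f μ ∧ ∃ C, ∀ᵐ u ∂μ, ‖f u‖ ≤ C}
  mul_mem' := by
    rintro f g ⟨hf, C, hC⟩ ⟨hg, D, hD⟩
    refine ⟨hf.mul hg, C * D, ?_⟩
    filter_upwards [hC, hD] with u h1 h2
    rw [Pi.mul_apply, norm_mul]
    exact mul_le_mul h1 h2 (norm_nonneg _) ((norm_nonneg _).trans h1)
  add_mem' := by
    rintro f g ⟨hf, C, hC⟩ ⟨hg, D, hD⟩
    refine ⟨hf.add hg, C + D, ?_⟩
    filter_upwards [hC, hD] with u h1 h2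
    exact (norm_add_le _ _).trans (add_le_add h1 h2)
  algebraMap_mem' c := ⟨aestronglyMeasurable_const, ‖c‖, Eventually.of_forall fun _ => le_rfl⟩

/-- Integrable functions. -/
def l1Sub (μ : Measure ℝ) : Submodule ℝ (ℝ → ℝ) where
  carrier := {f | Integrable f μ}
  add_mem' := fun hf hg => Integrable.add hf hg
  zero_mem' := integrable_zero _ _ _
  smul_mem' := fun c _ hf => Integrable.smul c hf

theorem bddAlg_mul_l1Sub {μ : Measure ℝ} (f : ℝ → ℝ) (hf : f ∈ bddAlg μ) (g : ℝ → ℝ)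
    (hg : g ∈ l1Sub μ) : f * g ∈ l1Sub μ :=
  Integrable.bdd_mul hg hf.1 hf.2.choose_spec

theorem bddAlg_congr {μ : Measure ℝ} {f g : ℝ → ℝ} (hf : f ∈ bddAlg μ) (h : f =ᵐ[μ] g) :
    g ∈ bddAlg μ :=
  ⟨hf.1.congr h, hf.2.imp fun C hC => by filter_upwards [hC, h] with u h1 h2; rwa [← h2]⟩

/-- Nothing is known about `f` off `[0, T]`, so measurability and the bound are shown for the
integral formula, which equals `f` almost everywhere. -/
theorem IsPrim.mem_bddAlg {μ : Measure ℝ} {T : ℝ} {f p : ℝ → ℝ} (hμ : μ (Ioc 0 T)ᶜ = 0)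
    (hf : IsPrim μ T f p) : f ∈ bddAlg μ := by
  have hm : (fun u => f 0 + ∫ v in Ioc 0 u, p v ∂μ) ∈ bddAlg μ := by
    refine ⟨(measurable_const.add (measurable_setIntegral_of_monotone hf.integrable
      fun a b hab => Ioc_subset_Ioc_right hab)).aestronglyMeasurable,
      ‖f 0‖ + ∫ u, |p u| ∂μ, Eventually.of_forall fun u => ?_⟩
    exact (norm_add_le _ _).trans (add_le_add le_rfl (hf.abs_setIntegral_le _))
  refine bddAlg_congr hm ?_
  have : ∀ᵐ u ∂μ, u ∈ Ioc 0 T := by rwa [ae_iff]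
  filter_upwards [this] with u hu
  rw [hf.eq_add u ⟨hu.1.le, hu.2⟩]

theorem IsPrim.leftLim_mem_bddAlg {μ : Measure ℝ} {T : ℝ} {f p : ℝ → ℝ}
    (hμ : μ (Ioc 0 T)ᶜ = 0) (hf : IsPrim μ T f p) : Function.leftLim f ∈ bddAlg μ := by
  have hm : (fun u => f 0 + ∫ v in Ioo 0 u, p v ∂μ) ∈ bddAlg μ := by
    refine ⟨(measurable_const.add (measurable_setIntegral_of_monotone hf.integrable
      fun a b hab => Ioo_subset_Ioo_right hab)).aestronglyMeasurable,
      ‖f 0‖ + ∫ u, |p u| ∂μ, Eventually.of_forall fun u => ?_⟩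
    exact (norm_add_le _ _).trans (add_le_add le_rfl (hf.abs_setIntegral_le _))
  refine bddAlg_congr hm ?_
  have : ∀ᵐ u ∂μ, u ∈ Ioc 0 T := by rwa [ae_iff]
  filter_upwards [this] with u hu
  rw [hf.leftLim_eq hu]

/-! ### Integrals of operators against paths, in terms of densities. -/

namespace TensorSeries

theorem e_apply (v w : List (Fin d)) : e v w = if w = v then 1 else 0 := rfl

/-- A series agrees with its expansion in the words of length `≤ N` up to level `N`. -/
theorem sub_sum_words_mem (x : TensorSeries d) (N : ℕ) :
    x - ∑ k ∈ Finset.range (N + 1), ∑ v : Fin k → Fin d, x (List.ofFn v) • e (List.ofFn v)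
      ∈ fil d (N + 1) := by
  intro w hw
  rw [sub_apply, sum_apply, sub_eq_zero, Finset.sum_eq_single w.length, sum_apply,
    Finset.sum_eq_single w.get]
  · simp [e_apply]
  · intro v _ hv
    rw [smul_apply, e_apply, if_neg, mul_zero]
    intro h
    apply hv
    apply List.ofFn_injective
    rw [← h, List.ofFn_get]
  · simp
  · intro k _ hk
    rw [sum_apply]
    refine Finset.sum_eq_zero fun v _ => ?_
    rw [smul_apply, e_apply, if_neg, mul_zero]
    rintro rfl
    simp at hk
  · simp; omega

/-- A filtered operator applied to a series, by expansion in words. -/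
theorem apply_eq_sum_words {A : Module.End ℝ (TensorSeries d)}
    (hA : ∀ n x, x ∈ fil d n → A x ∈ fil d n) (x : TensorSeries d) (w : List (Fin d)) :
    A x w = ∑ k ∈ Finset.range (w.length + 1), ∑ v : Fin k → Fin d,
      A (e (List.ofFn v)) w * x (List.ofFn v) := by
  have h := hA _ _ (sub_sum_words_mem x w.length) w (Nat.lt_succ_self _)
  rw [map_sub, sub_apply, sub_eq_zero] at h
  rw [h, map_sum, sum_apply]
  refine Finset.sum_congr rfl fun k _ => ?_
  rw [map_sum, sum_apply]
  refine Finset.sum_congr rfl fun v _ => ?_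
  rw [map_smul, smul_apply, mul_comm]

end TensorSeries

section OpIntegral

variable {μ : Measure ℝ} {T : ℝ} {g γ : ℝ → TensorSeries d} {s t : ℝ}
  {A : ℝ → Module.End ℝ (TensorSeries d)}

theorem opIntegrable_iff (hT : 0 ≤ T) (hμ : μ (Ioc 0 T)ᶜ = 0)
    (hg : ∀ w, IsPrim μ T (fun t => g t w) (fun t => γ t w))
    {F : ℝ → TensorSeries d → TensorSeries d} :
    OpIntegrable T F g s t ↔ ∀ v w, v.length ≤ w.length →
      IntegrableOn (fun u => F u (e v) w * γ u v) (Ioc s t) μ := by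
  refine forall_congr' fun v => forall_congr' fun w => imp_congr_right fun _ => ?_
  rw [(hg v).stieltjes_eq hT hμ, restrict_withDensityᵥ (hg v).integrable measurableSet_Ioc,
    integrable_withDensityᵥ_iff (hg v).integrable.integrableOn]
  rfl

/-- An operator that does not lower the order sees, at the word `w`, only the words of length at
most `|w|` of its argument. The sum over words in `opIntegral` is therefore the expansion of `A u (γ
u)`. -/
theorem opIntegral_eq (hT : 0 ≤ T) (hμ : μ (Ioc 0 T)ᶜ = 0)
    (hg : ∀ w, IsPrim μ T (fun t => g t w) (fun t => γ t w))
    (hA : ∀ u ∈ Ioc s t, ∀ n x, x ∈ fil d n → A u x ∈ fil d n)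
    (hint : OpIntegrable T (fun u => A u) g s t) (w : List (Fin d)) :
    IntegrableOn (fun u => A u (γ u) w) (Ioc s t) μ ∧
      opIntegral T (fun u => A u) g s t w = ∫ u in Ioc s t, A u (γ u) w ∂μ := by
  have hi := (opIntegrable_iff hT hμ hg).mp hint
  have hsum : EqOn (fun u => A u (γ u) w) (fun u => ∑ k ∈ Finset.range (w.length + 1),
      ∑ v : Fin k → Fin d, A u (e (List.ofFn v)) w * γ u (List.ofFn v)) (Ioc s t) :=
    fun u hu => apply_eq_sum_words (hA u hu) (γ u) w
  have hi2 : ∀ k ∈ Finset.range (w.length + 1), ∀ v : Fin k → Fin d,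
      IntegrableOn (fun u => A u (e (List.ofFn v)) w * γ u (List.ofFn v)) (Ioc s t) μ :=
    fun k hk v => hi _ _ (by
      rw [List.length_ofFn]; exact Nat.lt_succ_iff.mp (Finset.mem_range.mp hk))
  constructor
  · refine IntegrableOn.congr_fun ?_ hsum.symm measurableSet_Ioc
    exact integrable_finsetSum _ fun k hk => integrable_finsetSum _ fun v _ => hi2 k hk v
  · rw [setIntegral_congr_fun measurableSet_Ioc hsum, integral_finsetSum _ fun k hk =>
      integrable_finsetSum _ fun v _ => hi2 k hk v, opIntegral]
    refine Finset.sum_congr rfl fun k hk => ?_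
    rw [integral_finsetSum _ fun v _ => hi2 k hk v]
    refine Finset.sum_congr rfl fun v _ => ?_
    rw [(hg _).stieltjes_eq hT hμ, restrict_withDensityᵥ (hg _).integrable measurableSet_Ioc,
      integral_withDensityᵥ (hg _).integrable.integrableOn (hi2 k hk v)]

end OpIntegral

/-! ### Left limits under algebraic operations. -/

section LeftLimits

/-- Componentwise convergence from the left. -/
def HasLeft (F : ℝ → TensorSeries d) (l : TensorSeries d) (u : ℝ) : Prop :=
  ∀ w, Tendsto (fun t => F t w) (𝓝[<] u) (𝓝 (l w))

variable {F G : ℝ → TensorSeries d} {l m : TensorSeries d} {u : ℝ}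

theorem HasLeft.left_eq (h : HasLeft F l u) : left F u = l := by
  ext w
  exact leftLim_eq_of_tendsto (h w)

theorem HasLeft.const (x : TensorSeries d) : HasLeft (fun _ => x) x u :=
  fun _ => tendsto_const_nhds

theorem HasLeft.sub (hF : HasLeft F l u) (hG : HasLeft G m u) :
    HasLeft (fun t => F t - G t) (l - m) u := fun w => (hF w).sub (hG w)

theorem HasLeft.mul (hF : HasLeft F l u) (hG : HasLeft G m u) :
    HasLeft (fun t => F t * G t) (l * m) u := fun w => by
  simp only [mul_apply]
  exact tendsto_finsetSum _ fun i _ => (hF _).mul (hG _)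

theorem HasLeft.pow (hF : HasLeft F l u) (k : ℕ) : HasLeft (fun t => F t ^ k) (l ^ k) u := by
  induction k with
  | zero => simpa using HasLeft.const 1
  | succ k ih => simpa only [pow_succ] using ih.mul hF

theorem HasLeft.evalS (hF : HasLeft F l u) (f : PowerSeries ℝ) :
    HasLeft (fun t => TensorSeries.evalS f (F t)) (TensorSeries.evalS f l) u := fun w => by
  simp only [evalS_apply]
  exact tendsto_finsetSum _ fun k _ => (hF.pow k w).const_mul _

theorem HasLeft.texp (hF : HasLeft F l u) :
    HasLeft (fun t => TensorSeries.texp (F t)) (TensorSeries.texp l) u := by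
  simpa only [texp_eq_evalS] using hF.evalS _

theorem HasLeft.tlog (hF : HasLeft F l u) :
    HasLeft (fun t => TensorSeries.tlog (F t)) (TensorSeries.tlog l) u := by
  simpa only [tlog_eq_evalS] using (hF.sub (HasLeft.const 1)).evalS _

end LeftLimits

end JumpMagnus

/-! ### Existence and uniqueness of the signature. -/

namespace JumpMagnus

variable {d : ℕ} {μ : Measure ℝ} {T : ℝ}

namespace IsPrim

variable {f g p q : ℝ → ℝ}

theorem congr_on (hT : 0 ≤ T) (hf : IsPrim μ T f p) (h : EqOn f g (Icc 0 T)) : IsPrim μ T g p :=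
  ⟨hf.integrable, fun t ht => by rw [← h ht, ← h ⟨le_rfl, hT⟩, hf.eq_add t ht]⟩

theorem sum {ι : Type*} (s : Finset ι) {f p : ι → ℝ → ℝ} (h : ∀ i ∈ s, IsPrim μ T (f i) (p i)) :
    IsPrim μ T (fun t => ∑ i ∈ s, f i t) (fun t => ∑ i ∈ s, p i t) := by
  classical
  induction s using Finset.induction_on with
  | empty => simpa using IsPrim.const 0
  | insert i s his ih =>
    simp only [Finset.sum_insert his]
    exact (h i (by simp)).add (ih fun j hj => h j (by simp [hj]))

theorem density_unique (hT : 0 ≤ T) (hμ : μ (Ioc 0 T)ᶜ = 0) [IsFiniteMeasure μ]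
    (hp : IsPrim μ T f p) (hq : IsPrim μ T f q) : p =ᵐ[μ] q :=
  hp.integrable.ae_eq_of_withDensityᵥ_eq hq.integrable
    ((hp.stieltjes_eq hT hμ).symm.trans (hq.stieltjes_eq hT hμ))

end IsPrim

theorem IsPrim.comp_mul [IsFiniteMeasure μ] (hμ : μ (Ioc 0 T)ᶜ = 0) {F G ξ γ : ℝ → TensorSeries d}
    (hF : CompDeriv (IsPrim μ T) F ξ) (hG : CompDeriv (IsPrim μ T) G γ) :
    CompDeriv (IsPrim μ T) (fun t => F t * G t) (fun t => left F t * γ t + ξ t * G t) := by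
  intro w
  simp only [mul_apply, add_apply, ← Finset.sum_add_distrib]
  exact IsPrim.sum _ fun i _ => IsPrim.mul hμ (hF _) (hG _)

/-- The sum over the atoms of a function vanishing elsewhere is its integral. -/
theorem hasSum_setIntegral [IsFiniteMeasure μ] {p : ℝ → ℝ} (hp : Integrable p μ) {s : Set ℝ}
    (hs : MeasurableSet s) (h : ∀ u ∈ s, μ {u} = 0 → p u = 0) :
    HasSum (fun u : s => μ.real {(u : ℝ)} * p u) (∫ u in s, p u ∂μ) := by
  have h1 : ∫ u in s, p u ∂μ = ∫ u in s ∩ atoms μ, p u ∂μ :=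
    setIntegral_eq_of_subset_of_forall_sdiff_eq_zero hs inter_subset_left
      fun u hu => h u hu.1 (by_contra fun h0 => hu.2 ⟨hu.1, h0⟩)
  exact h1 ▸ hasSum_atoms hp s

namespace TensorSeries

/-- This is the triangularity of the signature equation: a right factor without scalar component
only sees strictly shorter words of the left factor. -/
theorem mul_apply_congr {a b y : TensorSeries d} (hy : y ∈ T0 d) {w : List (Fin d)}
    (h : ∀ i < w.length, a (w.take i) = b (w.take i)) : (a * y) w = (b * y) w := by
  rw [mul_apply, mul_apply, Finset.sum_range_succ, Finset.sum_range_succ, List.drop_length,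
    mem_T0.mp hy, mul_zero, mul_zero]
  congr 1
  exact Finset.sum_congr rfl fun i hi => by rw [h i (Finset.mem_range.mp hi)]

theorem mul_evalS_expQuot {x : TensorSeries d} (hx : x ∈ T0 d) :
    x * evalS expQuot x = texp x - 1 := by
  have h : LinearMap.mulLeft ℝ x (opS expQuot (LinearMap.mulLeft ℝ x) 1) =
      opS (PowerSeries.X * expQuot) (LinearMap.mulLeft ℝ x) 1 := by
    rw [opS_mul (mulLeft_raising hx), opS_X (mulLeft_raising hx)]
    rfl
  have h2 : (PowerSeries.X * expQuot : PowerSeries ℝ) = PowerSeries.exp ℝ - 1 := by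
    ext k
    cases k with
    | zero => simp
    | succ k =>
      rw [PowerSeries.coeff_succ_X_mul]
      simp [expQuot, PowerSeries.coeff_exp, PowerSeries.coeff_one]
  rw [LinearMap.mulLeft_apply, h2, opS_sub, opS_one] at h
  rw [texp_eq_evalS]
  exact h

end TensorSeries

section Dyson

/-- The words of the solution of `K_t = 1 + ∫_{(0,t]} K_{u-} y_u μ(du)`. -/
noncomputable def dyson (μ : Measure ℝ) (y : ℝ → TensorSeries d) : List (Fin d) → ℝ → ℝ
  -- The prefix `w` itself is left out of the sum: it would be multiplied by the scalar component of
  -- `y`, which is zero in all uses. Hence the recursion terminates.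
  | w => fun t => (1 : TensorSeries d) w + ∫ u in Ioc 0 t, ∑ i : Fin w.length,
      Function.leftLim (dyson μ y (w.take i)) u * y u (w.drop i) ∂μ
termination_by w => w.length
decreasing_by simp [List.length_take]

variable {y : ℝ → TensorSeries d}

/-- The solution of `K_t = 1 + ∫_{(0,t]} K_{u-} y_u μ(du)`. -/
noncomputable def dysonSeries (μ : Measure ℝ) (y : ℝ → TensorSeries d) (t : ℝ) : TensorSeries d :=
  fun w => dyson μ y w t

theorem dysonSeries_apply_nil (t : ℝ) : dysonSeries μ y t [] = 1 := by
  rw [dysonSeries, dyson]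
  simp [one_apply]

theorem isPrim_dysonSeries (hμ : μ (Ioc 0 T)ᶜ = 0) (hy0 : ∀ u, y u ∈ T0 d)
    (hy : CompIn (l1Sub μ) y) :
    CompDeriv (IsPrim μ T) (dysonSeries μ y) (fun u => left (dysonSeries μ y) u * y u) := by
  intro w
  induction hn : w.length using Nat.strong_induction_on generalizing w with
  | _ n ih =>
    subst hn
    have hdens : (fun u => (left (dysonSeries μ y) u * y u) w) = fun u => ∑ i : Fin w.length,
        Function.leftLim (dyson μ y (w.take i)) u * y u (w.drop i) := by
      funext u
      rw [mul_apply, Finset.sum_range_succ, List.drop_length, mem_T0.mp (hy0 u), mul_zero,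
        add_zero, Finset.sum_range]
      rfl
    rw [hdens]
    refine ⟨integrable_finsetSum _ fun i _ => ?_, fun t ht => ?_⟩
    · exact bddAlg_mul_l1Sub _ (IsPrim.leftLim_mem_bddAlg hμ
        (ih (w.take i).length (by simp [List.length_take]) (w.take i) rfl)) _ (hy _)
    · simp only [dysonSeries]
      rw [dyson]
      simp

end Dyson

/-- The density of the multiplicative increments of a path with density `x`. -/
noncomputable def marcus (μ : Measure ℝ) (x : ℝ → TensorSeries d) (u : ℝ) : TensorSeries d :=
  x u * evalS expQuot (μ.real {u} • x u)

theorem CompDeriv.hasLeft {F ξ : ℝ → TensorSeries d} (h : CompDeriv (IsPrim μ T) F ξ) {u : ℝ}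
    (hu : u ∈ Ioc 0 T) : HasLeft F (left F u) u := fun w => (h w).tendsto_leftLim hu

theorem CompDeriv.left_eq_self {F ξ : ℝ → TensorSeries d} (h : CompDeriv (IsPrim μ T) F ξ) {u : ℝ}
    (hu : u ∈ Ioc 0 T) (h0 : μ {u} = 0) : left F u = F u := by
  ext w
  exact (h w).leftLim_eq_self hu h0

theorem CompDeriv.jump_eq {F ξ : ℝ → TensorSeries d} (h : CompDeriv (IsPrim μ T) F ξ) {u : ℝ}
    (hu : u ∈ Ioc 0 T) : jump F u = μ.real {u} • ξ u := by
  ext w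
  exact (h w).sub_leftLim hu

theorem CompDeriv.compIn (hμ : μ (Ioc 0 T)ᶜ = 0) {F ξ : ℝ → TensorSeries d}
    (h : CompDeriv (IsPrim μ T) F ξ) : CompIn (Subalgebra.toSubmodule (bddAlg μ)) F :=
  fun w => (h w).mem_bddAlg hμ

theorem CompDeriv.compIn_left (hμ : μ (Ioc 0 T)ᶜ = 0) {F ξ : ℝ → TensorSeries d}
    (h : CompDeriv (IsPrim μ T) F ξ) : CompIn (Subalgebra.toSubmodule (bddAlg μ)) (left F) :=
  fun w => (h w).leftLim_mem_bddAlg hμ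

theorem CompDeriv.compIn_density {F ξ : ℝ → TensorSeries d}
    (h : CompDeriv (IsPrim μ T) F ξ) : CompIn (l1Sub μ) ξ := fun w => (h w).integrable

namespace Driver

variable {X x : ℝ → TensorSeries d} {s t : ℝ}

theorem compDeriv (D : Driver μ T X x) : CompDeriv (IsPrim μ T) X x := D.prim

theorem ae_mem (D : Driver μ T X x) : ∀ᵐ u ∂μ, u ∈ Ioc 0 T := by
  have := D.null
  rwa [ae_iff]

theorem mem_bddAlg_smul (D : Driver μ T X x) :
    CompIn (Subalgebra.toSubmodule (bddAlg μ)) (fun u => μ.real {u} • x u) := by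
  intro w
  refine bddAlg_congr (((D.compDeriv.compIn D.null).sub (D.compDeriv.compIn_left D.null)) w) ?_
  filter_upwards [D.ae_mem] with u hu
  rw [← D.compDeriv.jump_eq hu, jump]

theorem marcus_mem_T0 (D : Driver μ T X x) (u : ℝ) : marcus μ x u ∈ T0 d := by
  refine TensorSeries.mem_T0.mpr ?_
  rw [marcus, mul_apply_nil, TensorSeries.mem_T0.mp (D.mem_T0 u), zero_mul]

theorem compIn_marcus (D : Driver μ T X x) : CompIn (l1Sub μ) (marcus μ x) :=
  CompIn.mul_right bddAlg_mul_l1Sub D.compDeriv.compIn_density (D.mem_bddAlg_smul.evalS _)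

theorem marcus_of_null {u : ℝ} (h : μ {u} = 0) : marcus μ x u = x u := by
  have : μ.real {u} = 0 := by rw [Measure.real, h, ENNReal.toReal_zero]
  rw [marcus, this, zero_smul, evalS_zero]
  simp [expQuot]

/-- The definition of `marcus` is made for this identity: the drift and the Marcus correction of the
signature equation merge into one integral against `μ`. -/
theorem smul_marcus (D : Driver μ T X x) (u : ℝ) :
    μ.real {u} • marcus μ x u = texp (μ.real {u} • x u) - 1 := by
  rw [marcus, ← smul_mul_assoc, mul_evalS_expQuot ((T0 d).smul_mem _ (D.mem_T0 u))]

theorem opIntegrable (D : Driver μ T X x) {g γ : ℝ → TensorSeries d}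
    (hg : CompDeriv (IsPrim μ T) g γ) {F : ℝ → TensorSeries d → TensorSeries d}
    (hF : ∀ v, CompIn (Subalgebra.toSubmodule (bddAlg μ)) fun u => F u (e v)) :
    OpIntegrable T F g s t := by
  rw [opIntegrable_iff D.nonneg D.null hg]
  intro v w _
  exact Integrable.integrableOn (bddAlg_mul_l1Sub _ (hF v w) _ ((hg v).integrable))

/-- The path whose increments are the signature. -/
noncomputable def dev (_ : Driver μ T X x) : ℝ → TensorSeries d := dysonSeries μ (marcus μ x)

theorem dev_apply_nil (D : Driver μ T X x) (t : ℝ) : D.dev t [] = 1 := dysonSeries_apply_nil t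

theorem compDeriv_dev (D : Driver μ T X x) :
    CompDeriv (IsPrim μ T) D.dev (fun u => left D.dev u * marcus μ x u) :=
  isPrim_dysonSeries D.null D.marcus_mem_T0 D.compIn_marcus

theorem compDeriv_const_mul_dev (D : Driver μ T X x) (a : TensorSeries d) :
    CompDeriv (IsPrim μ T) (fun t => a * D.dev t) (fun u => a * (left D.dev u * marcus μ x u)) := by
  have := D.finite
  have h := IsPrim.comp_mul D.null (F := fun _ => a) (ξ := fun _ => 0)
    (fun w => IsPrim.const (a w)) D.compDeriv_dev
  simpa [(HasLeft.const a).left_eq] using h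

/-- The equation is linear under multiplication from the left, so multiplying `dev` by the inverse
of its value at `s` restarts it from `1`. -/
theorem isSignature (D : Driver μ T X x) (hs : s ∈ Icc 0 T) :
    IsSignature T X s (fun t => texp (-tlog (D.dev s)) * D.dev t) := by
  have := D.finite
  set a := texp (-tlog (D.dev s)) with ha
  set S : ℝ → TensorSeries d := fun t => a * D.dev t with hS
  have hSs : S s = 1 := texp_neg_tlog_mul (D.dev_apply_nil s)
  have hp : CompDeriv (IsPrim μ T) S (fun u => a * (left D.dev u * marcus μ x u)) :=
    D.compDeriv_const_mul_dev a
  have hleft : ∀ u ∈ Ioc 0 T, left S u = a * left D.dev u := fun u hu =>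
    ((HasLeft.const a).mul (D.compDeriv_dev.hasLeft hu)).left_eq
  have hsub : ∀ {t}, t ≤ T → Ioc s t ⊆ Ioc 0 T := fun ht => Ioc_subset_Ioc hs.1 ht
  have hop : ∀ t, OpIntegrable T (fun u x => left S u * x) X s t := fun t =>
    D.opIntegrable D.compDeriv fun v => (hp.compIn_left D.null).mul (CompIn.const _)
  -- The part of the density beyond the drift vanishes off the atoms, so its integral is the sum of
  -- the Marcus corrections.
  set p : ℝ → TensorSeries d := fun u => left S u * (marcus μ x u - x u) with hpdef
  have hpint : ∀ w, Integrable (fun u => p u w) μ := fun w =>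
    CompIn.mul_left bddAlg_mul_l1Sub (hp.compIn_left D.null)
      (D.compIn_marcus.sub D.compDeriv.compIn_density) w
  have hterm : ∀ u ∈ Ioc 0 T, ∀ w, μ.real {u} * p u w =
      (left S u * (texp (jump X u) - 1 - jump X u)) w := by
    intro u hu w
    rw [D.compDeriv.jump_eq hu, ← D.smul_marcus, ← smul_sub, mul_smul_comm, smul_apply]
  have hsum : ∀ t ≤ T, ∀ w, HasSum (fun u : Ioc s t =>
      (left S u * (texp (jump X u) - 1 - jump X u)) w) (∫ u in Ioc s t, p u w ∂μ) := by
    intro t ht w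
    have h := hasSum_setIntegral (hpint w) (s := Ioc s t) measurableSet_Ioc fun u hu h0 => by
      rw [hpdef]; simp [marcus_of_null h0]
    simpa only [hterm _ (hsub ht (Subtype.coe_prop _))] using h
  refine ⟨fun w => ?_, hop T, fun w => (hsum T le_rfl w).summable.abs, fun t ht w => ?_⟩
  · have h := (hp w).isCadlagOn
    exact ⟨fun u hu => h.1 u ⟨hs.1.trans hu.1, hu.2⟩, fun u hu => h.2 u ⟨hs.1.trans_lt hu.1, hu.2⟩⟩
  · obtain ⟨h1, h2⟩ := opIntegral_eq D.nonneg D.null D.compDeriv (s := s) (t := t)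
      (A := fun u => LinearMap.mulLeft ℝ (left S u))
      (fun u _ n z hz => by simpa using mul_mem_fil (fil_zero (left S u)) hz) (hop t) w
    have h3 := (hp w).sub_eq hs.1 ht.1 ht.2
    have h4 : ∫ u in Ioc s t, (a * (left D.dev u * marcus μ x u)) w ∂μ =
        ∫ u in Ioc s t, ((left S u * x u) w + p u w) ∂μ := by
      refine setIntegral_congr_fun measurableSet_Ioc fun u hu => ?_
      rw [← add_apply, hpdef, ← mul_add, add_sub_cancel, hleft u (hsub ht.2 hu), mul_assoc]
    rw [(hsum t ht.2 w).tsum_eq, ← hSs]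
    refine (sub_eq_iff_eq_add'.mp (h3.trans (h4.trans ?_))).trans (add_assoc _ _ _).symm
    exact (integral_add h1 (hpint w).integrableOn).trans (congrArg (· + _) h2.symm)

/-- Induction on word length: the density and the jump factor `exp(ΔX) - 1 - ΔX` have no scalar
component, so the right-hand side at `w` involves left limits of strictly shorter words only. -/
theorem signature_unique (D : Driver μ T X x) (hs : s ∈ Icc 0 T) {S S' : ℝ → TensorSeries d}
    (h : IsSignature T X s S) (h' : IsSignature T X s S') : EqOn S S' (Icc s T) := by
  suffices H : ∀ w, ∀ t ∈ Icc s T, S t w = S' t w from fun t ht => ext fun w => H w t ht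
  intro w
  induction hn : w.length using Nat.strong_induction_on generalizing w with
  | _ n ih =>
    subst hn
    intro t ht
    have hl : ∀ u ∈ Ioc s T, ∀ i < w.length, left S u (w.take i) = left S' u (w.take i) := by
      intro u hu i hi
      obtain ⟨l, hl⟩ := (h.cadlag (w.take i)).2 u hu
      have hl' : Tendsto (fun r => S' r (w.take i)) (𝓝[<] u) (𝓝 l) := by
        refine hl.congr' ?_
        filter_upwards [Ioo_mem_nhdsLT hu.1] with r hr
        exact ih (w.take i).length (by simp [List.length_take, hi]) _ rfl r
          ⟨hr.1.le, hr.2.le.trans hu.2⟩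
      exact (leftLim_eq_of_tendsto hl).trans (leftLim_eq_of_tendsto hl').symm
    have hsub : Ioc s t ⊆ Ioc s T := Ioc_subset_Ioc_right ht.2
    have hop : ∀ {S : ℝ → TensorSeries d}, IsSignature T X s S →
        opIntegral T (fun u x => left S u * x) X s t w =
          ∫ u in Ioc s t, (left S u * x u) w ∂μ := by
      intro S hS
      refine (opIntegral_eq D.nonneg D.null D.compDeriv (s := s) (t := t)
        (A := fun u => LinearMap.mulLeft ℝ (left S u))
        (fun u _ n z hz => by simpa using mul_mem_fil (fil_zero (left S u)) hz) ?_ w).2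
      have h1 := (opIntegrable_iff D.nonneg D.null D.compDeriv).mp hS.integrable
      rw [opIntegrable_iff D.nonneg D.null D.compDeriv]
      exact fun v w hvw => (h1 v w hvw).mono_set hsub
    rw [h.eqn t ht w, h'.eqn t ht w, hop h, hop h']
    congr 1
    · congr 1
      exact setIntegral_congr_fun measurableSet_Ioc fun u hu =>
        mul_apply_congr (D.mem_T0 u) (hl u (hsub hu))
    · refine tsum_congr fun u => mul_apply_congr ?_ (hl u (hsub u.2))
      refine TensorSeries.mem_T0.mpr ?_
      rw [sub_apply, sub_apply, texp_apply_nil, one_apply, if_pos rfl,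
        D.compDeriv.jump_eq (Ioc_subset_Ioc_left hs.1 (hsub u.2)), smul_apply,
        TensorSeries.mem_T0.mp (D.mem_T0 u)]
      simp

theorem isSignature_sig (D : Driver μ T X x) (hs : s ∈ Icc 0 T) :
    IsSignature T X s (sig T X s) := by
  have h : ∃ S, IsSignature T X s S := ⟨_, D.isSignature hs⟩
  have h2 : sig T X s = h.choose := by
    funext t
    rw [sig, dif_pos h]
  rw [h2]
  exact h.choose_spec

theorem sig_eq (D : Driver μ T X x) (hs : s ∈ Icc 0 T) (ht : t ∈ Icc s T) :
    sig T X s t = texp (-tlog (D.dev s)) * D.dev t :=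
  D.signature_unique hs (D.isSignature_sig hs) (D.isSignature hs) ht

end Driver

end JumpMagnus

/-! ### The Hausdorff equation with jumps. -/

namespace JumpMagnus

variable {d : ℕ} {μ : Measure ℝ} {T : ℝ}

/-- `ξ` is, away from the atoms of `μ`, the density of the path `f`. -/
def DiffuseDeriv (μ : Measure ℝ) (T : ℝ) (f ξ : ℝ → ℝ) : Prop :=
  ∃ p, IsPrim μ T f p ∧ ∀ᵐ u ∂μ, μ {u} = 0 → ξ u = p u

/-- Off the atoms the left limit in the integration by parts formula is the value, which leaves the
ordinary Leibniz rule; at the atoms the relation imposes nothing on `ξ`. -/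
theorem isDerivationRel_diffuseDeriv [IsFiniteMeasure μ] (hμ : μ (Ioc 0 T)ᶜ = 0) :
    IsDerivationRel (DiffuseDeriv μ T) where
  const c := ⟨_, IsPrim.const c, Eventually.of_forall fun _ _ => rfl⟩
  add := by
    rintro f g ξ γ ⟨p, hf, hp⟩ ⟨q, hg, hq⟩
    refine ⟨_, hf.add hg, ?_⟩
    filter_upwards [hp, hq] with u h1 h2 h0
    rw [h1 h0, h2 h0]
  mul := by
    rintro f g ξ γ ⟨p, hf, hp⟩ ⟨q, hg, hq⟩
    refine ⟨_, hf.mul hμ hg, ?_⟩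
    have hm : ∀ᵐ u ∂μ, u ∈ Ioc 0 T := by rwa [ae_iff]
    filter_upwards [hp, hq, hm] with u h1 h2 hu h0
    rw [h1 h0, h2 h0, hf.leftLim_eq_self hu h0]

theorem CompDeriv.ae_eq_of_diffuse [IsFiniteMeasure μ] (hT : 0 ≤ T) (hμ : μ (Ioc 0 T)ᶜ = 0)
    {F ξ γ : ℝ → TensorSeries d} (h : CompDeriv (DiffuseDeriv μ T) F ξ)
    (h' : CompDeriv (DiffuseDeriv μ T) F γ) : ∀ᵐ u ∂μ, μ {u} = 0 → ξ u = γ u := by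
  have : ∀ w, ∀ᵐ u ∂μ, μ {u} = 0 → ξ u w = γ u w := fun w => by
    obtain ⟨p, hp, h1⟩ := h w
    obtain ⟨q, hq, h2⟩ := h' w
    filter_upwards [h1, h2, hp.density_unique hT hμ hq] with u e1 e2 e3 h0
    rw [e1 h0, e2 h0, e3]
  filter_upwards [ae_all_iff.mpr this] with u hu h0
  exact ext fun w => hu w h0

theorem CompDeriv.diffuse {F ξ : ℝ → TensorSeries d} (h : CompDeriv (IsPrim μ T) F ξ) :
    CompDeriv (DiffuseDeriv μ T) F ξ := fun w => ⟨_, h w, Eventually.of_forall fun _ _ => rfl⟩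

theorem CompDeriv.diffuse_congr {F ξ γ : ℝ → TensorSeries d}
    (h : CompDeriv (DiffuseDeriv μ T) F ξ) (hγ : ∀ᵐ u ∂μ, μ {u} = 0 → γ u = ξ u) :
    CompDeriv (DiffuseDeriv μ T) F γ := fun w => by
  obtain ⟨p, hp, h1⟩ := h w
  refine ⟨p, hp, ?_⟩
  filter_upwards [h1, hγ] with u e1 e2 h0
  rw [e2 h0, e1 h0]

theorem CompDeriv.exists_density {F ξ : ℝ → TensorSeries d}
    (h : CompDeriv (DiffuseDeriv μ T) F ξ) :
    ∃ ψ : ℝ → TensorSeries d, CompDeriv (IsPrim μ T) F ψ ∧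
      ∀ᵐ u ∂μ, μ {u} = 0 → ψ u = ξ u := by
  choose p hp hξ using h
  refine ⟨fun u w => p w u, hp, ?_⟩
  filter_upwards [ae_all_iff.mpr hξ] with u hu h0
  exact ext fun w => (hu w h0).symm

theorem indicator_apply_word (s : Set ℝ) (x : ℝ → TensorSeries d) (u : ℝ) (w : List (Fin d)) :
    s.indicator x u w = s.indicator (fun r => x r w) u := by
  by_cases h : u ∈ s <;> simp [h]

namespace Driver

variable {X x : ℝ → TensorSeries d} {s t u : ℝ}

theorem logSig_eq (D : Driver μ T X x) (ht : t ∈ Icc 0 T) :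
    logSig T X t = tlog (texp (-tlog (D.dev t)) * D.dev T) := by
  rw [logSig, D.sig_eq ht ⟨ht.2, le_rfl⟩]

theorem sig_apply_nil (D : Driver μ T X x) (ht : t ∈ Icc 0 T) : sig T X t T [] = 1 := by
  rw [D.sig_eq ht ⟨ht.2, le_rfl⟩, mul_apply_nil, texp_apply_nil, D.dev_apply_nil, one_mul]

theorem sig_self (D : Driver μ T X x) : sig T X T T = 1 := by
  rw [D.sig_eq ⟨D.nonneg, le_rfl⟩ ⟨le_rfl, le_rfl⟩, texp_neg_tlog_mul (D.dev_apply_nil T)]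

theorem logSig_self (D : Driver μ T X x) : logSig T X T = 0 := by
  rw [logSig, D.sig_self, tlog_one]

theorem logSig_mem_T0 (u : ℝ) : logSig T X u ∈ T0 d := tlog_mem_T0 _

/-- Away from the jumps, `dΩ = -H(ad Ω)(dX)`. -/
theorem exists_density_logSig (D : Driver μ T X x) :
    ∃ ψ : ℝ → TensorSeries d, CompDeriv (IsPrim μ T) (logSig T X) ψ ∧
      ∀ᵐ u ∂μ, μ {u} = 0 → ψ u = -Had (logSig T X u) (x u) := by
  have := D.finite
  have hR := isDerivationRel_diffuseDeriv D.null
  have hnil := D.dev_apply_nil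
  have hdev : CompDeriv (DiffuseDeriv μ T) D.dev (fun u => D.dev u * x u) := by
    refine D.compDeriv_dev.diffuse.diffuse_congr ?_
    filter_upwards [D.ae_mem] with u hu h0
    rw [marcus_of_null h0, D.compDeriv_dev.left_eq_self hu h0]
  have hneg := hR.comp_mul (hR.comp_const (-1 : TensorSeries d)) (hR.comp_tlog hdev hnil).1
  simp only [neg_one_mul, zero_mul, add_zero] at hneg
  have hinv := hR.comp_evalS (PowerSeries.exp ℝ) hneg
  simp only [← texp_eq_evalS] at hinv
  -- `κ` is the diffuse derivative of the inverse of `dev`. Its formula is not needed: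
  -- differentiating the product of the inverse with `dev`, which is `1`, determines it.
  set κ : ℝ → TensorSeries d := fun u => evalDeriv (PowerSeries.exp ℝ) (-tlog (D.dev u))
    (-evalDeriv (PowerSeries.log ℝ) (D.dev u - 1) (D.dev u * x u)) with hκ
  have hone := hR.comp_mul hinv hdev
  simp only [texp_neg_tlog_mul (hnil _)] at hone
  have hκeq := CompDeriv.ae_eq_of_diffuse D.nonneg D.null hone (hR.comp_const 1)
  have hG := hR.comp_mul hinv (hR.comp_const (D.dev T))
  have hGnil : ∀ t, (texp (-tlog (D.dev t)) * D.dev T) [] = 1 := fun t => by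
    rw [mul_apply_nil, texp_apply_nil, hnil, one_mul]
  obtain ⟨h1, h2⟩ := hR.comp_tlog hG hGnil
  -- Two diffuse derivatives of the same path, one from the product rule and one through its
  -- logarithm, agree almost everywhere off the atoms.
  have h3 := CompDeriv.ae_eq_of_diffuse D.nonneg D.null hG h2
  obtain ⟨ψ, hψ, h4⟩ := h1.exists_density
  refine ⟨ψ, fun w => (hψ w).congr_on D.nonneg fun t ht => by dsimp only; rw [D.logSig_eq ht], ?_⟩
  filter_upwards [hκeq, h3, h4, D.ae_mem] with u e1 e2 e3 hu h0
  rw [e3 h0, D.logSig_eq ⟨hu.1.le, hu.2⟩]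
  have e4 : κ u * D.dev u = -x u := by
    have := e1 h0
    rw [← mul_assoc, texp_neg_tlog_mul (hnil u), one_mul] at this
    exact (neg_eq_of_add_eq_zero_right this).symm
  have e5 : κ u = -x u * texp (-tlog (D.dev u)) := by
    rw [← e4, mul_assoc, mul_texp_neg_tlog (hnil u), mul_one]
  rw [Had_eq_opS, ← map_neg, ← Had_eq_opS]
  refine eq_Had_of_expQuot (tlog_mem_T0 _) (mul_right_cancel_of_apply_nil (hGnil u) ?_)
  rw [← e2 h0, mul_zero, zero_add]
  rw [e5, mul_assoc]

theorem dev_eq (D : Driver μ T X x) (hu : u ∈ Ioc 0 T) :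
    D.dev u = left D.dev u * texp (jump X u) := by
  have h := D.compDeriv_dev.jump_eq hu
  rw [← mul_smul_comm, D.smul_marcus, ← D.compDeriv.jump_eq hu, jump, mul_sub, mul_one] at h
  exact sub_left_injective h

/-- Left limits pass through products, `exp` and `log`, and `dev_eq` gives `K_{u-}⁻¹ = exp(ΔX_u)
K_u⁻¹` for `K = dev`. -/
theorem left_logSig (D : Driver μ T X x) (hu : u ∈ Ioc 0 T) :
    left (logSig T X) u = tlog (texp (jump X u) * sig T X u T) := by
  have hdev := D.compDeriv_dev.hasLeft hu
  set l := texp (-tlog (left D.dev u)) with hl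
  have hnil : left D.dev u [] = 1 := by
    refine leftLim_eq_of_tendsto ?_
    simp only [D.dev_apply_nil]
    exact tendsto_const_nhds
  have hneg : HasLeft (fun t => -tlog (D.dev t)) (-tlog (left D.dev u)) u := fun w =>
    (hdev.tlog w).neg
  have h1 := (hneg.texp.mul (HasLeft.const (D.dev T))).tlog
  have h2 : HasLeft (logSig T X) (tlog (l * D.dev T)) u := fun w => by
    refine (h1 w).congr' ?_
    filter_upwards [Ioo_mem_nhdsLT hu.1] with r hr
    rw [D.logSig_eq ⟨hr.1.le, hr.2.le.trans hu.2⟩]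
  rw [h2.left_eq, D.sig_eq ⟨hu.1.le, hu.2⟩ ⟨hu.2, le_rfl⟩, ← mul_assoc]
  congr 2
  calc l = l * (D.dev u * texp (-tlog (D.dev u))) := by
        rw [mul_texp_neg_tlog (D.dev_apply_nil u), mul_one]
    _ = l * left D.dev u * (texp (jump X u) * texp (-tlog (D.dev u))) := by
        conv_lhs => enter [2, 1]; rw [D.dev_eq hu]
        simp only [mul_assoc]
    _ = _ := by rw [hl, texp_neg_tlog_mul hnil, one_mul]

theorem jump_mem_T0 (D : Driver μ T X x) (hu : u ∈ Ioc 0 T) : jump X u ∈ T0 d := by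
  rw [D.compDeriv.jump_eq hu]
  exact (T0 d).smul_mem _ (D.mem_T0 u)

theorem texp_left_logSig (D : Driver μ T X x) (hu : u ∈ Ioc 0 T) :
    texp (left (logSig T X) u) = texp (jump X u) * texp (logSig T X u) := by
  have h := D.sig_apply_nil ⟨hu.1.le, hu.2⟩
  rw [D.left_logSig hu, logSig, texp_tlog h, texp_tlog]
  rw [mul_apply_nil, texp_apply_nil, h, one_mul]

theorem left_logSig_mem_T0 (D : Driver μ T X x) (hu : u ∈ Ioc 0 T) :
    left (logSig T X) u ∈ T0 d := by
  rw [D.left_logSig hu]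
  exact tlog_mem_T0 _

/-- The jumps of the log-signature. -/
theorem hausdorffJump_eq (D : Driver μ T X x) (hu : u ∈ Ioc 0 T) :
    hausdorffJump X (logSig T X) u = left (logSig T X) u - logSig T X u := by
  have h := D.sig_apply_nil ⟨hu.1.le, hu.2⟩
  have hx := D.jump_mem_T0 hu
  ext w
  rw [sub_apply, D.left_logSig hu, logSig, ← integral_Had_tlog hx h w, hausdorffJump]
  congr 1
  funext θ
  have hθ := (T0 d).smul_mem θ hx
  -- The composition is `exp(ad z)` with `z = log(exp(θ ΔX_u) Sig_{u,T})`, on which `Ψ` gives `H(ad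
  -- z)`.
  rw [expAd_comp_expAd hθ (logSig_mem_T0 u) (tlog_mem_T0 (texp (θ • jump X u) * sig T X u T)),
    Psi_expAd (tlog_mem_T0 _)]
  rw [texp_tlog, logSig, texp_tlog h]
  rw [mul_apply_nil, texp_apply_nil, h, one_mul]

theorem hasSum_jump (D : Driver μ T X x) {F ξ : ℝ → TensorSeries d}
    (hF : CompDeriv (IsPrim μ T) F ξ) (hs : 0 ≤ s) (ht : t ≤ T) (w : List (Fin d)) :
    HasSum (fun u : Ioc s t => jump F u w) (∫ u in Ioc s t, (atoms μ).indicator ξ u w ∂μ) := by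
  have := D.finite
  simp only [indicator_apply_word]
  have h := hasSum_setIntegral ((hF w).integrable.indicator (measurableSet_atoms μ))
    (s := Ioc s t) measurableSet_Ioc fun u _ h0 => indicator_of_notMem (by simpa [atoms] using h0) _
  convert h using 1
  funext u
  rw [hF.jump_eq (Ioc_subset_Ioc hs ht u.2), smul_apply]
  by_cases h0 : (u : ℝ) ∈ atoms μ
  · rw [indicator_of_mem h0]
  · rw [indicator_of_notMem h0, Measure.real, not_not.mp h0, ENNReal.toReal_zero, zero_mul,
      zero_mul]

/-- The sum of the jumps is the integral of `x` over the atoms, so subtracting it leaves the density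
on the complement. -/
theorem compDeriv_contPart (D : Driver μ T X x) :
    CompDeriv (IsPrim μ T) (contPart X) ((atoms μ)ᶜ.indicator x) := by
  have := D.finite
  intro w
  simp only [indicator_apply_word]
  have hi := (D.prim w).integrable
  refine ⟨hi.indicator (measurableSet_atoms μ).compl, fun t ht => ?_⟩
  have h1 := (D.hasSum_jump D.compDeriv (s := 0) (t := t) le_rfl ht.2 w).tsum_eq
  simp only [indicator_apply_word] at h1
  have h0 := (D.hasSum_jump D.compDeriv (s := 0) (t := 0) le_rfl D.nonneg w).tsum_eq
  rw [Ioc_self, setIntegral_empty, ← Ioc_self (0 : ℝ)] at h0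
  rw [contPart, contPart, h0, h1, (D.prim w).eq_add t ht, sub_zero, add_sub_assoc,
    ← integral_sub hi.integrableOn (hi.indicator (measurableSet_atoms μ)).integrableOn]
  congr 1
  refine integral_congr_ae (Eventually.of_forall fun u => ?_)
  by_cases hu : u ∈ atoms μ <;> simp [hu]

theorem compIn_logSig (D : Driver μ T X x) :
    CompIn (Subalgebra.toSubmodule (bddAlg μ)) (logSig T X) := by
  obtain ⟨ψ, hψ, -⟩ := D.exists_density_logSig
  exact hψ.compIn D.null

theorem compIn_left_logSig (D : Driver μ T X x) :
    CompIn (Subalgebra.toSubmodule (bddAlg μ)) (left (logSig T X)) := by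
  obtain ⟨ψ, hψ, -⟩ := D.exists_density_logSig
  exact hψ.compIn_left D.null

theorem bddAlg_mul_mem (f : ℝ → ℝ) (hf : f ∈ bddAlg μ) (g : ℝ → ℝ)
    (hg : g ∈ Subalgebra.toSubmodule (bddAlg μ)) : f * g ∈ Subalgebra.toSubmodule (bddAlg μ) :=
  (bddAlg μ).mul_mem hf hg

theorem opIntegrable_Had (D : Driver μ T X x) {Y g γ : ℝ → TensorSeries d}
    (hY : CompIn (Subalgebra.toSubmodule (bddAlg μ)) Y) (hg : CompDeriv (IsPrim μ T) g γ) :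
    OpIntegrable T (fun u => Had (Y u)) g s t :=
  D.opIntegrable hg fun v => CompIn.Had bddAlg_mul_mem hY (CompIn.const (e v))

theorem opIntegral_Had (D : Driver μ T X x) {Y g γ : ℝ → TensorSeries d}
    (hY : CompIn (Subalgebra.toSubmodule (bddAlg μ)) Y) (hY0 : ∀ u ∈ Ioc s t, Y u ∈ T0 d)
    (hg : CompDeriv (IsPrim μ T) g γ) (w : List (Fin d)) :
    opIntegral T (fun u => Had (Y u)) g s t w = ∫ u in Ioc s t, Had (Y u) (γ u) w ∂μ := by
  have h := (opIntegral_eq D.nonneg D.null hg (s := s) (t := t)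
    (A := fun u => opS (bernoulliPowerSeries ℝ) (adE (Y u)))
    (fun u hu n z hz => opS_mem_fil (adE_raising (hY0 u hu)) hz)
    (by simpa only [Had_eq_opS] using D.opIntegrable_Had hY hg) w).2
  simpa only [Had_eq_opS] using h

/-- The jump-extended Hausdorff equation. -/
theorem hausdorff (D : Driver μ T X x) (ht : t ∈ Icc 0 T) (w : List (Fin d)) :
    Summable (fun u : Ioc t T => hausdorffJump X (logSig T X) u w) ∧
      logSig T X t w = opIntegral T (fun u => Had (left (logSig T X) u)) (contPart X) t T w
        + ∑' u : Ioc t T, hausdorffJump X (logSig T X) u w := by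
  have := D.finite
  obtain ⟨ψ, hψ, hψ2⟩ := D.exists_density_logSig
  have hsub : Ioc t T ⊆ Ioc 0 T := Ioc_subset_Ioc_left ht.1
  have hsum := (D.hasSum_jump hψ ht.1 le_rfl w).neg
  have hj : ∀ u : Ioc t T, -jump (logSig T X) u w = hausdorffJump X (logSig T X) u w := fun u => by
    rw [D.hausdorffJump_eq (hsub u.2), jump, sub_apply, sub_apply, neg_sub]
  simp only [hj] at hsum
  refine ⟨hsum.summable, ?_⟩
  rw [hsum.tsum_eq, D.opIntegral_Had D.compIn_left_logSig
    (fun u hu => D.left_logSig_mem_T0 (hsub hu)) D.compDeriv_contPart]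
  -- As `Ω_T = 0`, `Ω_t` is minus the integral of `ψ`; its parts off and on the atoms are the two
  -- terms of the equation.
  have h1 := (hψ w).sub_eq ht.1 ht.2 le_rfl
  rw [D.logSig_self, zero_apply, zero_sub] at h1
  simp only [indicator_apply_word]
  have hi := (hψ w).integrable
  have hia := (hi.indicator (measurableSet_atoms μ)).integrableOn (s := Ioc t T)
  have hic := (hi.indicator (measurableSet_atoms μ).compl).integrableOn (s := Ioc t T)
  have h2 : ∫ u in Ioc t T, Had (left (logSig T X) u) ((atoms μ)ᶜ.indicator x u) w ∂μ =
      ∫ u in Ioc t T, -((atoms μ)ᶜ.indicator (fun r => ψ r w) u) ∂μ := by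
    refine integral_congr_ae ?_
    filter_upwards [ae_restrict_of_ae hψ2, ae_restrict_mem measurableSet_Ioc] with u hu hu2
    by_cases h0 : u ∈ atoms μ
    · simp [h0, Had_eq_opS]
    · have h0' : μ {u} = 0 := not_not.mp h0
      rw [indicator_of_mem (by exact h0), indicator_of_mem (by exact h0), hu h0',
        hψ.left_eq_self (hsub hu2) h0', neg_apply, neg_neg]
  rw [h2, integral_neg, ← neg_add, ← integral_add hic hia, ← neg_eq_iff_eq_neg, h1]
  refine integral_congr_ae (Eventually.of_forall fun u => ?_)
  by_cases hu : u ∈ atoms μ <;> simp [hu]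

theorem countable_jumps (D : Driver μ T X x) : {u ∈ Ioc 0 T | jump X u ≠ 0}.Countable := by
  have := D.finite
  refine (countable_atoms μ).mono fun u hu => ?_
  by_contra h
  have h0 : μ {u} = 0 := not_not.mp h
  refine hu.2 ?_
  rw [D.compDeriv.jump_eq hu.1, Measure.real, h0, ENNReal.toReal_zero, zero_smul]

/-- Hausdorff's equation of a path without jumps. -/
theorem hausdorff_of_jump_eq_zero (D : Driver μ T X x) (h : ∀ u ∈ Ioc 0 T, jump X u = 0)
    (ht : t ∈ Icc 0 T) :
    (∀ u ∈ Ioc t T, hausdorffJump X (logSig T X) u = 0) ∧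
      logSig T X t = opIntegral T (fun u => Had (logSig T X u)) X t T := by
  have hsub : Ioc t T ⊆ Ioc 0 T := Ioc_subset_Ioc_left ht.1
  have hl : ∀ u ∈ Ioc t T, left (logSig T X) u = logSig T X u := fun u hu => by
    rw [D.left_logSig (hsub hu), h u (hsub hu), texp_zero, one_mul, logSig]
  have hj : ∀ u ∈ Ioc t T, hausdorffJump X (logSig T X) u = 0 := fun u hu => by
    rw [D.hausdorffJump_eq (hsub hu), hl u hu, sub_self]
  refine ⟨hj, ?_⟩
  ext w
  have hz : ∑' u : Ioc t T, hausdorffJump X (logSig T X) u w = 0 := by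
    simp [hj _ (Subtype.coe_prop _)]
  rw [(D.hausdorff ht w).2, hz, add_zero, D.opIntegral_Had D.compIn_left_logSig
    (fun u hu => D.left_logSig_mem_T0 (hsub hu)) D.compDeriv_contPart,
    D.opIntegral_Had D.compIn_logSig (fun u _ => logSig_mem_T0 u) D.compDeriv]
  refine setIntegral_congr_fun measurableSet_Ioc fun u hu => ?_
  -- The driving measure may have atoms at which `X` does not jump; there the density vanishes.
  have hx : (atoms μ)ᶜ.indicator x u = x u := by
    by_cases h0 : u ∈ atoms μ
    · have h1 := D.compDeriv.jump_eq (hsub hu)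
      rw [h u (hsub hu)] at h1
      have h2 : μ.real {u} ≠ 0 := by
        have := D.finite
        exact ENNReal.toReal_ne_zero.mpr ⟨h0, measure_ne_top _ _⟩
      rw [indicator_of_notMem (by simpa using h0), ((smul_eq_zero_iff_right h2).mp h1.symm)]
    · rw [indicator_of_mem (by exact h0)]
  rw [hl u hu, hx]

end Driver

/-! ### Sums over compositions as sums over lists. -/

open Finset.HasAntidiagonal in
theorem sum_antidiagonal_assoc {M : Type*} [AddCommMonoid M] (n : ℕ) (f : ℕ → ℕ → ℕ → M) :
    ∑ p ∈ antidiagonal n, ∑ q ∈ antidiagonal p.1, f q.1 q.2 p.2 =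
      ∑ p ∈ antidiagonal n, ∑ q ∈ antidiagonal p.2, f p.1 q.1 q.2 := by
  rw [Finset.sum_sigma', Finset.sum_sigma']
  refine Finset.sum_bij' (fun s _ => ⟨(s.2.1, s.2.2 + s.1.2), (s.2.2, s.1.2)⟩)
    (fun s _ => ⟨(s.1.1 + s.2.1, s.2.2), (s.1.1, s.2.1)⟩) ?_ ?_ ?_ ?_ ?_
  all_goals
    rintro ⟨⟨a, b⟩, c, e⟩ h
    simp only [Finset.mem_sigma, Finset.HasAntidiagonal.mem_antidiagonal] at h
    obtain ⟨h1, h2⟩ := h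
    subst h1
    subst h2
    simp [add_assoc]

/-- The lists of length `k` of natural numbers with sum `n`. -/
def listsWithSum : ℕ → ℕ → Finset (List ℕ)
  | 0, n => if n = 0 then {[]} else ∅
  | k + 1, n => (Finset.HasAntidiagonal.antidiagonal n).biUnion fun p =>
      (listsWithSum k p.2).image (p.1 :: ·)

theorem mem_listsWithSum {k n : ℕ} {l : List ℕ} :
    l ∈ listsWithSum k n ↔ l.length = k ∧ l.sum = n := by
  induction k generalizing n l with
  | zero =>
    rw [listsWithSum, List.length_eq_zero_iff]
    split_ifs with h
    · subst h; simp +contextual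
    · simp only [Finset.notMem_empty, false_iff, not_and]
      rintro rfl h'
      exact h (by simpa using h'.symm)
  | succ k ih =>
    simp only [listsWithSum, Finset.mem_biUnion, Finset.HasAntidiagonal.mem_antidiagonal,
      Finset.mem_image, ih]
    constructor
    · rintro ⟨p, hp, l, ⟨rfl, hl⟩, rfl⟩
      simp [hl, hp]
    · rintro ⟨h1, h2⟩
      cases l with
      | nil => simp at h1
      | cons a l =>
        exact ⟨(a, l.sum), by simpa using h2, l, ⟨by simpa using h1, rfl⟩, rfl⟩

section Sums

variable {M : Type*} [AddCommMonoid M]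

open Finset.HasAntidiagonal

theorem sum_listsWithSum_zero (n : ℕ) (f : List ℕ → M) :
    ∑ l ∈ listsWithSum 0 n, f l = if n = 0 then f [] else 0 := by
  rw [listsWithSum]
  split_ifs <;> simp

theorem sum_listsWithSum_succ (k n : ℕ) (f : List ℕ → M) :
    ∑ l ∈ listsWithSum (k + 1) n, f l =
      ∑ p ∈ antidiagonal n, ∑ l ∈ listsWithSum k p.2, f (p.1 :: l) := by
  rw [listsWithSum, Finset.sum_biUnion]
  · exact Finset.sum_congr rfl fun p _ =>
      Finset.sum_image fun _ _ _ _ h => (List.cons_injective h)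
  · rintro p hp q hq hpq
    refine Finset.disjoint_left.mpr fun l h1 h2 => hpq ?_
    simp only [Finset.mem_image] at h1 h2
    obtain ⟨l1, -, rfl⟩ := h1
    obtain ⟨l2, -, h⟩ := h2
    simp only [List.cons.injEq] at h
    have hp := Finset.HasAntidiagonal.mem_antidiagonal.mp (Finset.mem_coe.mp hp)
    have hq := Finset.HasAntidiagonal.mem_antidiagonal.mp (Finset.mem_coe.mp hq)
    exact Prod.ext h.1.symm (by omega)

/-- Entries equal to zero are allowed in `listsWithSum` so that cutting a list gives an unrestricted
Cauchy product; `sum_composition` discards them afterwards. -/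
theorem sum_listsWithSum_add (a b n : ℕ) (f : List ℕ → List ℕ → M) :
    ∑ l ∈ listsWithSum (a + b) n, f (l.take a) (l.drop a) =
      ∑ p ∈ antidiagonal n, ∑ l₁ ∈ listsWithSum a p.1, ∑ l₂ ∈ listsWithSum b p.2, f l₁ l₂ := by
  induction a generalizing n f with
  | zero =>
    simp only [sum_listsWithSum_zero, zero_add, List.take_zero, List.drop_zero]
    rw [Finset.sum_eq_single (0, n)]
    · simp
    · rintro ⟨p, q⟩ hp hne
      rw [if_neg]
      rintro rfl
      exact hne (by simpa using Finset.HasAntidiagonal.mem_antidiagonal.mp hp)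
    · simp [Finset.HasAntidiagonal.mem_antidiagonal]
  | succ a ih =>
    rw [add_right_comm, sum_listsWithSum_succ]
    simp only [List.take_succ_cons, List.drop_succ_cons]
    have h : ∀ p : ℕ × ℕ, _ := fun p => ih p.2 fun l₁ l₂ => f (p.1 :: l₁) l₂
    simp only [h]
    rw [← sum_antidiagonal_assoc n fun r s q => ∑ l₁ ∈ listsWithSum a s,
      ∑ l₂ ∈ listsWithSum b q, f (r :: l₁) l₂]
    simp only [sum_listsWithSum_succ]

/-- A sum over compositions as a sum over lists. -/
theorem sum_composition (n : ℕ) (f : List ℕ → M) (hf : ∀ l, 0 ∈ l → f l = 0) :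
    ∑ c : Composition n, f c.blocks = ∑ k ∈ Finset.range (n + 1), ∑ l ∈ listsWithSum k n, f l := by
  classical
  rw [← Finset.sum_biUnion]
  · rw [← Finset.sum_image (s := Finset.univ) (g := fun c : Composition n => c.blocks)
      fun _ _ _ _ h => Composition.ext h]
    refine Finset.sum_subset ?_ ?_
    · intro l hl
      simp only [Finset.mem_image, Finset.mem_univ, true_and] at hl
      obtain ⟨c, rfl⟩ := hl
      simp only [Finset.mem_biUnion, mem_listsWithSum]
      exact ⟨c.length, Finset.mem_range.mpr (Nat.lt_succ_of_le c.length_le), rfl, c.blocks_sum⟩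
    · intro l hl hl2
      simp only [Finset.mem_biUnion, mem_listsWithSum] at hl
      obtain ⟨k, -, -, hsum⟩ := hl
      by_contra h0
      refine hl2 (Finset.mem_image.mpr ⟨⟨l, fun {i} hi => ?_, hsum⟩, Finset.mem_univ _, rfl⟩)
      rcases Nat.eq_zero_or_pos i with rfl | h
      · exact absurd (hf l hi) h0
      · exact h
  · intro a _ b _ hab
    refine Finset.disjoint_left.mpr fun l h1 h2 => hab ?_
    rw [← (mem_listsWithSum.mp h1).1, (mem_listsWithSum.mp h2).1]

theorem sum_composition_of_two_le {n : ℕ} (hn : 0 < n) {M : Type*} [AddCommGroup M]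
    (f : List ℕ → M) :
    ∑ c : Composition n with 2 ≤ c.length, f c.blocks =
      ∑ c : Composition n, f c.blocks - f [n] := by
  rw [eq_sub_iff_add_eq, ← Finset.sum_filter_add_sum_filter_not Finset.univ
    fun c : Composition n => 2 ≤ c.length]
  congr 1
  have : (Finset.univ.filter fun c : Composition n => ¬ 2 ≤ c.length) =
      {Composition.single n hn} := by
    ext c
    have h := c.length_pos_of_pos hn
    rw [Finset.mem_filter, Finset.mem_singleton, Composition.eq_single_iff_length]
    simp only [Finset.mem_univ, true_and]
    omega
  simp only [this, Finset.sum_singleton, Composition.single_blocks]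

end Sums

/-! ### Tensor levels of products and of iterated commutators. -/

namespace TensorSeries

variable {d : ℕ}

open Finset.HasAntidiagonal

theorem level_apply (n : ℕ) (x : TensorSeries d) (w : List (Fin d)) :
    level n x w = if w.length = n then x w else 0 := rfl

theorem level_add (n : ℕ) (x y : TensorSeries d) : level n (x + y) = level n x + level n y := by
  ext w; simp only [level_apply, add_apply]; split_ifs <;> simp

theorem level_smul (n : ℕ) (c : ℝ) (x : TensorSeries d) : level n (c • x) = c • level n x := by
  ext w; simp only [level_apply, smul_apply]; split_ifs <;> simp

/-- The tensor level, as a linear map. -/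
noncomputable def levelE (d n : ℕ) : Module.End ℝ (TensorSeries d) where
  toFun := level n
  map_add' := level_add n
  map_smul' := level_smul n

theorem level_sub (n : ℕ) (x y : TensorSeries d) : level n (x - y) = level n x - level n y :=
  map_sub (levelE d n) x y

theorem level_sum {ι : Type*} (s : Finset ι) (n : ℕ) (f : ι → TensorSeries d) :
    level n (∑ i ∈ s, f i) = ∑ i ∈ s, level n (f i) := map_sum (levelE d n) f s

theorem level_zero_of_mem_T0 {x : TensorSeries d} (hx : x ∈ T0 d) : level 0 x = 0 := by
  ext w
  rw [level_apply, zero_apply]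
  split_ifs with h
  · rw [List.length_eq_zero_iff.mp h, mem_T0.mp hx]
  · rfl

theorem level_eq_zero_of_mem_fil {n : ℕ} {x : TensorSeries d} (hx : x ∈ fil d (n + 1)) :
    level n x = 0 := by
  ext w
  rw [level_apply, zero_apply]
  split_ifs with h
  · exact hx w (by omega)
  · rfl

theorem level_mul (n : ℕ) (x y : TensorSeries d) :
    level n (x * y) = ∑ p ∈ antidiagonal n, level p.1 x * level p.2 y := by
  ext w
  rw [level_apply, sum_apply]
  simp only [mul_apply, level_apply]
  split_ifs with h
  · rw [Finset.sum_comm, h]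
    refine Finset.sum_congr rfl fun i hi => ?_
    rw [Finset.mem_range] at hi
    have h1 : (w.take i).length = i := by simp; omega
    have h2 : (w.drop i).length = n - i := by simp; omega
    rw [Finset.sum_eq_single (i, n - i)]
    · rw [if_pos h1, if_pos h2]
    · rintro ⟨p, q⟩ _ hne
      by_cases hp : i = p
      · rw [if_neg (c := (w.drop i).length = q), mul_zero]
        rw [h2]
        exact fun hq => hne (by rw [hp, ← hq, hp])
      · rw [if_neg (by rwa [h1]), zero_mul]
    · intro hni
      exact absurd (Finset.HasAntidiagonal.mem_antidiagonal.mpr (by dsimp only; omega)) hni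
  · refine (Finset.sum_eq_zero fun p hp => Finset.sum_eq_zero fun i hi => ?_).symm
    rw [Finset.mem_range] at hi
    have hp := Finset.HasAntidiagonal.mem_antidiagonal.mp hp
    by_cases h1 : (w.take i).length = p.1
    · rw [if_neg (c := (w.drop i).length = p.2), mul_zero]
      simp only [List.length_take, List.length_drop] at h1 ⊢
      omega
    · rw [if_neg h1, zero_mul]

theorem level_adE (n : ℕ) (x y : TensorSeries d) :
    level n (adE x y) = ∑ p ∈ antidiagonal n, adE (level p.1 x) (level p.2 y) := by
  simp only [adE_apply, level_sub, level_mul, Finset.sum_sub_distrib]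
  congr 1
  exact Finset.Nat.sum_antidiagonal_swap (f := fun p : ℕ × ℕ => level p.2 y * level p.1 x)

/-- The operator `ad x^{(l₁)} ⋯ ad x^{(lₖ)}`. -/
noncomputable def adLevelsE (l : List ℕ) (x : TensorSeries d) : Module.End ℝ (TensorSeries d) :=
  (l.map fun i => adE (level i x)).prod

theorem adLevelsE_cons (i : ℕ) (l : List ℕ) (x z : TensorSeries d) :
    adLevelsE (i :: l) x z = adE (level i x) (adLevelsE l x z) := by
  rw [adLevelsE, List.map_cons, List.prod_cons]; rfl

theorem coe_adLevelsE (l : List ℕ) (x : TensorSeries d) : ⇑(adLevelsE l x) = adLevels l x := by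
  funext z
  induction l with
  | nil => simp [adLevelsE, adLevels]
  | cons i l ih => rw [adLevelsE_cons, ih]; rfl

theorem prodLevels_nil (x : TensorSeries d) : prodLevels [] x = 1 := rfl

theorem prodLevels_cons (i : ℕ) (l : List ℕ) (x : TensorSeries d) :
    prodLevels (i :: l) x = level i x * prodLevels l x := by
  simp [prodLevels]

theorem prodLevels_append (l l' : List ℕ) (x : TensorSeries d) :
    prodLevels (l ++ l') x = prodLevels l x * prodLevels l' x := by
  simp [prodLevels]

/-- `F` sums over the lists of length `k` to `x`, level by level. -/
def SumsTo (F : List ℕ → TensorSeries d) (k : ℕ) (x : TensorSeries d) : Prop :=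
  ∀ n, ∑ l ∈ listsWithSum k n, F l = level n x

theorem SumsTo.mul {F G : List ℕ → TensorSeries d} {a b : ℕ} {x y : TensorSeries d}
    (hF : SumsTo F a x) (hG : SumsTo G b y) :
    SumsTo (fun l => F (l.take a) * G (l.drop a)) (a + b) (x * y) := fun n => by
  rw [sum_listsWithSum_add a b n fun l l' => F l * G l', level_mul]
  refine Finset.sum_congr rfl fun p _ => ?_
  rw [← hF, ← hG, Finset.sum_mul_sum]

theorem sumsTo_prodLevels (x : TensorSeries d) (k : ℕ) :
    SumsTo (fun l => prodLevels l x) k (x ^ k) := by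
  induction k with
  | zero =>
    intro n
    rw [sum_listsWithSum_zero, pow_zero]
    ext w
    rw [level_apply, one_apply]
    by_cases h : n = 0
    · subst h
      by_cases hw : w = [] <;> simp [hw, prodLevels_nil, one_apply]
    · by_cases hw : w = [] <;> simp [hw, h, Ne.symm h]
  | succ k ih =>
    intro n
    rw [sum_listsWithSum_succ, pow_succ', level_mul]
    refine Finset.sum_congr rfl fun p _ => ?_
    rw [← ih, Finset.mul_sum]
    exact Finset.sum_congr rfl fun l _ => prodLevels_cons _ _ _

theorem sum_adLevelsE (y z : TensorSeries d) (b n : ℕ) :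
    ∑ p ∈ antidiagonal n, ∑ l ∈ listsWithSum b p.1, adLevelsE l y (level p.2 z) =
      level n ((adE y ^ b) z) := by
  induction b generalizing n with
  | zero =>
    simp only [sum_listsWithSum_zero]
    rw [Finset.sum_eq_single (0, n)]
    · simp [adLevelsE]
    · rintro ⟨p, q⟩ hp hne
      rw [if_neg]
      rintro rfl
      exact hne (by simpa using Finset.HasAntidiagonal.mem_antidiagonal.mp hp)
    · simp [Finset.HasAntidiagonal.mem_antidiagonal]
  | succ b ih =>
    simp only [sum_listsWithSum_succ, adLevelsE_cons]
    rw [sum_antidiagonal_assoc n fun r s q => ∑ l ∈ listsWithSum b s,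
      adE (level r y) (adLevelsE l y (level q z)), pow_succ', Module.End.mul_apply, level_adE]
    refine Finset.sum_congr rfl fun p _ => ?_
    rw [← ih, map_sum]
    exact Finset.sum_congr rfl fun q _ => (map_sum _ _ _).symm

/-- Here the entries of the inner factor come first and those of the commutators last, opposite to
`sum_adLevelsE`; hence the swap of the antidiagonal. -/
theorem SumsTo.adLevels {F : List ℕ → TensorSeries d} {a : ℕ} {z : TensorSeries d}
    (hF : SumsTo F a z) (y : TensorSeries d) (b : ℕ) :
    SumsTo (fun l => TensorSeries.adLevels (l.drop a) y (F (l.take a))) (a + b)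
      ((adE y ^ b) z) := fun n => by
  rw [sum_listsWithSum_add a b n fun l l' => TensorSeries.adLevels l' y (F l), ← sum_adLevelsE,
    ← Finset.Nat.sum_antidiagonal_swap]
  refine Finset.sum_congr rfl fun p _ => ?_
  rw [Finset.sum_comm]
  refine Finset.sum_congr rfl fun l _ => ?_
  rw [Prod.fst_swap, ← hF, map_sum, coe_adLevelsE]

end TensorSeries

end JumpMagnus

/-! ### Algebra of the Magnus terms and of the jump terms. -/

namespace JumpMagnus

variable {d : ℕ}

namespace TensorSeries

section Expansions

/-- `x = ∑ₖ aₖ` with `aₖ` of order at least `k`. -/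
structure Expands (x : TensorSeries d) (a : ℕ → TensorSeries d) : Prop where
  mem : ∀ k, a k ∈ fil d k
  sub_sum_mem : ∀ N, x - ∑ k ∈ Finset.range (N + 1), a k ∈ fil d (N + 1)

theorem Expands.mul {x y : TensorSeries d} {a b : ℕ → TensorSeries d} (hx : Expands x a)
    (hy : Expands y b) :
    Expands (x * y) fun k => ∑ p ∈ Finset.HasAntidiagonal.antidiagonal k, a p.1 * b p.2 where
  mem k := Submodule.sum_mem _ fun p hp =>
    Finset.HasAntidiagonal.mem_antidiagonal.mp hp ▸ mul_mem_fil (hx.mem p.1) (hy.mem p.2)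
  sub_sum_mem N := by
    have h1 := mul_mem_fil (hx.sub_sum_mem N) (fil_zero y)
    have h2 := mul_mem_fil (fil_zero (∑ k ∈ Finset.range (N + 1), a k)) (hy.sub_sum_mem N)
    rw [add_zero] at h1
    rw [zero_add] at h2
    have h3 : (∑ k ∈ Finset.range (N + 1), a k) * (∑ k ∈ Finset.range (N + 1), b k) -
        ∑ k ∈ Finset.range (N + 1), ∑ p ∈ Finset.HasAntidiagonal.antidiagonal k, a p.1 * b p.2
          ∈ fil d (N + 1) := by
      intro w hw
      rw [Finset.sum_mul_sum, sub_apply, sub_eq_zero]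
      simp only [sum_apply]
      exact (sum_antidiagonal_eq_sum_square N (fun i j => (a i * b j) w) fun i j hij =>
        mul_mem_fil (hx.mem i) (hy.mem j) w (by omega)).symm
    have h := (fil d (N + 1)).add_mem ((fil d (N + 1)).add_mem h1 h2) h3
    rw [sub_mul, mul_sub] at h
    convert h using 1
    abel

theorem expands_texp {x : TensorSeries d} (hx : x ∈ T0 d) :
    Expands (texp x) fun k => (1 / (k ! : ℝ)) • x ^ k where
  mem k := (fil d k).smul_mem _ (pow_mem_fil hx k)
  sub_sum_mem N := by
    have h := evalS_sub_sum_mem (PowerSeries.exp ℝ) hx N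
    rw [← texp_eq_evalS] at h
    simpa [PowerSeries.coeff_exp] using h

end Expansions

section Vanishing

variable {x : TensorSeries d} {l : List ℕ}

theorem prodLevels_eq_zero (hx : x ∈ T0 d) (h : 0 ∈ l) : prodLevels l x = 0 := by
  refine List.prod_eq_zero (List.mem_map.mpr ⟨0, h, level_zero_of_mem_T0 hx⟩)

theorem adLevels_eq_zero (hx : x ∈ T0 d) (h : 0 ∈ l) (z : TensorSeries d) :
    adLevels l x z = 0 := by
  have h0 : adLevelsE l x = 0 := by
    refine List.prod_eq_zero (List.mem_map.mpr ⟨0, h, ?_⟩)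
    rw [level_zero_of_mem_T0 hx]
    ext1 z
    simp [adE_apply]
  rw [← coe_adLevelsE, h0]
  rfl

theorem adLevels_apply_zero (l : List ℕ) (x : TensorSeries d) : adLevels l x 0 = 0 := by
  rw [← coe_adLevelsE, map_zero]

end Vanishing

/-- The term `B_{k-1} / (k-1)! ad y^{(l₂)} ⋯ ad y^{(lₖ)} (z^{(l₁)})`. -/
noncomputable def magTerm (y z : TensorSeries d) (l : List ℕ) : TensorSeries d :=
  ((bernoulli (l.length - 1) : ℝ) / ((l.length - 1)! : ℝ)) •
    adLevels (l.drop 1) y (prodLevels (l.take 1) z)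

theorem magTerm_singleton (y z : TensorSeries d) (n : ℕ) : magTerm y z [n] = level n z := by
  simp [magTerm, adLevels, prodLevels]

theorem sum_magTerm {y z : TensorSeries d} (hy : y ∈ T0 d) (hz : z ∈ T0 d) {n : ℕ} (hn : 0 < n) :
    ∑ c : Composition n, magTerm y z c.blocks = level n (Had y z) := by
  rw [sum_composition n (magTerm y z)]
  · have hk : ∀ k, ∑ l ∈ listsWithSum (k + 1) n, magTerm y z l =
        level n (PowerSeries.coeff k (bernoulliPowerSeries ℝ) • (adE y ^ k) z) := by
      intro k
      have h1 := sumsTo_prodLevels z 1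
      rw [pow_one] at h1
      rw [level_smul, ← h1.adLevels y k n, add_comm 1 k, Finset.smul_sum]
      refine Finset.sum_congr rfl fun l hl => ?_
      rw [magTerm, (mem_listsWithSum.mp hl).1, Nat.add_sub_cancel]
      simp [bernoulliPowerSeries]
    rw [Finset.sum_range_succ', sum_listsWithSum_zero, if_neg hn.ne', add_zero]
    simp only [hk]
    have h2 := level_eq_zero_of_mem_fil
      (opS_sub_sum_mem (f := bernoulliPowerSeries ℝ) (adE_raising hy) z n)
    -- Lists of length at most `n` give the powers of `ad y` below `n`, while the truncated series
    -- runs up to `n`. The last term is invisible at level `n`, since `z` has order at least one.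
    have h3 : (adE y ^ n) z ∈ fil d (n + 1) := by
      rw [add_comm]
      exact (adE_raising hy).pow_mem (mem_T0_iff_fil.mp hz) n
    rw [level_sub, sub_eq_zero, Finset.sum_range_succ, level_add, level_smul,
      level_eq_zero_of_mem_fil h3, smul_zero, add_zero, level_sum] at h2
    rw [Had_eq_opS, h2]
  · intro l hl
    rw [magTerm]
    rw [← List.take_append_drop 1 l, List.mem_append] at hl
    rcases hl with h | h
    · rw [prodLevels_eq_zero hz h, adLevels_apply_zero, smul_zero]
    · rw [adLevels_eq_zero hy h, smul_zero]

theorem sum_magTerm_of_two_le {y z : TensorSeries d} (hy : y ∈ T0 d) (hz : z ∈ T0 d) {n : ℕ}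
    (hn : 0 < n) : ∑ c : Composition n with 2 ≤ c.length, magTerm y z c.blocks =
      level n (Had y z) - level n z := by
  rw [sum_composition_of_two_le hn, sum_magTerm hy hz hn, magTerm_singleton]

section JumpTerms

variable (x y v : TensorSeries d)

/-- A summand of the jump terms of the Magnus expansion. -/
noncomputable def jumpSummand (l : List ℕ) (i j m : ℕ) : TensorSeries d :=
  ((-1 : ℝ) ^ (i - j) * (bernoulli (l.length - i) : ℝ) /
    (((l.length - i)! : ℝ) * (m ! : ℝ) * ((j - m)! : ℝ) * ((i - j)! : ℝ))) •
  adLevels (l.drop i) v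
    (prodLevels (l.take m) x * prodLevels ((l.take j).drop m) y * prodLevels ((l.take i).drop j) v)

/-- The sum of all jump terms, including those with `(i, m) = (1, 1)`. -/
noncomputable def jumpSum (l : List ℕ) : TensorSeries d :=
  ∑ i ∈ Finset.Icc 1 l.length, ∑ j ∈ Finset.range (i + 1), ∑ m ∈ Finset.range (j + 1),
    jumpSummand x y v l i j m

/-- For `(i, m) = (1, 1)` necessarily `j = 1`, and this single excluded summand is the Magnus term
with `ΔX` in place of `dX`. -/
theorem hJmpTerm_eq (X Y : ℝ → TensorSeries d) {l : List ℕ} (hl : l ≠ []) (u : ℝ) :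
    hJmpTerm X Y l u = jumpSum (jump X u) (Y u) (left Y u) l
      - magTerm (left Y u) (jump X u) l := by
  have h1 : 1 ≤ l.length := List.length_pos_iff.mpr hl
  have h : magTerm (left Y u) (jump X u) l = ∑ i ∈ Finset.Icc 1 l.length,
      ∑ j ∈ Finset.range (i + 1), ∑ m ∈ Finset.range (j + 1), if i = 1 ∧ m = 1 then
        jumpSummand (jump X u) (Y u) (left Y u) l i j m else 0 := by
    rw [Finset.sum_eq_single 1, Finset.sum_eq_single 1, Finset.sum_eq_single 1]
    · simp [magTerm, jumpSummand, prodLevels_nil]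
    · intro m _ hm
      simp [hm]
    · simp
    · intro j hj hj1
      have : j = 0 := by have := Finset.mem_range.mp hj; omega
      subst this
      simp
    · simp
    · intro i _ hi
      simp [hi]
    · simp [h1]
  rw [h, jumpSum, ← Finset.sum_sub_distrib, hJmpTerm]
  refine Finset.sum_congr rfl fun i _ => ?_
  rw [← Finset.sum_sub_distrib]
  refine Finset.sum_congr rfl fun j _ => ?_
  rw [← Finset.sum_sub_distrib]
  refine Finset.sum_congr rfl fun m _ => ?_
  split_ifs
  · rw [sub_self]
  · rw [sub_zero]; rfl

variable {x y v}

theorem sum_jumpSummand {i j m k : ℕ} (hm : m ≤ j) (hj : j ≤ i) (hi : i ≤ k) (n : ℕ) :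
    ∑ l ∈ listsWithSum k n, jumpSummand x y v l i j m =
      ((-1 : ℝ) ^ (i - j) * (bernoulli (k - i) : ℝ) /
        (((k - i)! : ℝ) * (m ! : ℝ) * ((j - m)! : ℝ) * ((i - j)! : ℝ))) •
      level n ((adE v ^ (k - i)) (x ^ m * y ^ (j - m) * v ^ (i - j))) := by
  have h := ((((sumsTo_prodLevels x m).mul (sumsTo_prodLevels y (j - m))).mul
    (sumsTo_prodLevels v (i - j))))
  rw [Nat.add_sub_cancel' hm, Nat.add_sub_cancel' hj] at h
  have h2 := h.adLevels v (k - i) n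
  rw [Nat.add_sub_cancel' hi] at h2
  rw [← h2, Finset.smul_sum]
  refine Finset.sum_congr rfl fun l hl => ?_
  rw [jumpSummand, (mem_listsWithSum.mp hl).1]
  simp only [List.take_take, min_eq_left hm, min_eq_left hj]

/-- The sum is level `n` of `H(ad v)(exp(x) exp(y) exp(-v) - 1)`, and the argument vanishes because
`exp v = exp x exp y`. -/
theorem sum_jumpSum (hx : x ∈ T0 d) (hy : y ∈ T0 d) (hv : v ∈ T0 d)
    (h : texp v = texp x * texp y) (n : ℕ) :
    ∑ c : Composition n, jumpSum x y v c.blocks = 0 := by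
  have hnv : -v ∈ T0 d := (T0 d).neg_mem hv
  have hE := ((expands_texp hx).mul (expands_texp hy)).mul (expands_texp hnv)
  rw [← h, texp_mul_texp_neg hv] at hE
  simp only [Finset.Nat.sum_antidiagonal_eq_sum_range_succ_mk] at hE
  set E : ℕ → TensorSeries d := fun i => ∑ j ∈ Finset.range (i + 1),
    (∑ m ∈ Finset.range (j + 1), (1 / (m ! : ℝ)) • x ^ m * (1 / ((j - m)! : ℝ)) • y ^ (j - m)) *
      (1 / ((i - j)! : ℝ)) • (-v) ^ (i - j) with hEdef
  have hE' : Expands 1 E := hE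
  -- Dropping `E 0 = 1` accounts for the subtracted unit and matches the restriction `1 ≤ i`. The
  -- terms `F i` therefore expand zero.
  set F : ℕ → TensorSeries d := fun i => if i = 0 then 0 else E i with hF
  have hFfil : ∀ i, F i ∈ fil d i := fun i => by
    rw [hF]
    dsimp only
    split_ifs
    · exact (fil d i).zero_mem
    · exact hE'.mem i
  have hFsum : ∑ i ∈ Finset.range (n + 1), F i ∈ fil d (n + 1) := by
    have h1 := (fil d (n + 1)).neg_mem (hE'.sub_sum_mem n)
    rw [Finset.sum_range_succ'] at h1 ⊢
    have hE0 : E 0 = 1 := by simp [hEdef]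
    rw [hE0, neg_sub, add_sub_cancel_right] at h1
    simpa [hF] using h1
  rw [sum_composition n (jumpSum x y v)]
  · have hk : ∀ k, ∑ l ∈ listsWithSum k n, jumpSum x y v l = ∑ p ∈
        Finset.HasAntidiagonal.antidiagonal k,
        PowerSeries.coeff p.2 (bernoulliPowerSeries ℝ) • level n ((adE v ^ p.2) (F p.1)) := by
      intro k
      have e1 : ∑ l ∈ listsWithSum k n, jumpSum x y v l =
          ∑ l ∈ listsWithSum k n, ∑ i ∈ Finset.Icc 1 k, ∑ j ∈ Finset.range (i + 1),
            ∑ m ∈ Finset.range (j + 1), jumpSummand x y v l i j m :=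
        Finset.sum_congr rfl fun l hl => by rw [jumpSum, (mem_listsWithSum.mp hl).1]
      rw [e1, Finset.sum_comm, Finset.Nat.sum_antidiagonal_eq_sum_range_succ_mk]
      have hsub : Finset.Icc 1 k ⊆ Finset.range (k + 1) := fun i hi => by
        simp only [Finset.mem_Icc, Finset.mem_range] at hi ⊢; omega
      rw [← Finset.sum_subset hsub]
      · refine Finset.sum_congr rfl fun i hi => ?_
        rw [Finset.mem_Icc] at hi
        have hi0 : i ≠ 0 := by omega
        rw [Finset.sum_comm]
        simp only [hF, if_neg hi0, hEdef, map_sum, level_sum, Finset.smul_sum, Finset.sum_mul]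
        refine Finset.sum_congr rfl fun j hj => ?_
        rw [Finset.sum_comm]
        refine Finset.sum_congr rfl fun m hm => ?_
        rw [sum_jumpSummand (Nat.lt_succ_iff.mp (Finset.mem_range.mp hm))
          (Nat.lt_succ_iff.mp (Finset.mem_range.mp hj)) hi.2, ← neg_one_smul ℝ v, smul_pow]
        simp only [smul_mul_assoc, mul_smul_comm, map_smul, level_smul, smul_smul]
        congr 1
        simp only [bernoulliPowerSeries, PowerSeries.coeff_mk, map_div₀, map_natCast,
          eq_ratCast]
        field_simp
      · intro i hi hi2
        have : i = 0 := by
          simp only [Finset.mem_Icc, Finset.mem_range] at hi hi2; omega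
        subst this
        have h0 : level n (0 : TensorSeries d) = 0 := map_zero (levelE d n)
        simp [hF, h0]
    simp only [hk]
    -- On the square the sum over `i` can be taken first, inside `(ad v)^b`, where it has order
    -- greater than `n`.
    rw [sum_antidiagonal_eq_sum_square n (fun i b =>
      PowerSeries.coeff b (bernoulliPowerSeries ℝ) • level n ((adE v ^ b) (F i))), Finset.sum_comm]
    · refine Finset.sum_eq_zero fun b _ => ?_
      rw [← Finset.smul_sum, ← level_sum, ← map_sum, level_eq_zero_of_mem_fil, smul_zero]
      exact fil_mono (by omega) ((adE_raising hv).pow_mem hFsum b)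
    · intro i b hib
      rw [level_eq_zero_of_mem_fil, smul_zero]
      exact fil_mono (by omega) ((adE_raising hv).pow_mem (hFfil i) b)
  · intro l hl
    refine Finset.sum_eq_zero fun i hi => Finset.sum_eq_zero fun j hj => Finset.sum_eq_zero
      fun m hm => ?_
    rw [jumpSummand]
    have hm := Nat.lt_succ_iff.mp (Finset.mem_range.mp hm)
    have hj := Nat.lt_succ_iff.mp (Finset.mem_range.mp hj)
    rw [← List.take_append_drop i l, ← List.take_append_drop j (l.take i),
      ← List.take_append_drop m ((l.take i).take j)] at hl
    simp only [List.take_take, min_eq_left hj, min_eq_left hm, List.mem_append] at hl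
    rcases hl with ((hl | hl) | hl) | hl
    · rw [prodLevels_eq_zero hx hl, zero_mul, zero_mul, adLevels_apply_zero, smul_zero]
    · rw [prodLevels_eq_zero hy hl, mul_zero, zero_mul, adLevels_apply_zero, smul_zero]
    · rw [prodLevels_eq_zero hv hl, mul_zero, adLevels_apply_zero, smul_zero]
    · rw [adLevels_eq_zero hv hl, smul_zero]

theorem hJmpTerm_singleton (X Y : ℝ → TensorSeries d) (n : ℕ) (u : ℝ) :
    hJmpTerm X Y [n] u = level n (Y u) - level n (left Y u) := by
  simp [hJmpTerm, Finset.sum_range_succ, adLevels, prodLevels]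
  abel

/-- The sum of the jump terms of the Magnus expansion at a jump time. -/
theorem sum_hJmpTerm {X Y : ℝ → TensorSeries d} {u : ℝ} (hx : jump X u ∈ T0 d) (hy : Y u ∈ T0 d)
    (hv : left Y u ∈ T0 d) (h : texp (left Y u) = texp (jump X u) * texp (Y u)) {n : ℕ}
    (hn : 0 < n) :
    ∑ c : Composition n with 2 ≤ c.length, hJmpTerm X Y c.blocks u =
      level n (left Y u - Y u) - level n (Had (left Y u) (jump X u)) := by
  rw [sum_composition_of_two_le hn fun l => hJmpTerm X Y l u, hJmpTerm_singleton]
  have hc : ∀ c : Composition n, hJmpTerm X Y c.blocks u =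
      jumpSum (jump X u) (Y u) (left Y u) c.blocks - magTerm (left Y u) (jump X u) c.blocks :=
    fun c => hJmpTerm_eq X Y (List.ne_nil_of_length_pos (c.length_pos_of_pos hn)) u
  rw [Finset.sum_congr rfl fun c _ => hc c, Finset.sum_sub_distrib, sum_jumpSum hx hy hv h n,
    sum_magTerm hv hx hn, level_sub]
  abel

end JumpTerms

end TensorSeries

end JumpMagnus

namespace JumpMagnus

variable {d : ℕ} {μ : Measure ℝ} {T : ℝ}

/-! ### Absolute convergence of the jump terms. -/

section Summability

/-- The functions that are bounded on `s`. -/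
def bddOnAlg (s : Set ℝ) : Subalgebra ℝ (ℝ → ℝ) where
  carrier := {f | ∃ C, ∀ u ∈ s, |f u| ≤ C}
  mul_mem' := by
    rintro f g ⟨C, hC⟩ ⟨D, hD⟩
    refine ⟨C * D, fun u hu => ?_⟩
    rw [Pi.mul_apply, abs_mul]
    exact mul_le_mul (hC u hu) (hD u hu) (abs_nonneg _) ((abs_nonneg _).trans (hC u hu))
  add_mem' := by
    rintro f g ⟨C, hC⟩ ⟨D, hD⟩
    exact ⟨C + D, fun u hu => (abs_add_le _ _).trans (add_le_add (hC u hu) (hD u hu))⟩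
  algebraMap_mem' c := ⟨|c|, fun _ _ => le_rfl⟩

/-- The functions that are summable over `s`. -/
def summableOnSub (s : Set ℝ) : Submodule ℝ (ℝ → ℝ) where
  carrier := {f | Summable fun u : s => f u}
  add_mem' := fun hf hg => Summable.add hf hg
  zero_mem' := summable_zero
  smul_mem' := fun c _ hf => Summable.mul_left c hf

theorem mem_summableOnSub {s : Set ℝ} {f : ℝ → ℝ} :
    f ∈ summableOnSub s ↔ Summable fun u : s => f u := Iff.rfl

theorem bddOnAlg_mul_summableOnSub {s : Set ℝ} (f : ℝ → ℝ) (hf : f ∈ bddOnAlg s) (g : ℝ → ℝ)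
    (hg : g ∈ summableOnSub s) : f * g ∈ summableOnSub s := by
  obtain ⟨C, hC⟩ := hf
  have hg : Summable fun u : s => g u := hg
  refine Summable.of_norm_bounded (hg.abs.mul_left C) fun u => ?_
  rw [Pi.mul_apply, norm_mul]
  exact mul_le_mul_of_nonneg_right (hC u u.2) (abs_nonneg _)

theorem IsPrim.mem_bddOnAlg {f p : ℝ → ℝ} (hf : IsPrim μ T f p) : f ∈ bddOnAlg (Ioc 0 T) := by
  refine ⟨|f 0| + ∫ u, |p u| ∂μ, fun u hu => ?_⟩
  rw [hf.eq_add u ⟨hu.1.le, hu.2⟩]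
  exact (abs_add_le _ _).trans (add_le_add le_rfl (hf.abs_setIntegral_le _))

theorem IsPrim.leftLim_mem_bddOnAlg {f p : ℝ → ℝ} (hf : IsPrim μ T f p) :
    Function.leftLim f ∈ bddOnAlg (Ioc 0 T) := by
  refine ⟨|f 0| + ∫ u, |p u| ∂μ, fun u hu => ?_⟩
  rw [hf.leftLim_eq hu]
  exact (abs_add_le _ _).trans (add_le_add le_rfl (hf.abs_setIntegral_le _))

theorem IsPrim.jump_mem_summableOnSub [IsFiniteMeasure μ] {f p : ℝ → ℝ} (hf : IsPrim μ T f p) :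
    (fun u => f u - Function.leftLim f u) ∈ summableOnSub (Ioc 0 T) := by
  have h := (hasSum_atoms hf.integrable (Ioc 0 T)).summable
  exact h.congr fun u => (hf.sub_leftLim u.2).symm

theorem CompDeriv.compIn_bddOnAlg {F ξ : ℝ → TensorSeries d} (h : CompDeriv (IsPrim μ T) F ξ) :
    CompIn (Subalgebra.toSubmodule (bddOnAlg (Ioc 0 T))) F := fun w => (h w).mem_bddOnAlg

theorem CompDeriv.compIn_bddOnAlg_left {F ξ : ℝ → TensorSeries d}
    (h : CompDeriv (IsPrim μ T) F ξ) :
    CompIn (Subalgebra.toSubmodule (bddOnAlg (Ioc 0 T))) (left F) :=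
  fun w => (h w).leftLim_mem_bddOnAlg

theorem CompDeriv.compIn_summableOnSub_jump [IsFiniteMeasure μ] {F ξ : ℝ → TensorSeries d}
    (h : CompDeriv (IsPrim μ T) F ξ) : CompIn (summableOnSub (Ioc 0 T)) (jump F) :=
  fun w => (h w).jump_mem_summableOnSub

namespace CompIn

variable {M : Submodule ℝ (ℝ → ℝ)} {S : Subalgebra ℝ (ℝ → ℝ)} {F G : ℝ → TensorSeries d}

theorem congr (h : CompIn M F) (e : ∀ u, G u = F u) : CompIn M G := by
  rwa [show G = F from funext e]

theorem prodLevels (hF : CompIn (Subalgebra.toSubmodule S) F) (l : List ℕ) :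
    CompIn (Subalgebra.toSubmodule S) (fun u => TensorSeries.prodLevels l (F u)) := by
  induction l with
  | nil => exact CompIn.const 1
  | cons i l ih => exact ((hF.level i).mul ih).congr fun u => prodLevels_cons _ _ _

theorem prodLevels_of_ne_nil (hM : ∀ f ∈ S, ∀ g ∈ M, f * g ∈ M)
    (hF : CompIn (Subalgebra.toSubmodule S) F) (hFM : CompIn M F) {l : List ℕ} (hl : l ≠ []) :
    CompIn M (fun u => TensorSeries.prodLevels l (F u)) := by
  obtain ⟨i, l, rfl⟩ := List.exists_cons_of_ne_nil hl
  exact (mul_right hM (hFM.level i) (hF.prodLevels l)).congr fun u => prodLevels_cons _ _ _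

/-- A telescoping argument: each step replaces one factor and leaves a difference `F - G` of levels.
-/
theorem prodLevels_sub (hM : ∀ f ∈ S, ∀ g ∈ M, f * g ∈ M)
    (hF : CompIn (Subalgebra.toSubmodule S) F) (hG : CompIn (Subalgebra.toSubmodule S) G)
    (hFG : CompIn M fun u => F u - G u) (l : List ℕ) :
    CompIn M (fun u => TensorSeries.prodLevels l (F u) - TensorSeries.prodLevels l (G u)) := by
  induction l with
  | nil => exact CompIn.zero.congr fun u => sub_self _
  | cons i l ih =>
    refine ((mul_right hM (hFG.level i) (hF.prodLevels l)).add
      (mul_left hM (hG.level i) ih)).congr fun u => ?_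
    rw [prodLevels_cons, prodLevels_cons, level_sub, sub_mul, mul_sub]
    abel

end CompIn

theorem sum_alternating_inv_factorial {i : ℕ} (hi : i ≠ 0) :
    ∑ j ∈ Finset.range (i + 1), (-1 : ℝ) ^ (i - j) / ((j ! : ℝ) * ((i - j)! : ℝ)) = 0 := by
  have h := add_pow (1 : ℝ) (-1) i
  rw [add_neg_cancel, zero_pow hi] at h
  have h2 : ∑ j ∈ Finset.range (i + 1), (-1 : ℝ) ^ (i - j) / ((j ! : ℝ) * ((i - j)! : ℝ)) =
      (∑ j ∈ Finset.range (i + 1), (1 : ℝ) ^ j * (-1) ^ (i - j) * (i.choose j : ℝ)) /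
        (i ! : ℝ) := by
    rw [Finset.sum_div]
    refine Finset.sum_congr rfl fun j hj => ?_
    rw [Nat.cast_choose ℝ (Nat.lt_succ_iff.mp (Finset.mem_range.mp hj))]
    have := Nat.factorial_ne_zero i
    field_simp
    simp
  rw [h2, ← h, zero_div]

/-- Summands with `m ≥ 1` contain a factor `ΔX`. Those with `m = 0` need not lie in `M` one by one,
but for fixed `i` their coefficients sum to zero over `j`, as in `(1 - 1)^i`. The product with all
`Y` replaced by `Y_-` does not depend on `j` and can be subtracted, which leaves differences
controlled by the jumps of `Y`. -/
theorem compIn_hJmpTerm {M : Submodule ℝ (ℝ → ℝ)} {S : Subalgebra ℝ (ℝ → ℝ)}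
    (hM : ∀ f ∈ S, ∀ g ∈ M, f * g ∈ M) {X Y : ℝ → TensorSeries d}
    (hX : CompIn (Subalgebra.toSubmodule S) (jump X)) (hXM : CompIn M (jump X))
    (hY : CompIn (Subalgebra.toSubmodule S) Y) (hY' : CompIn (Subalgebra.toSubmodule S) (left Y))
    (hYM : CompIn M (jump Y)) {l : List ℕ} (hl : l ≠ []) : CompIn M (hJmpTerm X Y l) := by
  refine CompIn.sum _ fun i hi => ?_
  have hi0 : i ≠ 0 := by have := (Finset.mem_Icc.mp hi).1; omega
  have hpos : ∀ j ∈ Finset.range (i + 1), ∀ m ∈ Finset.range j, CompIn M fun u =>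
      if i = 1 ∧ m + 1 = 1 then 0 else jumpSummand (jump X u) (Y u) (left Y u) l i j (m + 1) := by
    intro j hj m hm
    split_ifs with h
    · exact CompIn.zero
    · have hne : l.take (m + 1) ≠ [] := by simp [hl]
      exact (CompIn.adLevels hM _ hY' (CompIn.mul_right hM (CompIn.mul_right hM
        (hX.prodLevels_of_ne_nil hM hXM hne) (hY.prodLevels _)) (hY'.prodLevels _))).smul _
  have hzero : CompIn M fun u => ∑ j ∈ Finset.range (i + 1),
      jumpSummand (jump X u) (Y u) (left Y u) l i j 0 := by
    set c : ℕ → ℝ := fun j => (-1 : ℝ) ^ (i - j) * (bernoulli (l.length - i) : ℝ) /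
      (((l.length - i)! : ℝ) * (0 ! : ℝ) * ((j - 0)! : ℝ) * ((i - j)! : ℝ)) with hc
    have h1 : CompIn M fun u => ∑ j ∈ Finset.range (i + 1), c j • adLevels (l.drop i) (left Y u)
        ((prodLevels (l.take j) (Y u) - prodLevels (l.take j) (left Y u)) *
          prodLevels ((l.take i).drop j) (left Y u)) :=
      CompIn.sum _ fun j _ => (CompIn.adLevels hM _ hY' (CompIn.mul_right hM
        (hY.prodLevels_sub hM hY' hYM _) (hY'.prodLevels _))).smul _
    refine h1.congr fun u => ?_
    have hcs : ∑ j ∈ Finset.range (i + 1), c j = 0 := by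
      have h2 : ∀ j, c j = ((bernoulli (l.length - i) : ℝ) / ((l.length - i)! : ℝ)) *
          ((-1 : ℝ) ^ (i - j) / ((j ! : ℝ) * ((i - j)! : ℝ))) := fun j => by
        rw [hc]
        dsimp only
        rw [Nat.sub_zero, Nat.factorial_zero, Nat.cast_one, div_mul_div_comm]
        congr 1 <;> ring
      rw [Finset.sum_congr rfl fun j _ => h2 j, ← Finset.mul_sum,
        sum_alternating_inv_factorial hi0, mul_zero]
    have h3 : ∑ j ∈ Finset.range (i + 1), c j • adLevels (l.drop i) (left Y u)
        (prodLevels (l.take i) (left Y u)) = 0 := by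
      rw [← Finset.sum_smul, hcs, zero_smul]
    rw [← add_zero (∑ j ∈ Finset.range (i + 1), c j • _), ← h3, ← Finset.sum_add_distrib]
    refine Finset.sum_congr rfl fun j hj => ?_
    rw [← smul_add, ← coe_adLevelsE, ← map_add, jumpSummand, coe_adLevelsE]
    have h4 : prodLevels (l.take i) (left Y u) =
        prodLevels (l.take j) (left Y u) * prodLevels ((l.take i).drop j) (left Y u) := by
      rw [← prodLevels_append]
      congr 1
      conv_lhs => rw [← List.take_append_drop j (l.take i)]
      rw [List.take_take, min_eq_left (Nat.lt_succ_iff.mp (Finset.mem_range.mp hj))]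
    rw [h4, sub_mul, sub_add_cancel, List.take_zero, List.drop_zero, prodLevels_nil, one_mul]
  refine ((CompIn.sum _ fun j hj => CompIn.sum _ fun m hm => hpos j hj m hm).add hzero).congr
    fun u => ?_
  rw [← Finset.sum_add_distrib]
  refine Finset.sum_congr rfl fun j _ => ?_
  rw [Finset.sum_range_succ']
  congr 1
  simp only [zero_ne_one, and_false, if_false]
  rfl

end Summability

/-! ### Dependence of the recursion on the lower levels only. -/

section Dependence

/-- The paths compared later are arbitrary and may lack left limits, in which case
`Function.leftLim` is the value at `u`; hence the second hypothesis. -/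
theorem leftLim_congr {f g : ℝ → ℝ} {u : ℝ} (h : f =ᶠ[𝓝[<] u] g) (hu : f u = g u) :
    Function.leftLim f u = Function.leftLim g u := by
  by_cases hf : ∃ y, Tendsto f (𝓝[<] u) (𝓝 y)
  · obtain ⟨y, hy⟩ := hf
    rw [leftLim_eq_of_tendsto hy, leftLim_eq_of_tendsto (hy.congr' h)]
  · rw [leftLim_eq_of_not_tendsto f hf, leftLim_eq_of_not_tendsto g, hu]
    exact fun ⟨y, hy⟩ => hf ⟨y, hy.congr' h.symm⟩

theorem level_left_congr {Y Z : ℝ → TensorSeries d} {k : ℕ}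
    (h : ∀ u ∈ Icc 0 T, level k (Y u) = level k (Z u)) {u : ℝ} (hu : u ∈ Ioc 0 T) :
    level k (left Y u) = level k (left Z u) := by
  ext w
  rw [level_apply, level_apply]
  split_ifs with hw
  · have hYZ : ∀ r ∈ Icc 0 T, Y r w = Z r w := fun r hr => by
      have := congrFun (h r hr) w
      simpa [level, hw] using this
    refine leftLim_congr ?_ (hYZ u ⟨hu.1.le, hu.2⟩)
    filter_upwards [Ioo_mem_nhdsLT hu.1] with r hr
    exact hYZ r ⟨hr.1.le, hr.2.le.trans hu.2⟩
  · rfl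

theorem prodLevels_congr {l : List ℕ} {x y : TensorSeries d}
    (h : ∀ i ∈ l, level i x = level i y) : prodLevels l x = prodLevels l y := by
  rw [prodLevels, prodLevels, List.map_congr_left h]

theorem adLevels_congr {l : List ℕ} {x y : TensorSeries d}
    (h : ∀ i ∈ l, level i x = level i y) : adLevels l x = adLevels l y := by
  rw [← coe_adLevelsE, ← coe_adLevelsE, adLevelsE, adLevelsE,
    List.map_congr_left fun i hi => by rw [h i hi]]

theorem Composition.block_lt {n : ℕ} (c : Composition n) (hc : 2 ≤ c.length) {i : ℕ}
    (hi : i ∈ c.blocks) : i < n := by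
  obtain ⟨s, t, hst⟩ := List.append_of_mem hi
  have hlen : c.blocks.length = s.length + (t.length + 1) := by rw [hst]; simp
  have hsum := c.blocks_sum
  rw [hst, List.sum_append, List.sum_cons] at hsum
  have h1 : s.length ≤ s.sum := List.length_le_sum_of_one_le _ fun j hj =>
    c.blocks_pos (by rw [hst]; simp [hj])
  have h2 : t.length ≤ t.sum := List.length_le_sum_of_one_le _ fun j hj =>
    c.blocks_pos (by rw [hst]; simp [hj])
  have h3 : 2 ≤ c.blocks.length := hc
  omega

end Dependence

end JumpMagnus

namespace JumpMagnus

variable {d : ℕ} {μ : Measure ℝ} {T : ℝ}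

section Dependence

theorem hMag_congr (X : ℝ → TensorSeries d) {Y Z : ℝ → TensorSeries d} {t : ℝ} {l : List ℕ}
    (h : ∀ u ∈ Ioc t T, ∀ k ∈ l, level k (left Y u) = level k (left Z u)) :
    hMag T X Y t l = hMag T X Z t l := by
  cases l with
  | nil => rfl
  | cons a l =>
    refine congrArg (_ • ·) ?_
    ext w
    refine Finset.sum_congr rfl fun k _ => Finset.sum_congr rfl fun v _ => ?_
    refine VectorMeasure.setIntegral_congr_fun fun u hu => ?_
    dsimp only
    rw [adLevels_congr fun i hi => h u hu i (List.mem_cons_of_mem _ hi)]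

theorem hJmpTerm_congr (X : ℝ → TensorSeries d) {Y Z : ℝ → TensorSeries d} {u : ℝ} {l : List ℕ}
    (h : ∀ k ∈ l, level k (Y u) = level k (Z u))
    (h' : ∀ k ∈ l, level k (left Y u) = level k (left Z u)) :
    hJmpTerm X Y l u = hJmpTerm X Z l u := by
  have h1 : ∀ i, adLevels (l.drop i) (left Y u) = adLevels (l.drop i) (left Z u) := fun i =>
    adLevels_congr fun k hk => h' k (List.mem_of_mem_drop hk)
  have h2 : ∀ j m, prodLevels ((l.take j).drop m) (Y u) = prodLevels ((l.take j).drop m) (Z u) :=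
    fun j m => prodLevels_congr fun k hk => h k (List.mem_of_mem_take (List.mem_of_mem_drop hk))
  have h3 : ∀ j m, prodLevels ((l.take j).drop m) (left Y u) =
      prodLevels ((l.take j).drop m) (left Z u) :=
    fun j m => prodLevels_congr fun k hk => h' k (List.mem_of_mem_take (List.mem_of_mem_drop hk))
  simp only [hJmpTerm, h1, h2, h3]

theorem hJmp_congr (X : ℝ → TensorSeries d) {Y Z : ℝ → TensorSeries d} {t : ℝ} {l : List ℕ}
    (h : ∀ u ∈ Ioc t T, ∀ k ∈ l, level k (Y u) = level k (Z u))
    (h' : ∀ u ∈ Ioc t T, ∀ k ∈ l, level k (left Y u) = level k (left Z u)) :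
    hJmp T X Y t l = hJmp T X Z t l := by
  have : ∀ u : Ioc t T, hJmpTerm X Y l u = hJmpTerm X Z l u := fun u =>
    hJmpTerm_congr X (h u u.2) (h' u u.2)
  ext w
  exact tsum_congr fun u => congrFun (this u) w

/-- The right-hand side of the Magnus recursion depends on the lower levels only. -/
theorem magnusRHS_congr (X : ℝ → TensorSeries d) {Y Z : ℝ → TensorSeries d} {n : ℕ}
    (h : ∀ u ∈ Icc 0 T, ∀ k < n, level k (Y u) = level k (Z u)) {t : ℝ} (ht : t ∈ Icc 0 T) :
    magnusRHS T X Y n t = magnusRHS T X Z n t := by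
  have hsub : Ioc t T ⊆ Ioc 0 T := Ioc_subset_Ioc_left ht.1
  have hl : ∀ u ∈ Ioc t T, ∀ k < n, level k (left Y u) = level k (left Z u) := fun u hu k hk =>
    level_left_congr (fun r hr => h r hr k hk) (hsub hu)
  have hr : ∀ u ∈ Ioc t T, ∀ k < n, level k (Y u) = level k (Z u) := fun u hu =>
    h u ⟨(hsub hu).1.le, hu.2⟩
  have hc : ∀ c ∈ Finset.univ.filter fun c : Composition n => 2 ≤ c.length,
      hMag T X Y t c.blocks + hJmp T X Y t c.blocks =
        hMag T X Z t c.blocks + hJmp T X Z t c.blocks := by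
    intro c hc
    have hc2 : ∀ i ∈ c.blocks, i < n := fun i hi =>
      Composition.block_lt c (Finset.mem_filter.mp hc).2 hi
    rw [hMag_congr X fun u hu k hk => hl u hu k (hc2 k hk),
      hJmp_congr X (fun u hu k hk => hr u hu k (hc2 k hk)) fun u hu k hk => hl u hu k (hc2 k hk)]
  exact congrArg (_ + ·) (Finset.sum_congr rfl hc)

end Dependence

theorem CompIn.summable {F : ℝ → TensorSeries d} {s t : Set ℝ} (h : CompIn (summableOnSub t) F)
    (hst : s ⊆ t) (w : List (Fin d)) : Summable fun u : s => F u w :=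
  (mem_summableOnSub.mp (h w)).comp_injective (inclusion_injective hst)

/-! ### The jump Magnus expansion of the log-signature. -/

namespace Driver

variable {X x : ℝ → TensorSeries d} {t u : ℝ}

theorem summable_hJmpTerm (D : Driver μ T X x) (ht : 0 ≤ t) {l : List ℕ} (hl : l ≠ [])
    (w : List (Fin d)) : Summable fun u : Ioc t T => hJmpTerm X (logSig T X) l u w := by
  have := D.finite
  obtain ⟨ψ, hψ, -⟩ := D.exists_density_logSig
  have h : CompIn (summableOnSub (Ioc 0 T)) (hJmpTerm X (logSig T X) l) :=
    compIn_hJmpTerm bddOnAlg_mul_summableOnSub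
      (D.compDeriv.compIn_bddOnAlg.sub D.compDeriv.compIn_bddOnAlg_left)
      D.compDeriv.compIn_summableOnSub_jump hψ.compIn_bddOnAlg hψ.compIn_bddOnAlg_left
      hψ.compIn_summableOnSub_jump hl
  exact h.summable (Ioc_subset_Ioc_left ht) w

theorem compDeriv_level {F ξ : ℝ → TensorSeries d} (h : CompDeriv (IsPrim μ T) F ξ) (n : ℕ) :
    CompDeriv (IsPrim μ T) (fun t => level n (F t)) (fun t => level n (ξ t)) := by
  intro w
  by_cases hw : w.length = n
  · simpa [level, hw] using h w
  · simpa [level, hw] using IsPrim.const (μ := μ) (T := T) 0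

theorem opIntegrable_adLevels (D : Driver μ T X x) (ls : List ℕ) (n : ℕ) {s t : ℝ} :
    OpIntegrable T (fun u => adLevels ls (left (logSig T X) u)) (fun u => level n (X u)) s t :=
  D.opIntegrable (compDeriv_level D.compDeriv n) fun v =>
    CompIn.adLevels bddAlg_mul_mem ls D.compIn_left_logSig (CompIn.const (e v))

theorem level_mem_T0 {y : TensorSeries d} (hy : y ∈ T0 d) (n : ℕ) : level n y ∈ T0 d := by
  refine TensorSeries.mem_T0.mpr ?_
  rw [level_apply, TensorSeries.mem_T0.mp hy, ite_self]

theorem adLevelsE_mem_fil {y : TensorSeries d} (hy : y ∈ T0 d) (l : List ℕ) {n : ℕ}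
    {z : TensorSeries d} (hz : z ∈ fil d n) : adLevelsE l y z ∈ fil d n := by
  induction l with
  | nil => exact hz
  | cons i l ih =>
    rw [adLevelsE_cons]
    exact fil_mono (Nat.le_succ n) (adE_raising (level_mem_T0 hy i) _ _ ih)

theorem compIn_magTerm (D : Driver μ T X x) (l : List ℕ) (hl : l ≠ []) :
    CompIn (l1Sub μ) fun u => magTerm (left (logSig T X) u) (x u) l := by
  obtain ⟨i, l, rfl⟩ := List.exists_cons_of_ne_nil hl
  refine CompIn.smul _ (CompIn.adLevels bddAlg_mul_l1Sub _ D.compIn_left_logSig ?_)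
  exact (D.compDeriv.compIn_density.level i).congr fun u => by simp [prodLevels]

theorem hMag_apply (D : Driver μ T X x) (ht : 0 ≤ t) {l : List ℕ} (hl : l ≠ [])
    (w : List (Fin d)) : hMag T X (logSig T X) t l w =
      ∫ u in Ioc t T, magTerm (left (logSig T X) u) (x u) l w ∂μ := by
  obtain ⟨i, l, rfl⟩ := List.exists_cons_of_ne_nil hl
  have h := (opIntegral_eq D.nonneg D.null (compDeriv_level D.compDeriv i) (s := t) (t := T)
    (A := fun u => adLevelsE l (left (logSig T X) u))
    (fun u hu n z hz => adLevelsE_mem_fil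
      (D.left_logSig_mem_T0 (Ioc_subset_Ioc_left ht hu)) l hz)
    (by simpa only [coe_adLevelsE] using D.opIntegrable_adLevels l i) w).2
  simp only [coe_adLevelsE] at h
  rw [hMag, smul_apply, h, ← integral_const_mul]
  refine integral_congr_ae (Eventually.of_forall fun u => ?_)
  simp [magTerm, prodLevels]

/-- The jump Magnus expansion. -/
theorem level_logSig (D : Driver μ T X x) {n : ℕ} (hn : 0 < n) (ht : t ∈ Icc 0 T) :
    level n (logSig T X t) = magnusRHS T X (logSig T X) n t := by
  have := D.finite
  have hsub : Ioc t T ⊆ Ioc 0 T := Ioc_subset_Ioc_left ht.1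
  set Ω := logSig T X with hΩ
  set H : ℝ → TensorSeries d := fun u => Had (left Ω u) (x u) with hH
  have hHint : CompIn (l1Sub μ) H :=
    CompIn.Had bddAlg_mul_l1Sub D.compIn_left_logSig D.compDeriv.compIn_density
  have hne : ∀ c : Composition n, c.blocks ≠ [] := fun c =>
    List.ne_nil_of_length_pos (c.length_pos_of_pos hn)
  have hΩl : ∀ u ∈ Ioc t T, left Ω u ∈ T0 d := fun u hu => D.left_logSig_mem_T0 (hsub hu)
  ext w
  have hmag : ∑ c : Composition n with 2 ≤ c.length, hMag T X Ω t c.blocks w =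
      ∫ u in Ioc t T, (level n (H u) w - level n (x u) w) ∂μ := by
    rw [Finset.sum_congr rfl fun c _ => D.hMag_apply ht.1 (hne c) w, ← integral_finsetSum]
    · refine setIntegral_congr_fun measurableSet_Ioc fun u hu => ?_
      rw [← sub_apply, hH, ← sum_magTerm_of_two_le (hΩl u hu) (D.mem_T0 u) hn, sum_apply]
    · exact fun c _ => (D.compIn_magTerm _ (hne c) w).integrableOn
  have hjmp : ∑ c : Composition n with 2 ≤ c.length, hJmp T X Ω t c.blocks w =
      ∑' u : Ioc t T, (level n (hausdorffJump X Ω u) w -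
        level n (Had (left Ω u) (jump X u)) w) := by
    simp only [hJmp]
    rw [← Summable.tsum_finsetSum fun c _ => D.summable_hJmpTerm ht.1 (hne c) w]
    refine tsum_congr fun u => ?_
    have hu := hsub u.2
    rw [← sub_apply, D.hausdorffJump_eq hu, ← sum_hJmpTerm (D.jump_mem_T0 hu)
      (logSig_mem_T0 _) (hΩl u u.2) (D.texp_left_logSig hu) hn, sum_apply]
  rw [magnusRHS, add_apply, sum_apply]
  simp only [add_apply]
  rw [Finset.sum_add_distrib, hmag, hjmp]
  simp only [level_apply]
  split_ifs with hw
  · obtain ⟨hs, heq⟩ := D.hausdorff ht w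
    rw [← hΩ] at hs heq
    -- The Magnus integrals run over all of `μ`, and the jump terms subtract `H(ad Ω_-)(ΔX)`, the
    -- integral over the atoms. What remains is the integral against the continuous part in the
    -- Hausdorff equation.
    have hHjump : HasSum (fun u : Ioc t T => Had (left Ω u) (jump X u) w)
        (∫ u in Ioc t T ∩ atoms μ, H u w ∂μ) := by
      refine (hasSum_atoms (hHint w) (Ioc t T)).congr_fun fun u => ?_
      rw [D.compDeriv.jump_eq (hsub u.2), Had_eq_opS, map_smul, smul_apply, ← Had_eq_opS]
    rw [heq, hs.tsum_sub hHjump.summable, hHjump.tsum_eq, sub_apply,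
      (D.prim w).sub_eq ht.1 ht.2 le_rfl,
      integral_sub (hHint w).integrableOn (D.prim w).integrable.integrableOn,
      D.opIntegral_Had D.compIn_left_logSig hΩl D.compDeriv_contPart]
    have h1 : ∫ u in Ioc t T, Had (left Ω u) ((atoms μ)ᶜ.indicator x u) w ∂μ =
        ∫ u in Ioc t T \ atoms μ, H u w ∂μ := by
      rw [sdiff_eq, ← setIntegral_indicator (measurableSet_atoms μ).compl]
      refine integral_congr_ae (Eventually.of_forall fun u => ?_)
      by_cases h0 : u ∈ atoms μ
      · simp [h0, Had_eq_opS]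
      · simp [h0, hH]
    have h2 := integral_inter_add_sdiff (measurableSet_atoms μ)
      ((hHint w).integrableOn (s := Ioc t T))
    rw [h1, ← h2]
    ring
  · simp

end Driver

end JumpMagnus

namespace JumpMagnus

variable {d : ℕ} {μ : Measure ℝ} {T : ℝ}

/-! ### Closed subspaces and the Lie property. -/

section Closedness

variable {W : Submodule ℝ (TensorSeries d)} {N : ℕ}

/-- A subspace containing all series of high order is the set of zeros of functionals depending
on finitely many components only. -/
theorem exists_forall_apply_eq_zero (hW : fil d (N + 1) ≤ W) :
    ∃ π : Module.End ℝ (TensorSeries d), (∀ x, x ∈ W ↔ ∀ w, π x w = 0) ∧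
      ∀ x w, π x w = ∑ k ∈ Finset.range (N + 1), ∑ v : Fin k → Fin d,
        π (e (List.ofFn v)) w * x (List.ofFn v) := by
  -- The projection onto a complement along `W` kills all series of order above `N`, so it factors
  -- through finitely many words.
  obtain ⟨q, hq⟩ := W.exists_isCompl
  have hker : ∀ x, x ∈ W ↔ (q.subtype ∘ₗ q.projectionOnto W hq.symm) x = 0 := fun x => by
    rw [LinearMap.comp_apply, Submodule.subtype_apply, ZeroMemClass.coe_eq_zero,
      Submodule.projectionOnto_apply_eq_zero_iff]
  refine ⟨q.subtype ∘ₗ q.projectionOnto W hq.symm, fun x => ?_, fun x w => ?_⟩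
  · rw [hker x]
    exact ⟨fun h w => by rw [h, zero_apply], fun h => ext h⟩
  · have h := (hker _).mp (hW (sub_sum_words_mem x N))
    rw [map_sub, sub_eq_zero] at h
    rw [h, map_sum, sum_apply]
    refine Finset.sum_congr rfl fun k _ => ?_
    rw [map_sum, sum_apply]
    refine Finset.sum_congr rfl fun v _ => ?_
    rw [map_smul, smul_apply, mul_comm]

theorem integral_mem {ν : Measure ℝ} (hW : fil d (N + 1) ≤ W) {p : ℝ → TensorSeries d}
    (hp : ∀ w, Integrable (fun u => p u w) ν) (h : ∀ᵐ u ∂ν, p u ∈ W) {y : TensorSeries d}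
    (hy : ∀ w, y w = ∫ u, p u w ∂ν) : y ∈ W := by
  obtain ⟨π, h1, h2⟩ := exists_forall_apply_eq_zero hW
  refine (h1 y).mpr fun w => ?_
  have h3 : ∫ u, π (p u) w ∂ν = 0 := by
    rw [← integral_zero ℝ ℝ (μ := ν)]
    refine integral_congr_ae ?_
    filter_upwards [h] with u hu
    exact (h1 _).mp hu w
  rw [← h3, h2]
  simp only [h2 (p _)]
  rw [integral_finsetSum _ fun k _ => integrable_finsetSum _ fun v _ => (hp _).const_mul _]
  refine Finset.sum_congr rfl fun k _ => ?_
  rw [integral_finsetSum _ fun v _ => (hp _).const_mul _]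
  refine Finset.sum_congr rfl fun v _ => ?_
  rw [integral_const_mul, hy]

theorem HasLeft.mem (hW : fil d (N + 1) ≤ W) {F : ℝ → TensorSeries d} {l : TensorSeries d} {u : ℝ}
    (hl : HasLeft F l u) (h : ∀ᶠ t in 𝓝[<] u, F t ∈ W) : l ∈ W := by
  obtain ⟨π, h1, h2⟩ := exists_forall_apply_eq_zero hW
  refine (h1 l).mpr fun w => ?_
  have h3 : Tendsto (fun t => π (F t) w) (𝓝[<] u) (𝓝 (π l w)) := by
    rw [h2 l w, funext fun t => h2 (F t) w]
    exact tendsto_finsetSum _ fun k _ => tendsto_finsetSum _ fun v _ => (hl _).const_mul _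
  refine tendsto_nhds_unique h3 (tendsto_const_nhds.congr' ?_)
  filter_upwards [h] with t ht
  exact ((h1 _).mp ht w).symm

/-- Each functional defining `W` turns the path into the zero function on `[0, T]`, whose density is
zero almost everywhere; there is one functional per word, hence countably many. -/
theorem density_mem [IsFiniteMeasure μ] (hT : 0 ≤ T) (hμ : μ (Ioc 0 T)ᶜ = 0)
    (hW : fil d (N + 1) ≤ W) {F ξ : ℝ → TensorSeries d} (hF : CompDeriv (IsPrim μ T) F ξ)
    (h : ∀ t ∈ Icc 0 T, F t ∈ W) : ∀ᵐ u ∂μ, ξ u ∈ W := by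
  obtain ⟨π, h1, h2⟩ := exists_forall_apply_eq_zero hW
  have h3 : ∀ w, ∀ᵐ u ∂μ, π (ξ u) w = 0 := fun w => by
    have hp : IsPrim μ T (fun t => π (F t) w) (fun u => π (ξ u) w) := by
      rw [funext fun t => h2 (F t) w, funext fun t => h2 (ξ t) w]
      refine IsPrim.sum _ fun k _ => IsPrim.sum _ fun v _ => ?_
      exact ⟨(hF _).integrable.const_mul _, fun t ht => by
        rw [(hF _).eq_add t ht, integral_const_mul, mul_add]⟩
    exact (hp.congr_on hT fun t ht => (h1 _).mp (h t ht) w).density_unique hT hμ (IsPrim.const 0)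
  filter_upwards [ae_all_iff.mpr h3] with u hu
  exact (h1 _).mpr hu

end Closedness

section Lie

open TensorSeries

variable {L : LieSubalgebra ℝ (TensorSeries d)}

/-- The series agreeing with an element of `L` below level `n`. -/
noncomputable def lieMod (L : LieSubalgebra ℝ (TensorSeries d)) (n : ℕ) :
    Submodule ℝ (TensorSeries d) :=
  L.toSubmodule ⊔ fil d n

theorem fil_le_lieMod (n : ℕ) : fil d n ≤ lieMod L n := le_sup_right

theorem lieMod_anti {m n : ℕ} (h : m ≤ n) : lieMod L n ≤ lieMod L m :=
  sup_le_sup_left (fun _ hx => fil_mono h hx) _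

/-- The gain of one order comes from `y` having no scalar component: an error of order `n + 1` in
`x` becomes one of order `n + 2` in the bracket. The inductions on the order rest on this. -/
theorem adE_mem_lieMod (hL : L.toSubmodule ≤ T0 d) {n : ℕ} {x y : TensorSeries d}
    (hx : x ∈ lieMod L (n + 1)) (hy : y ∈ lieMod L (n + 2)) : adE x y ∈ lieMod L (n + 2) := by
  obtain ⟨a, ha, r, hr, rfl⟩ := Submodule.mem_sup.mp hx
  obtain ⟨b, hb, s, hs, rfl⟩ := Submodule.mem_sup.mp hy
  have hab : adE a b ∈ L.toSubmodule := L.lie_mem ha hb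
  have hrest : adE (a + r) (b + s) - adE a b ∈ fil d (n + 2) := by
    have e1 : adE (a + r) (b + s) - adE a b = adE r b + adE (a + r) s := by
      simp only [adE_apply]; noncomm_ring
    have hr0 : r ∈ T0 d := mem_T0_iff_fil.mpr (fil_mono (by omega) hr)
    have hb1 := mem_T0_iff_fil.mp (hL hb)
    rw [e1]
    refine Submodule.add_mem _ ?_ ?_
    · rw [adE_apply]
      have h1 := mul_mem_fil hr hb1
      have h2 := mul_mem_fil hb1 hr
      rw [add_comm] at h2
      exact Submodule.sub_mem _ h1 h2
    · exact fil_mono (by omega) (adE_raising ((T0 d).add_mem (hL ha) hr0) _ _ hs)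
  rw [← sub_add_cancel (adE (a + r) (b + s)) (adE a b)]
  exact Submodule.add_mem _ (Submodule.mem_sup_right hrest) (Submodule.mem_sup_left hab)

theorem lieMod_succ_le_T0 (hL : L.toSubmodule ≤ T0 d) (n : ℕ) : lieMod L (n + 1) ≤ T0 d :=
  sup_le hL fun _ hx => mem_T0_iff_fil.mpr (fil_mono (by omega) hx)

theorem Had_mem_lieMod (hL : L.toSubmodule ≤ T0 d) {n : ℕ} {x y : TensorSeries d}
    (hx : x ∈ lieMod L (n + 1)) (hy : y ∈ lieMod L (n + 2)) : Had x y ∈ lieMod L (n + 2) := by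
  have h := opS_sub_sum_mem (f := bernoulliPowerSeries ℝ)
    (adE_raising (lieMod_succ_le_T0 hL n hx)) y (n + 1)
  rw [← Had_eq_opS] at h
  rw [← sub_add_cancel (Had x y) (∑ k ∈ Finset.range (n + 1 + 1),
    PowerSeries.coeff k (bernoulliPowerSeries ℝ) • (adE x ^ k) y)]
  refine Submodule.add_mem _ (fil_le_lieMod _ h) (Submodule.sum_mem _ fun k _ =>
    Submodule.smul_mem _ _ ?_)
  induction k with
  | zero => simpa using hy
  | succ k ih =>
    rw [pow_succ', Module.End.mul_apply]
    exact adE_mem_lieMod hL hx (ih (by simp_all; omega))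

/-- The difference is `∫₀¹ H(ad log(exp(θ x) g))(x) dθ`, for which the logarithms are needed to one
order less. -/
theorem tlog_sub_mem_lieMod (hL : L.toSubmodule ≤ T0 d) {n : ℕ} {x g : TensorSeries d}
    (hg : g [] = 1) (hx : x ∈ lieMod L (n + 2))
    (h : ∀ θ : ℝ, tlog (texp (θ • x) * g) ∈ lieMod L (n + 1)) :
    tlog (texp x * g) - tlog g ∈ lieMod L (n + 2) := by
  refine integral_mem (ν := volume.restrict (Ioc (0 : ℝ) 1)) (fil_le_lieMod (n + 2))
    (p := fun θ => Had (tlog (texp (θ • x) * g)) x) (fun w => ?_)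
    (Eventually.of_forall fun θ => Had_mem_lieMod hL (h θ) hx) fun w => ?_
  · exact (intervalIntegrable_iff_integrableOn_Ioc_of_le zero_le_one).mp
      ((continuous_Had_tlog x g w).intervalIntegrable 0 1)
  · rw [sub_apply, ← integral_Had_tlog (lieMod_succ_le_T0 hL (n + 1) hx) hg,
      intervalIntegral.integral_of_le zero_le_one]

/-- The Baker-Campbell-Hausdorff series of Lie elements is Lie. -/
theorem tlog_mem_lieMod (hL : L.toSubmodule ≤ T0 d) {n : ℕ} {x g : TensorSeries d}
    (hg : g [] = 1) (hx : x ∈ lieMod L (n + 1)) (h : tlog g ∈ lieMod L (n + 1)) :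
    tlog (texp x * g) ∈ lieMod L (n + 1) := by
  induction n generalizing x with
  | zero => exact fil_le_lieMod _ (mem_T0_iff_fil.mp (tlog_mem_T0 _))
  | succ n ih =>
    rw [← sub_add_cancel (tlog (texp x * g)) (tlog g)]
    refine Submodule.add_mem _ (tlog_sub_mem_lieMod hL hg hx fun θ => ?_) h
    exact ih (Submodule.smul_mem _ _ (lieMod_anti (by omega) hx)) (lieMod_anti (by omega) h)

theorem lieSpan_le_T0 {V : Submodule ℝ (TensorSeries d)} (hV : V ≤ T0 d) :
    (LieSubalgebra.lieSpan ℝ (TensorSeries d) (V : Set (TensorSeries d))).toSubmodule ≤ T0 d := by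
  let K : LieSubalgebra ℝ (TensorSeries d) :=
    { T0 d with
      lie_mem' := fun {x y} hx hy => by
        have hx : x [] = 0 := hx
        have hy : y [] = 0 := hy
        change (x * y - y * x) [] = 0
        rw [sub_apply, mul_apply_nil, mul_apply_nil, hx, hy, sub_self] }
  have : LieSubalgebra.lieSpan ℝ (TensorSeries d) (V : Set (TensorSeries d)) ≤ K :=
    LieSubalgebra.lieSpan_le.mpr hV
  exact this

theorem mem_lieSeries_iff {V : Submodule ℝ (TensorSeries d)} {x : TensorSeries d} :
    x ∈ lieSeries V ↔ ∀ n, x ∈ lieMod (LieSubalgebra.lieSpan ℝ (TensorSeries d)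
      (V : Set (TensorSeries d))) (n + 1) := by
  refine forall_congr' fun N => ⟨?_, fun h => ?_⟩
  · rintro ⟨y, hy, h⟩
    rw [← add_sub_cancel y x]
    refine Submodule.add_mem _ (Submodule.mem_sup_left hy) (fil_le_lieMod _ fun w hw => ?_)
    rw [sub_apply, h w (Nat.le_of_lt_succ hw), sub_self]
  · obtain ⟨y, hy, r, hr, rfl⟩ := Submodule.mem_sup.mp h
    exact ⟨y, hy, fun w hw => by rw [add_apply, hr w (Nat.lt_succ_of_le hw), add_zero]⟩

end Lie

/-- Induction on the order for the density `ψ` of `Ω`: off the atoms it is `-H(ad Ω)(x)`, and at an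
atom it is a multiple of the jump of `Ω`, which `tlog_sub_mem_lieMod` controls. Integrating from `t`
to `T` returns `-Ω_t`. -/
theorem Driver.logSig_mem_lieSeries {X x : ℝ → TensorSeries d} (D : Driver μ T X x)
    {V : Submodule ℝ (TensorSeries d)} (hV : V ≤ T0 d) (hX : ∀ t ∈ Icc 0 T, X t ∈ V) {t : ℝ}
    (ht : t ∈ Icc 0 T) : logSig T X t ∈ lieSeries V := by
  have := D.finite
  rw [mem_lieSeries_iff]
  set L := LieSubalgebra.lieSpan ℝ (TensorSeries d) (V : Set (TensorSeries d)) with hLdef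
  have hL : L.toSubmodule ≤ T0 d := lieSpan_le_T0 hV
  have hVL : ∀ n, V ≤ lieMod L n := fun n y hy =>
    Submodule.mem_sup_left (LieSubalgebra.subset_lieSpan hy)
  intro n
  induction n generalizing t with
  | zero => exact fil_le_lieMod _ (mem_T0_iff_fil.mp (logSig_mem_T0 t))
  | succ n ih =>
    obtain ⟨ψ, hψ, hψ2⟩ := D.exists_density_logSig
    have hx : ∀ᵐ u ∂μ, x u ∈ lieMod L (n + 2) :=
      density_mem D.nonneg D.null (fil_le_lieMod (n + 2)) D.compDeriv fun t ht => hVL _ (hX t ht)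
    have hjump : ∀ u ∈ Ioc 0 T, jump X u ∈ lieMod L (n + 2) := fun u hu => by
      refine Submodule.sub_mem _ (hVL _ (hX u ⟨hu.1.le, hu.2⟩)) ?_
      refine (D.compDeriv.hasLeft hu).mem (fil_le_lieMod (n + 2)) ?_
      filter_upwards [Ioo_mem_nhdsLT hu.1] with r hr
      exact hVL _ (hX r ⟨hr.1.le, hr.2.le.trans hu.2⟩)
    have hψmem : ∀ᵐ u ∂μ, ψ u ∈ lieMod L (n + 2) := by
      filter_upwards [hψ2, hx, D.ae_mem] with u h1 h2 hu
      have hu' : u ∈ Icc 0 T := ⟨hu.1.le, hu.2⟩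
      by_cases h0 : μ {u} = 0
      · rw [h1 h0]
        exact Submodule.neg_mem _ (Had_mem_lieMod hL (ih hu') h2)
      · have h3 : μ.real {u} ≠ 0 := ENNReal.toReal_ne_zero.mpr ⟨h0, measure_ne_top _ _⟩
        rw [← Submodule.smul_mem_iff _ h3, ← hψ.jump_eq hu, jump, ← neg_sub]
        refine Submodule.neg_mem _ ?_
        rw [D.left_logSig hu]
        refine tlog_sub_mem_lieMod hL (D.sig_apply_nil hu') (hjump u hu) fun θ => ?_
        exact tlog_mem_lieMod hL (D.sig_apply_nil hu')
          (Submodule.smul_mem _ _ (lieMod_anti (by omega) (hjump u hu))) (ih hu')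
    rw [← neg_mem_iff]
    refine integral_mem (ν := μ.restrict (Ioc t T)) (fil_le_lieMod (n + 2))
      (fun w => (hψ w).integrable.integrableOn) (ae_restrict_of_ae hψmem) fun w => ?_
    have h := (hψ w).sub_eq ht.1 ht.2 le_rfl
    rw [D.logSig_self, zero_apply, zero_sub] at h
    rw [neg_apply, h]

end JumpMagnus

/-! ### Conclusion. -/

theorem theorem5p1 {d : ℕ} (T : ℝ) (hT : 0 ≤ T) (X : ℝ → TensorSeries d) (hX : IsBVPath T X) :
    -- the signature `Sig(X)_{s,·}` is well defined, and the log-signature is càdlàg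
    (∀ s ∈ Icc 0 T, IsSignature T X s (sig T X s) ∧
      ∀ S, IsSignature T X s S → EqOn S (sig T X s) (Icc s T)) ∧
    (∀ w, IsCadlagOn (fun t => logSig T X t w) 0 T) ∧
    -- the jump-extended Hausdorff equation, with absolutely convergent jump sum
    {u ∈ Ioc 0 T | jump X u ≠ 0}.Countable ∧
    (∀ t ∈ Icc 0 T,
      OpIntegrable T (fun u => Had (left (logSig T X) u)) (contPart X) t T ∧
      ∀ w, Summable (fun u : Ioc t T => |hausdorffJump X (logSig T X) u w|) ∧
        logSig T X t w =
          opIntegral T (fun u => Had (left (logSig T X) u)) (contPart X) t T w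
            + ∑' u : Ioc t T, hausdorffJump X (logSig T X) u w) ∧
    -- without jumps: the jump sum vanishes and Hausdorff's equation remains
    ((∀ w, ContinuousOn (fun t => X t w) (Icc 0 T)) → ∀ t ∈ Icc 0 T,
      (∀ w, ∑' u : Ioc t T, hausdorffJump X (logSig T X) u w = 0) ∧
      logSig T X t = opIntegral T (fun u => Had (logSig T X u)) X t T) ∧
    -- (i) the jump Magnus expansion
    (∀ t ∈ Icc 0 T, level 1 (logSig T X t) = level 1 (X T - X t)) ∧
    (∀ n : ℕ, 2 ≤ n → ∀ t ∈ Icc 0 T,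
      (∀ c : Composition n, 2 ≤ c.length → ∀ (l : ℕ) (ls : List ℕ), c.blocks = l :: ls →
        OpIntegrable T (fun u => adLevels ls (left (logSig T X) u))
          (fun u => level l (X u)) t T) ∧
      (∀ c : Composition n, 2 ≤ c.length → ∀ w,
        Summable (fun u : Ioc t T => |hJmpTerm X (logSig T X) c.blocks u w|)) ∧
      level n (logSig T X t) = magnusRHS T X (logSig T X) n t) ∧
    -- its right-hand side depends on the lower levels only
    (∀ n : ℕ, 2 ≤ n → ∀ Y Z : ℝ → TensorSeries d,
      (∀ u ∈ Icc 0 T, ∀ k < n, level k (Y u) = level k (Z u)) →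
      ∀ t ∈ Icc 0 T, magnusRHS T X Y n t = magnusRHS T X Z n t) ∧
    -- (ii) the log-signature is Lie in every linear subspace in which the path takes its values
    (∀ V : Submodule ℝ (TensorSeries d), V ≤ T0 d → (∀ t ∈ Icc 0 T, X t ∈ V) →
      ∀ t ∈ Icc 0 T, logSig T X t ∈ lieSeries V ∧ sig T X t T ∈ texp '' lieSeries V) := by
  obtain ⟨μ, x, D⟩ := exists_driver hT hX
  obtain ⟨ψ, hψ, -⟩ := D.exists_density_logSig
  refine ⟨fun s hs => ⟨D.isSignature_sig hs, fun S hS => D.signature_unique hs hS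
    (D.isSignature_sig hs)⟩, fun w => (hψ w).isCadlagOn, D.countable_jumps, fun t ht =>
    ⟨D.opIntegrable_Had D.compIn_left_logSig D.compDeriv_contPart, fun w =>
      ⟨(D.hausdorff ht w).1.abs, (D.hausdorff ht w).2⟩⟩, fun hc t ht => ?_, fun t ht => ?_,
    fun n hn t ht => ⟨fun c _ l ls _ => D.opIntegrable_adLevels ls l, fun c _ w => ?_,
      D.level_logSig (by omega) ht⟩,
    fun n _ Y Z h t ht => magnusRHS_congr X h ht, fun V hV hXV t ht => ?_⟩
  · have hj : ∀ u ∈ Ioc 0 T, jump X u = 0 := fun u hu => TensorSeries.ext fun w => by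
      have h := (hc w u ⟨hu.1.le, hu.2⟩).mono_left (nhdsWithin_le_of_mem
        (mem_of_superset (Ioo_mem_nhdsLT hu.1) fun r hr => ⟨hr.1.le, hr.2.le.trans hu.2⟩))
      exact sub_eq_zero.mpr (leftLim_eq_of_tendsto h).symm
    obtain ⟨h1, h2⟩ := D.hausdorff_of_jump_eq_zero hj ht
    refine ⟨fun w => ?_, h2⟩
    simp [h1 _ (Subtype.coe_prop _)]
  · have h : (Finset.univ.filter fun c : Composition 1 => 2 ≤ c.length) = ∅ :=
      Finset.filter_eq_empty_iff.mpr fun c _ h => absurd (h.trans c.length_le) (by norm_num)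
    rw [D.level_logSig one_pos ht, magnusRHS, h, Finset.sum_empty, add_zero]
  · exact (D.summable_hJmpTerm ht.1
      (List.ne_nil_of_length_pos (c.length_pos_of_pos (by omega))) w).abs
  · have h := D.logSig_mem_lieSeries hV hXV ht
    exact ⟨h, logSig T X t, h, texp_tlog (D.sig_apply_nil ht)⟩
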